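/- The infinite grid has the points $\mathbb Z^2$; its edges join points at distance one on a common row or a common column. A $B_2$-EPG representation of a finite graph $G$ assigns to every vertex $u$ a path $P_u$ of the grid with at most two bends such that two distinct vertices are adjacent in $G$ if and only if their paths share a grid edge. A vertex $u$ is a Z-vertex of the representation if there are exactly two rows and exactly one column that contain at least one edge of $P_u$. Theorem. There is an algorithm that, given a $B_2$-EPG representation of a graph $G$ in which every vertex is a Z-vertex, computes the size of a maximum clique of $G$ in polynomial time. More precisely, there are a program of a random access machine with integer cells, whose elementary operations are indirect memory access, addition, subtraction and comparison, each of unit cost, and a polynomial $p$ such that the following holds. Let $G$ be a graph with vertices $0,\dots,n-1$ and with a $B_2$-EPG representation in which every vertex is a Z-vertex. Given as input the number $n$ and, for each vertex in turn, the coordinates of the two ends and of the bends of its path, in their order along the path, the program halts after at most $p(n)$ steps with the output $\omega(G)$, the maximum size of a clique of $G$. -/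

import Mathlib

namespace EPG

/-! ### Paths on the grid and their intersection graphs -/

/-- The infinite rectangular grid. The point `(x, y)` lies on column `x` and on row `y`; two points
are joined by a grid edge when they are at distance one on a common row or a common column. -/
def grid : SimpleGraph (ℤ × ℤ) where
  Adj p q := (p.1 = q.1 ∧ |p.2 - q.2| = 1) ∨ (p.2 = q.2 ∧ |p.1 - q.1| = 1)
  symm := ⟨fun p q h => by rwa [abs_sub_comm q.2, abs_sub_comm q.1, eq_comm (a := q.1),
    eq_comm (a := q.2)]⟩
  loopless := ⟨fun p h => by simp at h⟩

/-- The points of a list at which the polygonal line through the list turns. -/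
def bendPoints : List (ℤ × ℤ) → List (ℤ × ℤ)
  | p :: q :: r :: l =>
    if (p.1 = q.1 ∧ q.1 = r.1) ∨ (p.2 = q.2 ∧ q.2 = r.2) then bendPoints (q :: r :: l)
    else q :: bendPoints (q :: r :: l)
  | _ => []

/-- A (simple) path on the grid. -/
structure GridPath where
  src : ℤ × ℤ
  tgt : ℤ × ℤ
  walk : grid.Walk src tgt
  isPath : walk.IsPath

namespace GridPath

/-- The number of bends of a grid path. -/
def numBends (P : GridPath) : ℕ := (bendPoints P.walk.support).length

/-- The first end of the path, then its bends in order, then its last end. -/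
def corners (P : GridPath) : List (ℤ × ℤ) :=
  P.src :: (bendPoints P.walk.support ++ [P.tgt])

/-- The rows that contain at least one edge of the path. -/
def rows (P : GridPath) : Set ℤ := {a | ∃ e ∈ P.walk.edges, ∀ p ∈ e, p.2 = a}

/-- The columns that contain at least one edge of the path. -/
def cols (P : GridPath) : Set ℤ := {a | ∃ e ∈ P.walk.edges, ∀ p ∈ e, p.1 = a}

/-- The path intersects exactly two rows and exactly one column. -/
def IsZ (P : GridPath) : Prop := P.rows.ncard = 2 ∧ P.cols.ncard = 1

end GridPath

/-- A `B_k`-EPG representation of `G`: every vertex is a grid path with at most `k` bends, and two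
distinct vertices are adjacent exactly when their paths share a grid edge. -/
structure BendRep {V : Type*} (k : ℕ) (G : SimpleGraph V) where
  path : V → GridPath
  bends_le : ∀ v, (path v).numBends ≤ k
  adj_iff : ∀ u v, G.Adj u v ↔
    u ≠ v ∧ ∃ e, e ∈ (path u).walk.edges ∧ e ∈ (path v).walk.edges

/-- A representation given to an algorithm: the number of vertices, followed, vertex by vertex, by
the two coordinates of each corner of its path. -/
def BendRep.encode {k n : ℕ} {G : SimpleGraph (Fin n)} (R : BendRep k G) : List ℤ :=
  (n : ℤ) :: (List.finRange n).flatMap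
    (fun v => (R.path v).corners.flatMap (fun p => [p.1, p.2]))

/-! ### Random access machines with a step count

Programs work on a memory of integer cells with indirect addressing. The only arithmetic is
addition, subtraction and comparison, each of unit cost, so that in `t` steps the bit length of the
numbers grows by at most `O(t)`, and polynomial time means the same as for Turing machines. -/

/-- A memory: one integer cell for each integer address. -/
abbrev Mem := ℤ → ℤ

/-- The memory that holds the list `l` in the cells `0, 1, 2, …` and zeros elsewhere. -/
def Mem.ofList (l : List ℤ) : Mem := fun a => if 0 ≤ a then l.getD a.toNat 0 else 0

/-- Expressions. `load e` is the content of the cell whose address is the value of `e`. -/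
inductive Expr where
  | const (c : ℤ)
  | load (e : Expr)
  | add (e f : Expr)
  | sub (e f : Expr)
  | lt (e f : Expr)

namespace Expr

/-- The value of an expression. -/
def eval (M : Mem) : Expr → ℤ
  | const c => c
  | load e => M (eval M e)
  | add e f => eval M e + eval M f
  | sub e f => eval M e - eval M f
  | lt e f => if eval M e < eval M f then 1 else 0

/-- The number of elementary operations used to evaluate an expression. -/
def cost : Expr → ℕ
  | const _ => 1
  | load e => cost e + 1
  | add e f => cost e + cost f + 1
  | sub e f => cost e + cost f + 1
  | lt e f => cost e + cost f + 1

end Expr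

/-- Programs. `store e f` writes the value of `f` into the cell whose address is the value of `e`;
a test `e` succeeds when the value of `e` is positive. -/
inductive Program where
  | skip
  | store (e f : Expr)
  | seq (c d : Program)
  | ite (e : Expr) (c d : Program)
  | loop (e : Expr) (c : Program)

/-- `Runs c M t M'`: started on the memory `M`, the program `c` halts after exactly `t` steps with
the memory `M'`. -/
inductive Runs : Program → Mem → ℕ → Mem → Prop where
  | skip (M : Mem) : Runs Program.skip M 1 M
  | store (e f : Expr) (M : Mem) :
      Runs (Program.store e f) M (e.cost + f.cost + 1)
        (Function.update M (e.eval M) (f.eval M))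
  | seq {c d : Program} {M M' M'' : Mem} {s t : ℕ} (hc : Runs c M s M') (hd : Runs d M' t M'') :
      Runs (Program.seq c d) M (s + t) M''
  | ite_pos {e : Expr} {c : Program} (d : Program) {M M' : Mem} {t : ℕ} (he : 0 < e.eval M)
      (hc : Runs c M t M') : Runs (Program.ite e c d) M (e.cost + 1 + t) M'
  | ite_neg {e : Expr} (c : Program) {d : Program} {M M' : Mem} {t : ℕ} (he : ¬ 0 < e.eval M)
      (hd : Runs d M t M') : Runs (Program.ite e c d) M (e.cost + 1 + t) M'
  | loop_pos {e : Expr} {c : Program} {M M' M'' : Mem} {s t : ℕ} (he : 0 < e.eval M)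
      (hc : Runs c M s M') (hl : Runs (Program.loop e c) M' t M'') :
      Runs (Program.loop e c) M (e.cost + 1 + s + t) M''
  | loop_neg {e : Expr} (c : Program) {M : Mem} (he : ¬ 0 < e.eval M) :
      Runs (Program.loop e c) M (e.cost + 1) M

end EPG

/-! A path with at most two bends that uses two rows and one column runs horizontally, vertically,
horizontally, so five integers describe it (`ZShape`). The core of the proof is `Track.covered`:
every clique lies in the union of two cliques from an explicit family of polynomial size. The
members of the family are the candidates `Cand T₁ T₂ T₃`. Each of their three intervals has a kind,
a line and two ends, and apart from the kind these numbers are doubled input coordinates up to a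
shift by one. The program therefore runs through all pairs of candidates, discards the pairs in
which one of the two sets is not a clique, and finds a maximum clique inside each remaining union.
The complement of a union of two cliques is bipartite, so this is a maximum independent set in a
bipartite graph. An auction finds it, and its final prices supply the dual certificate, as in
König's theorem.

For the covering, a row segment is treated as an interval of positions that includes the bend. Two
paths in different columns share an edge exactly when they meet on some row, and paths in one column
that have a common row always meet there. If two rows suffice for the clique, and the paths on only
one of them meet there pairwise, then one point on each row pierces all paths (`exists_two_points`).
Paths through one position lie in a candidate built from a single edge or from three edges at a grid
point (`exists_isCand_of_position`). The same holds for paths in one column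
(`exists_isCand_of_column`). If two paths have the same rows `r` and `s` but do not meet on `r`
(`Apart`), then every path uses `r` or `s`. Either the argument for two rows applies, or three such
pairs sit on three rows and the whole clique lies in one candidate with proper intervals
(`covered_of_triangle`). If there is no such pair, then two rows suffice, or two columns suffice, or
four distinct rows would overlap in each of their three splittings into pairs, which is impossible.

The algorithm is written in a small language with counted loops. The language is compiled to the
machine with a polynomial time bound read off the syntax, and loop invariants prove its correctness.
-/

namespace EPG

/-! ### The polygonal line of a grid path -/

/-- The grid edge between `(x, y)` and `(x + 1, y)`. -/
def hEdge (x y : ℤ) : Sym2 (ℤ × ℤ) := s((x, y), (x + 1, y))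

/-- The grid edge between `(x, y)` and `(x, y + 1)`. -/
def vEdge (x y : ℤ) : Sym2 (ℤ × ℤ) := s((x, y), (x, y + 1))

theorem hEdge_inj {x y x' y' : ℤ} : hEdge x y = hEdge x' y' ↔ x = x' ∧ y = y' := by
  simp only [hEdge, Sym2.eq_iff, Prod.mk.injEq]; omega

theorem vEdge_inj {x y x' y' : ℤ} : vEdge x y = vEdge x' y' ↔ x = x' ∧ y = y' := by
  simp only [vEdge, Sym2.eq_iff, Prod.mk.injEq]; omega

theorem hEdge_ne_vEdge {x y x' y' : ℤ} : hEdge x y ≠ vEdge x' y' := by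
  simp only [hEdge, vEdge, ne_eq, Sym2.eq_iff, Prod.mk.injEq]; omega

/-- `Axis true p q`: the points lie on a common row; `Axis false p q`: on a common column. -/
def Axis : Bool → ℤ × ℤ → ℤ × ℤ → Prop
  | true, p, q => p.2 = q.2 ∧ p.1 ≠ q.1
  | false, p, q => p.1 = q.1 ∧ p.2 ≠ q.2

/-- The edges of the axis-parallel segment between two points. -/
def seg : Bool → ℤ × ℤ → ℤ × ℤ → Set (Sym2 (ℤ × ℤ))
  | true, p, q => {e | ∃ x, e = hEdge x p.2 ∧ min p.1 q.1 ≤ x ∧ x < max p.1 q.1}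
  | false, p, q => {e | ∃ y, e = vEdge p.1 y ∧ min p.2 q.2 ≤ y ∧ y < max p.2 q.2}

/-- `q` is the first grid point after `p` on the segment from `p` to `r`. -/
def Leads : Bool → ℤ × ℤ → ℤ × ℤ → ℤ × ℤ → Prop
  | true, p, q, r =>
    q.2 = p.2 ∧ (q.1 = p.1 + 1 ∧ q.1 ≤ r.1 ∨ q.1 = p.1 - 1 ∧ r.1 ≤ q.1)
  | false, p, q, r =>
    q.1 = p.1 ∧ (q.2 = p.2 + 1 ∧ q.2 ≤ r.2 ∨ q.2 = p.2 - 1 ∧ r.2 ≤ q.2)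

/-- The polygonal line through a list of corners, with alternating directions, the set of its edges
and the first grid point after its first end. -/
inductive Polyline : Bool → ℤ × ℤ → List (ℤ × ℤ) → Set (Sym2 (ℤ × ℤ)) → Prop
  | last (h : Bool) (p q r : ℤ × ℤ) (ha : Axis h p r) (hl : Leads h p q r) :
      Polyline h q [p, r] (seg h p r)
  | cons (h : Bool) (p q r s : ℤ × ℤ) (l : List (ℤ × ℤ)) (S : Set (Sym2 (ℤ × ℤ)))
      (ha : Axis h p r) (hl : Leads h p q r) (hp : Polyline (!h) s (r :: l) S) :
      Polyline h q (p :: r :: l) (seg h p r ∪ S)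

theorem grid_adj_iff {p q : ℤ × ℤ} : grid.Adj p q ↔
    (p.1 = q.1 ∧ (p.2 = q.2 + 1 ∨ q.2 = p.2 + 1)) ∨
      (p.2 = q.2 ∧ (p.1 = q.1 + 1 ∨ q.1 = p.1 + 1)) := by
  simp only [grid, abs_eq (zero_le_one' ℤ)]; omega

theorem sym2_eq_hEdge_or_vEdge {p q : ℤ × ℤ} (h : grid.Adj p q) :
    (p.2 = q.2 ∧ s(p, q) = hEdge (min p.1 q.1) p.2 ∧ max p.1 q.1 = min p.1 q.1 + 1) ∨
      (p.1 = q.1 ∧ s(p, q) = vEdge p.1 (min p.2 q.2) ∧ max p.2 q.2 = min p.2 q.2 + 1) := by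
  obtain ⟨x, y⟩ := p
  obtain ⟨x', y'⟩ := q
  simp only [grid_adj_iff] at h
  simp only [hEdge, vEdge, Sym2.eq_iff, Prod.mk.injEq] at h ⊢
  rcases h with ⟨h, h' | h'⟩ | ⟨h, h' | h'⟩ <;> subst h h' <;> simp

/-- Only a common row of `q` and `r` is required, so `q = r` is allowed. `polyline_single` needs
this degenerate case. -/
theorem seg_unit_true {p q r : ℤ × ℤ} (hg : grid.Adj p q) (hl : Leads true p q r)
    (ha : q.2 = r.2) : seg true p r = {s(p, q)} ∪ seg true q r := by
  obtain ⟨x, y⟩ := p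
  obtain ⟨x', y'⟩ := q
  obtain ⟨x'', y''⟩ := r
  have hh := sym2_eq_hEdge_or_vEdge hg
  simp only [Leads, grid_adj_iff] at hl hg hh ha
  ext e
  simp only [seg, Set.mem_ofPred_eq, Set.mem_union, Set.mem_singleton_iff]
  rcases hh with ⟨h1, h2, h3⟩ | hh
  · rw [h2]
    constructor
    · rintro ⟨z, rfl, hz⟩
      by_cases hz' : z = min x x'
      · left; rw [hz']
      · right; exact ⟨z, by rw [h1], by omega⟩
    · rintro (rfl | ⟨z, rfl, hz⟩)
      · exact ⟨_, rfl, by omega⟩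
      · exact ⟨z, by rw [h1], by omega⟩
  · omega

theorem seg_unit_false {p q r : ℤ × ℤ} (hg : grid.Adj p q) (hl : Leads false p q r)
    (ha : q.1 = r.1) : seg false p r = {s(p, q)} ∪ seg false q r := by
  obtain ⟨x, y⟩ := p
  obtain ⟨x', y'⟩ := q
  obtain ⟨x'', y''⟩ := r
  have hh := sym2_eq_hEdge_or_vEdge hg
  simp only [Leads, grid_adj_iff] at hl hg hh ha
  ext e
  simp only [seg, Set.mem_ofPred_eq, Set.mem_union, Set.mem_singleton_iff]
  rcases hh with hh | ⟨h1, h2, h3⟩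
  · omega
  · rw [h2]
    constructor
    · rintro ⟨z, rfl, hz⟩
      by_cases hz' : z = min y y'
      · left; rw [hz']
      · right; exact ⟨z, by rw [h1], by omega⟩
    · rintro (rfl | ⟨z, rfl, hz⟩)
      · exact ⟨_, rfl, by omega⟩
      · exact ⟨z, by rw [h1], by omega⟩

theorem seg_unit {h : Bool} {p q r : ℤ × ℤ} (hg : grid.Adj p q) (hl : Leads h p q r)
    (ha : Axis h q r) : seg h p r = {s(p, q)} ∪ seg h q r := by
  cases h
  · exact seg_unit_false hg hl ha.1
  · exact seg_unit_true hg hl ha.1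

theorem seg_self (h : Bool) (p : ℤ × ℤ) : seg h p p = ∅ := by
  cases h <;> · ext e; simp [seg]

theorem polyline_single {p q : ℤ × ℤ} (hg : grid.Adj p q) :
    ∃ h, Axis h p q ∧ Leads h p q q ∧ seg h p q = {s(p, q)} := by
  rcases (grid_adj_iff.1 hg).symm with ⟨h1, h2⟩ | ⟨h1, h2⟩
  · have hl : Leads true p q q := ⟨h1.symm, by omega⟩
    refine ⟨true, ⟨h1, by omega⟩, hl, ?_⟩
    rw [seg_unit_true hg hl rfl, seg_self, Set.union_empty]
  · have hl : Leads false p q q := ⟨h1.symm, by omega⟩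
    refine ⟨false, ⟨h1, by omega⟩, hl, ?_⟩
    rw [seg_unit_false hg hl rfl, seg_self, Set.union_empty]

/-- A collinear step that does not return to `q` continues in the direction of the first segment, so
the corner `p` is replaced by `o`. -/
theorem Polyline.extend {h : Bool} {o p q : ℤ × ℤ} {l : List (ℤ × ℤ)} {S : Set (Sym2 (ℤ × ℤ))}
    (hp : Polyline h q (p :: l) S) (hg : grid.Adj o p) (hne : o ≠ q)
    (hc : (o.1 = p.1 ∧ p.1 = q.1) ∨ (o.2 = p.2 ∧ p.2 = q.2)) :
    Polyline h p (o :: l) ({s(o, p)} ∪ S) := by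
  have key : ∀ r, Axis h p r → Leads h p q r → Axis h o r ∧ Leads h o p r := by
    intro r ha hl
    have hg' := grid_adj_iff.1 hg
    have hne' : ¬ (o.1 = q.1 ∧ o.2 = q.2) := fun h => hne (Prod.ext h.1 h.2)
    cases h <;> simp only [Axis, Leads] at * <;> omega
  cases hp with
  | last _ _ _ r ha hl =>
    rw [← seg_unit hg (key _ ha hl).2 ha]
    exact Polyline.last _ _ _ _ (key _ ha hl).1 (key _ ha hl).2
  | cons _ _ _ r s l S ha hl hp =>
    rw [← Set.union_assoc, ← seg_unit hg (key _ ha hl).2 ha]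
    exact Polyline.cons _ _ _ _ _ _ _ (key _ ha hl).1 (key _ ha hl).2 hp

theorem Polyline.turn {h : Bool} {o p q : ℤ × ℤ} {l : List (ℤ × ℤ)} {S : Set (Sym2 (ℤ × ℤ))}
    (hp : Polyline h q (p :: l) S) (hg : grid.Adj o p)
    (hc : ¬ ((o.1 = p.1 ∧ p.1 = q.1) ∨ (o.2 = p.2 ∧ p.2 = q.2))) :
    Polyline (!h) p (o :: p :: l) ({s(o, p)} ∪ S) := by
  obtain ⟨h', ha', hl', hs'⟩ := polyline_single hg
  obtain ⟨r, hl⟩ : ∃ r, Leads h p q r := by cases hp <;> exact ⟨_, by assumption⟩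
  have : h' = !h := by
    cases h <;> cases h' <;> simp [Axis, Leads] at * <;> omega
  subst this
  rw [← hs']
  exact Polyline.cons _ _ _ _ q _ _ ha' hl' (by simpa using hp)

/-- Induction along the walk, each edge either lengthening the first segment or opening a new one.
Simplicity of the path serves only to exclude an immediate reversal. -/
theorem exists_polyline {u v : ℤ × ℤ} (w : grid.Walk u v) (hw : w.IsPath) (hn : 0 < w.length) :
    ∃ h q, (∃ l, w.support = u :: q :: l) ∧
      Polyline h q (u :: (bendPoints w.support ++ [v])) {e | e ∈ w.edges} := by
  induction w with
  | nil => simp at hn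
  | @cons u p v hg w ih =>
    cases w with
    | nil =>
      obtain ⟨h, ha, hl, hs⟩ := polyline_single hg
      refine ⟨h, p, ⟨[], by simp⟩, ?_⟩
      have := Polyline.last h u p p ha hl
      rw [hs] at this
      simpa [bendPoints] using this
    | @cons _ q _ hg' w =>
      obtain ⟨h, q', ⟨l, hl⟩, hp⟩ := ih hw.of_cons (by simp)
      have hq : q' = q := by
        have := hl
        simp only [SimpleGraph.Walk.support_cons, List.cons.injEq, true_and] at this
        cases w <;> simp_all
      subst hq
      have hsup : (SimpleGraph.Walk.cons hg (SimpleGraph.Walk.cons hg' w)).support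
          = u :: p :: q' :: l := by
        rw [SimpleGraph.Walk.support_cons, hl]
      have hne : u ≠ q' := by
        have := hw.support_nodup
        rw [hsup] at this
        rintro rfl
        simp at this
      have hE : {e | e ∈ (SimpleGraph.Walk.cons hg (SimpleGraph.Walk.cons hg' w)).edges} =
          {s(u, p)} ∪ {e | e ∈ (SimpleGraph.Walk.cons hg' w).edges} := by
        ext e; simp
      rw [hE, hsup]
      rw [hl] at hp
      by_cases hc : (u.1 = p.1 ∧ p.1 = q'.1) ∨ (u.2 = p.2 ∧ p.2 = q'.2)
      · refine ⟨h, p, ⟨_, rfl⟩, ?_⟩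
        rw [show bendPoints (u :: p :: q' :: l) = bendPoints (p :: q' :: l) by
          rw [bendPoints, if_pos hc]]
        exact hp.extend hg hne hc
      · refine ⟨!h, p, ⟨_, rfl⟩, ?_⟩
        rw [show bendPoints (u :: p :: q' :: l) = p :: bendPoints (p :: q' :: l) by
          rw [bendPoints, if_neg hc]]
        exact hp.turn hg hc

end EPG

/-! ### Paths with three segments and their common edges. -/

namespace EPG

/-- The data of a path with three segments, the first and the last of which are horizontal: it runs
from `(e, a)` over `(c, a)` and `(c, b)` to `(f, b)`. -/
structure ZShape where
  e : ℤ
  c : ℤ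
  f : ℤ
  a : ℤ
  b : ℤ
  he : e ≠ c
  hf : c ≠ f
  hab : a ≠ b

namespace ZShape

/-- The grid edges of the path. -/
def edges (z : ZShape) : Set (Sym2 (ℤ × ℤ)) :=
  seg true (z.e, z.a) (z.c, z.a) ∪
    (seg false (z.c, z.a) (z.c, z.b) ∪ seg true (z.c, z.b) (z.f, z.b))

/-- Two nondegenerate segments on a line overlap. -/
def Ov (p q p' q' : ℤ) : Prop := min p q < max p' q' ∧ min p' q' < max p q

/-- Two paths share a grid edge. -/
def Share (u v : ZShape) : Prop :=
  (u.a = v.a ∧ Ov u.e u.c v.e v.c) ∨ (u.a = v.b ∧ Ov u.e u.c v.f v.c) ∨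
    (u.b = v.a ∧ Ov u.f u.c v.e v.c) ∨ (u.b = v.b ∧ Ov u.f u.c v.f v.c) ∨
      (u.c = v.c ∧ Ov u.a u.b v.a v.b)

theorem hEdge_mem_edges {z : ZShape} {x y : ℤ} : hEdge x y ∈ z.edges ↔
    (y = z.a ∧ min z.e z.c ≤ x ∧ x < max z.e z.c) ∨
      (y = z.b ∧ min z.f z.c ≤ x ∧ x < max z.f z.c) := by
  simp only [edges, seg, Set.mem_union, Set.mem_ofPred_eq, hEdge_ne_vEdge, false_and, exists_false,
    false_or, hEdge_inj, min_comm z.c z.f, max_comm z.c z.f]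
  constructor
  · rintro (⟨_, ⟨rfl, rfl⟩, h⟩ | ⟨_, ⟨rfl, rfl⟩, h⟩)
    · exact .inl ⟨rfl, h⟩
    · exact .inr ⟨rfl, h⟩
  · rintro (⟨rfl, h⟩ | ⟨rfl, h⟩)
    · exact .inl ⟨_, ⟨rfl, rfl⟩, h⟩
    · exact .inr ⟨_, ⟨rfl, rfl⟩, h⟩

theorem vEdge_mem_edges {z : ZShape} {x y : ℤ} : vEdge x y ∈ z.edges ↔
    x = z.c ∧ min z.a z.b ≤ y ∧ y < max z.a z.b := by
  simp only [edges, seg, Set.mem_union, Set.mem_ofPred_eq, hEdge_ne_vEdge.symm, false_and,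
    exists_false, false_or, or_false, vEdge_inj]
  constructor
  · rintro ⟨_, ⟨rfl, rfl⟩, h⟩
    exact ⟨rfl, h⟩
  · rintro ⟨rfl, h⟩
    exact ⟨_, ⟨rfl, rfl⟩, h⟩

theorem eq_hEdge_or_vEdge {z : ZShape} {s : Sym2 (ℤ × ℤ)} (h : s ∈ z.edges) :
    (∃ x y, s = hEdge x y) ∨ ∃ x y, s = vEdge x y := by
  rcases h with ⟨x, rfl, -⟩ | ⟨x, rfl, -⟩ | ⟨x, rfl, -⟩
  · exact .inl ⟨_, _, rfl⟩
  · exact .inr ⟨_, _, rfl⟩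
  · exact .inl ⟨_, _, rfl⟩

theorem share_iff_exists_edge {u v : ZShape} : Share u v ↔ ∃ s, s ∈ u.edges ∧ s ∈ v.edges := by
  have hu := u.he
  have hu' := u.hf
  have hu'' := u.hab
  have hv := v.he
  have hv' := v.hf
  have hv'' := v.hab
  constructor
  · rintro (⟨h, h', h''⟩ | ⟨h, h', h''⟩ | ⟨h, h', h''⟩ | ⟨h, h', h''⟩ | ⟨h, h', h''⟩)
    -- The overlap of two segments begins at the larger of the two lower ends.
    · exact ⟨hEdge (max (min u.e u.c) (min v.e v.c)) u.a, hEdge_mem_edges.2 (by omega),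
        hEdge_mem_edges.2 (by omega)⟩
    · exact ⟨hEdge (max (min u.e u.c) (min v.f v.c)) u.a, hEdge_mem_edges.2 (by omega),
        hEdge_mem_edges.2 (by omega)⟩
    · exact ⟨hEdge (max (min u.f u.c) (min v.e v.c)) u.b, hEdge_mem_edges.2 (by omega),
        hEdge_mem_edges.2 (by omega)⟩
    · exact ⟨hEdge (max (min u.f u.c) (min v.f v.c)) u.b, hEdge_mem_edges.2 (by omega),
        hEdge_mem_edges.2 (by omega)⟩
    · exact ⟨vEdge u.c (max (min u.a u.b) (min v.a v.b)), vEdge_mem_edges.2 (by omega),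
        vEdge_mem_edges.2 (by omega)⟩
  · rintro ⟨s, hs, hs'⟩
    unfold Share Ov
    rcases eq_hEdge_or_vEdge hs with ⟨x, y, rfl⟩ | ⟨x, y, rfl⟩
    · rw [hEdge_mem_edges] at hs hs'
      rcases hs with ⟨h, hs⟩ | ⟨h, hs⟩ <;> rcases hs' with ⟨h', hs'⟩ | ⟨h', hs'⟩
      · exact .inl (by omega)
      · exact .inr (.inl (by omega))
      · exact .inr (.inr (.inl (by omega)))
      · exact .inr (.inr (.inr (.inl (by omega))))
    · rw [vEdge_mem_edges] at hs hs'
      exact .inr (.inr (.inr (.inr (by omega))))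

end ZShape

theorem row_eq_of_mem_seg_true {p q : ℤ × ℤ} {s : Sym2 (ℤ × ℤ)} (hs : s ∈ seg true p q) {a : ℤ}
    (ha : ∀ r ∈ s, r.2 = a) : a = p.2 := by
  obtain ⟨x, rfl, -⟩ := hs
  exact (ha _ (Sym2.mem_mk_left _ _)).symm

theorem not_row_of_mem_seg_false {p q : ℤ × ℤ} {s : Sym2 (ℤ × ℤ)} (hs : s ∈ seg false p q) {a : ℤ}
    (ha : ∀ r ∈ s, r.2 = a) : False := by
  obtain ⟨x, rfl, -⟩ := hs
  have h1 := ha _ (Sym2.mem_mk_left _ _)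
  have h2 := ha _ (Sym2.mem_mk_right _ _)
  simp only at h1 h2
  omega

/-- Two bends leave at most three alternating segments. Among these shapes only horizontal,
vertical, horizontal has horizontal edges on more than one row. -/
theorem GridPath.exists_zShape (P : GridPath) (hb : P.numBends ≤ 2) (hz : P.IsZ) :
    ∃ z : ZShape, P.corners = [(z.e, z.a), (z.c, z.a), (z.c, z.b), (z.f, z.b)] ∧
      ∀ s, s ∈ P.walk.edges ↔ s ∈ z.edges := by
  have hrow : ∀ a, ¬ P.rows ⊆ {a} := by
    intro a ha
    have := Set.ncard_le_ncard ha
    rw [hz.1, Set.ncard_singleton] at this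
    omega
  rcases Nat.eq_zero_or_pos P.walk.length with h0 | h0
  · exfalso
    refine hrow 0 ?_
    rintro a ⟨s, hs, -⟩
    rw [← SimpleGraph.Walk.length_edges, List.length_eq_zero_iff] at h0
    simp [h0] at hs
  obtain ⟨h, q, -, hp⟩ := exists_polyline P.walk P.isPath h0
  have hlen : P.corners.length ≤ 4 := by
    unfold GridPath.numBends at hb
    simp only [GridPath.corners, List.length_cons, List.length_append, List.length_nil]
    omega
  change Polyline h q P.corners _ at hp
  -- The corners and the edge set become variables, so that case analysis on `Polyline` can unify
  -- its indices.
  suffices H : ∀ (C : List (ℤ × ℤ)) (E : Set (Sym2 (ℤ × ℤ))), C.length ≤ 4 → Polyline h q C E →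
      (∀ a : ℤ, ¬ {a | ∃ s ∈ E, ∀ p ∈ s, p.2 = a} ⊆ ({a} : Set ℤ)) →
      ∃ z : ZShape, C = [(z.e, z.a), (z.c, z.a), (z.c, z.b), (z.f, z.b)] ∧ E = z.edges by
    obtain ⟨z, hC, hE⟩ := H _ _ hlen hp hrow
    exact ⟨z, hC, fun s => Set.ext_iff.1 hE s⟩
  clear hrow hz hlen h0 hb hp
  intro C E hlen hp hrow
  cases hp with
  | last _ p _ r ha hl =>
    exfalso
    refine hrow p.2 ?_
    rintro a ⟨s, hs, hs'⟩
    cases h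
    · exact (not_row_of_mem_seg_false hs hs').elim
    · exact row_eq_of_mem_seg_true hs hs'
  | cons _ p _ r s l S ha hl hp =>
    cases hp with
    | last _ _ _ t ha' hl' =>
      exfalso
      cases h
      · refine hrow r.2 ?_
        rintro a ⟨s, hs | hs, hs'⟩
        · exact (not_row_of_mem_seg_false hs hs').elim
        · exact row_eq_of_mem_seg_true hs hs'
      · refine hrow p.2 ?_
        rintro a ⟨s, hs | hs, hs'⟩
        · exact row_eq_of_mem_seg_true hs hs'
        · exact (not_row_of_mem_seg_false hs hs').elim
    | cons _ _ _ t s' l S ha' hl' hp =>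
      cases hp with
      | cons _ _ _ t' _ l S _ _ hp =>
        exfalso
        cases hp <;> simp only [List.length_cons, List.length_nil] at hlen <;> omega
      | last _ _ _ t' ha'' hl'' =>
        cases h
        · exfalso
          refine hrow r.2 ?_
          rintro a ⟨s, hs | hs | hs, hs'⟩
          · exact (not_row_of_mem_seg_false hs hs').elim
          · exact row_eq_of_mem_seg_true hs hs'
          · exact (not_row_of_mem_seg_false hs hs').elim
        · obtain ⟨p1, p2⟩ := p
          obtain ⟨r1, r2⟩ := r
          obtain ⟨t1, t2⟩ := t
          obtain ⟨w1, w2⟩ := t'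
          simp only [Axis, Bool.not_true, Bool.not_false] at ha ha' ha''
          obtain ⟨rfl, ha⟩ := ha
          obtain ⟨rfl, ha'⟩ := ha'
          obtain ⟨rfl, ha''⟩ := ha''
          exact ⟨⟨p1, r1, w1, p2, t2, ha, ha'', ha'⟩, rfl, rfl⟩

end EPG

namespace EPG

/-! ### Intervals on two tracks -/

/-- Helly's theorem on a line; the largest left end is a common point. -/
theorem exists_common_point {ι : Type*} (S : Finset ι) (l h : ι → ℤ)
    (H : ∀ i ∈ S, ∀ j ∈ S, l i ≤ h j) : ∃ p, ∀ i ∈ S, l i ≤ p ∧ p ≤ h i := by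
  rcases S.eq_empty_or_nonempty with rfl | hS
  · exact ⟨0, by simp⟩
  · obtain ⟨m, hm, hmax⟩ := S.exists_max_image l hS
    exact ⟨l m, fun i hi => ⟨hmax i hi, H m hm i hi⟩⟩

/-- A family `X` of pairs of intervals on two tracks, any two of which meet on one of the tracks,
together with a family `A` on the first track and a family `B` on the second track, is pierced by a
point of the first track and a point of the second track. -/
theorem exists_two_points {ι : Type*} (A B X : Finset ι) (l h l' h' : ι → ℤ)
    (hX : ∀ i ∈ X, l i ≤ h i) (hX' : ∀ i ∈ X, l' i ≤ h' i)
    (hAA : ∀ i ∈ A, ∀ j ∈ A, l i ≤ h j)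
    (hAX : ∀ i ∈ A, ∀ j ∈ X, l i ≤ h j ∧ l j ≤ h i)
    (hBB : ∀ i ∈ B, ∀ j ∈ B, l' i ≤ h' j)
    (hBX : ∀ i ∈ B, ∀ j ∈ X, l' i ≤ h' j ∧ l' j ≤ h' i)
    (hXX : ∀ i ∈ X, ∀ j ∈ X, (l i ≤ h j ∧ l j ≤ h i) ∨ (l' i ≤ h' j ∧ l' j ≤ h' i)) :
    ∃ p q, (∀ i ∈ A, l i ≤ p ∧ p ≤ h i) ∧ (∀ i ∈ B, l' i ≤ q ∧ q ≤ h' i) ∧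
      ∀ i ∈ X, (l i ≤ p ∧ p ≤ h i) ∨ (l' i ≤ q ∧ q ≤ h' i) := by
  classical
  -- Once the members of `X` missed by `p` meet pairwise on the second track, Helly's theorem there
  -- yields `q`.
  suffices H : ∃ p, (∀ i ∈ A, l i ≤ p ∧ p ≤ h i) ∧
      ∀ i ∈ X, ∀ j ∈ X, ¬ (l i ≤ p ∧ p ≤ h i) → ¬ (l j ≤ p ∧ p ≤ h j) → l' i ≤ h' j by
    obtain ⟨p, hp, hp'⟩ := H
    obtain ⟨q, hq⟩ := exists_common_point
      (B ∪ X.filter (fun i => ¬ (l i ≤ p ∧ p ≤ h i))) l' h' (by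
        intro i hi j hj
        rw [Finset.mem_union, Finset.mem_filter] at hi hj
        rcases hi with hi | hi <;> rcases hj with hj | hj
        · exact hBB i hi j hj
        · exact (hBX i hi j hj.1).1
        · exact (hBX j hj i hi.1).2
        · exact hp' i hi.1 j hj.1 hi.2 hj.2)
    refine ⟨p, q, hp, fun i hi => hq i (Finset.mem_union_left _ hi), fun i hi => ?_⟩
    by_cases hc : l i ≤ p ∧ p ≤ h i
    · exact .inl hc
    · exact .inr (hq i (Finset.mem_union_right _ (Finset.mem_filter.2 ⟨hi, hc⟩)))
  let D := (X ×ˢ X).filter (fun x => h' x.2 < l' x.1)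
  have hD : ∀ x, x ∈ D ↔ (x.1 ∈ X ∧ x.2 ∈ X) ∧ h' x.2 < l' x.1 := by simp [D]
  rcases D.eq_empty_or_nonempty with hD0 | hD0
  · obtain ⟨p, hp⟩ := exists_common_point A l h hAA
    refine ⟨p, hp, fun i hi j hj _ _ => ?_⟩
    by_contra hc
    have : (i, j) ∈ D := (hD _).2 ⟨⟨hi, hj⟩, not_le.1 hc⟩
    simp [hD0] at this
  -- Among the pairs that are disjoint on the second track, one whose later right end on the first
  -- track comes earliest. It determines how far right `p` can be placed.
  obtain ⟨⟨u, v⟩, huv, hmin⟩ := D.exists_min_image (fun x => max (h x.1) (h x.2)) hD0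
  obtain ⟨⟨hu, hv⟩, hd⟩ := (hD _).1 huv
  simp only at hu hv hd hmin
  have hminX : ∀ i ∈ X, ∀ j ∈ X, h' j < l' i → max (h u) (h v) ≤ max (h i) (h j) :=
    fun i hi j hj hc => hmin (i, j) ((hD _).2 ⟨⟨hi, hj⟩, hc⟩)
  have huv' := hXX u hu v hv
  have hXu := hX' u hu
  have hXv := hX' v hv
  by_cases hA : ∃ a ∈ A, h a < max (h u) (h v)
  · obtain ⟨a0, ha0, hlt⟩ := hA
    obtain ⟨a, ha, hamin⟩ := A.exists_min_image h ⟨a0, ha0⟩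
    have := hamin a0 ha0
    -- Members of `X` meet `a`, so those missed by `p = h a` end before `p`. Two of them that are
    -- disjoint on the second track would contradict the minimality of `u`, `v`.
    refine ⟨h a, fun i hi => ⟨hAA i hi a ha, hamin i hi⟩, fun i hi j hj hi' hj' => ?_⟩
    have h1 := hAX a ha i hi
    have h2 := hAX a ha j hj
    by_contra hc
    have := hminX i hi j hj (by omega)
    omega
  · push Not at hA
    refine ⟨max (h u) (h v), fun i hi => ?_, fun i hi j hj hi' hj' => ?_⟩
    · have h1 := hAX i hi u hu
      have h2 := hAX i hi v hv
      have h3 := hA i hi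
      omega
    -- If `i` and `j` are disjoint on the second track, they meet on the first and so lie on the
    -- same side of `p`. On the left they contradict minimality. On the right they miss `u` and `v`
    -- on the first track, so on the second track both span the gap between `u` and `v` and meet
    -- after all.
    · have i1 := hXX i hi u hu
      have i2 := hXX i hi v hv
      have j1 := hXX j hj u hu
      have j2 := hXX j hj v hv
      have hij := hXX i hi j hj
      have hi0 := hX i hi
      have hj0 := hX j hj
      by_contra hc
      have := hminX i hi j hj (by omega)
      omega

end EPG

namespace EPG

/-! ### Covering a clique by two cliques of a simple form -/

namespace ZShape

/-- The path has a horizontal segment on row `r`. -/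
def Has (z : ZShape) (r : ℤ) : Prop := z.a = r ∨ z.b = r

/-- The column of the end of the path on row `r`. -/
def tip (z : ZShape) (r : ℤ) : ℤ := if z.a = r then z.e else z.f

/-- The first position of the path on row `r`. The edge from column `x` to column `x + 1` has
position `2 * x + 1`, and the bend in column `c` has position `2 * c`. -/
def lo (z : ZShape) (r : ℤ) : ℤ := min (2 * z.c) (2 * z.tip r + 1)

/-- The last position of the path on row `r`. -/
def hi (z : ZShape) (r : ℤ) : ℤ := max (2 * z.c) (2 * z.tip r - 1)

/-- The paths have a common position on row `r`. -/
def Meet (r : ℤ) (u v : ZShape) : Prop :=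
  u.Has r ∧ v.Has r ∧ u.lo r ≤ v.hi r ∧ v.lo r ≤ u.hi r

theorem tip_ne (z : ZShape) (r : ℤ) : z.tip r ≠ z.c := by
  have := z.he
  have := z.hf
  unfold tip
  split_ifs <;> omega

theorem lo_le_hi (z : ZShape) (r : ℤ) : z.lo r ≤ z.hi r := by
  unfold lo hi; omega

theorem share_iff_row_or_column {u v : ZShape} : Share u v ↔
    (∃ r, u.Has r ∧ v.Has r ∧ Ov (u.tip r) u.c (v.tip r) v.c) ∨
      (u.c = v.c ∧ Ov u.a u.b v.a v.b) := by
  have hu := u.hab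
  have hv := v.hab
  unfold Share
  constructor
  · rintro (⟨h, h'⟩ | ⟨h, h'⟩ | ⟨h, h'⟩ | ⟨h, h'⟩ | h)
    · exact .inl ⟨u.a, .inl rfl, .inl h.symm, by simpa [tip, h] using h'⟩
    · exact .inl ⟨u.a, .inl rfl, .inr h.symm, by
        rw [tip, tip, if_pos rfl, if_neg (by omega)]; exact h'⟩
    · exact .inl ⟨u.b, .inr rfl, .inl h.symm, by
        rw [tip, tip, if_neg hu, if_pos h.symm]; exact h'⟩
    · exact .inl ⟨u.b, .inr rfl, .inr h.symm, by
        rw [tip, tip, if_neg hu, if_neg (by omega)]; exact h'⟩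
    · exact .inr h
  · rintro (⟨r, h | h, h' | h', ho⟩ | h)
    · rw [tip, tip, if_pos h, if_pos h'] at ho
      exact .inl ⟨h.trans h'.symm, ho⟩
    · rw [tip, tip, if_pos h, if_neg (by omega)] at ho
      exact .inr (.inl ⟨h.trans h'.symm, ho⟩)
    · rw [tip, tip, if_neg (by omega), if_pos h'] at ho
      exact .inr (.inr (.inl ⟨h.trans h'.symm, ho⟩))
    · rw [tip, tip, if_neg (by omega), if_neg (by omega)] at ho
      exact .inr (.inr (.inr (.inl ⟨h.trans h'.symm, ho⟩)))
    · exact .inr (.inr (.inr (.inr h)))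

/-- The interval of positions ends at the bend, which is even, and at the last edge before the tip,
which is odd. When the bends differ, a common even position is interior to one of the intervals, so
a neighbouring edge is common too. -/
theorem meet_iff_ov {r : ℤ} {u v : ZShape} (hc : u.c ≠ v.c) :
    Meet r u v ↔ u.Has r ∧ v.Has r ∧ Ov (u.tip r) u.c (v.tip r) v.c := by
  have hu := u.tip_ne r
  have hv := v.tip_ne r
  unfold Meet lo hi Ov
  refine and_congr_right fun _ => and_congr_right fun _ => ?_
  omega

theorem share_iff_meet {u v : ZShape} (hc : u.c ≠ v.c) : Share u v ↔ ∃ r, Meet r u v := by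
  simp only [share_iff_row_or_column, meet_iff_ov hc, hc, false_and, or_false]

/-- The common position is the bend, whether or not the paths share an edge on the row. -/
theorem meet_of_c_eq {r : ℤ} {u v : ZShape} (hc : u.c = v.c) (hu : u.Has r) (hv : v.Has r) :
    Meet r u v :=
  ⟨hu, hv, by unfold lo hi; omega, by unfold lo hi; omega⟩

theorem Share.symm {u v : ZShape} (h : Share u v) : Share v u := by
  rw [share_iff_exists_edge] at h ⊢
  obtain ⟨s, h, h'⟩ := h
  exact ⟨s, h', h⟩

theorem share_self (u : ZShape) : Share u u := by
  have := u.hab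
  exact share_iff_row_or_column.2 (.inr ⟨rfl, by unfold Ov; omega⟩)

/-- The path runs along the row (`k = 0`) or the column (`k ≠ 0`) with the number `r / 2`, starts
there at position `α` or before and ends at position `β` or later. -/
def Within (k r α β : ℤ) (z : ZShape) : Prop :=
  (k = 0 ∧ ((2 * z.a = r ∧ min (2 * z.c) (2 * z.e + 1) ≤ α ∧ β ≤ max (2 * z.c) (2 * z.e - 1)) ∨
    (2 * z.b = r ∧ min (2 * z.c) (2 * z.f + 1) ≤ α ∧ β ≤ max (2 * z.c) (2 * z.f - 1)))) ∨
  (k ≠ 0 ∧ 2 * z.c = r ∧ min (2 * z.a) (2 * z.b) ≤ α ∧ β ≤ max (2 * z.a) (2 * z.b))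

theorem within_row {r α β : ℤ} {z : ZShape} :
    Within 0 (2 * r) α β z ↔ z.Has r ∧ z.lo r ≤ α ∧ β ≤ z.hi r := by
  have := z.hab
  unfold Within Has lo hi tip
  split_ifs <;> omega

theorem within_column {r α β : ℤ} {z : ZShape} :
    Within 1 (2 * r) α β z ↔ z.c = r ∧ min (2 * z.a) (2 * z.b) ≤ α ∧ β ≤ max (2 * z.a) (2 * z.b) := by
  unfold Within
  omega

/-- A number which is a coordinate of a corner of the path. -/
def IsCoord (z : ZShape) (x : ℤ) : Prop := x = z.e ∨ x = z.c ∨ x = z.f ∨ x = z.a ∨ x = z.b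

end ZShape

open ZShape

/-- An interval `[α, β]` of positions on the row (`k = 0`) or column (`k ≠ 0`) number `r / 2`. -/
structure Track where
  k : ℤ
  r : ℤ
  α : ℤ
  β : ℤ

namespace Track

/-- The path contains the interval. -/
def Con (T : Track) (z : ZShape) : Prop := Within T.k T.r T.α T.β z

/-- The path meets the interval. -/
def Touch (T : Track) (z : ZShape) : Prop := Within T.k T.r T.β T.α z

theorem con_row {r α β : ℤ} {z : ZShape} :
    Con ⟨0, 2 * r, α, β⟩ z ↔ z.Has r ∧ z.lo r ≤ α ∧ β ≤ z.hi r := within_row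

theorem touch_row {r α β : ℤ} {z : ZShape} :
    Touch ⟨0, 2 * r, α, β⟩ z ↔ z.Has r ∧ z.lo r ≤ β ∧ α ≤ z.hi r := within_row

theorem con_column {r α β : ℤ} {z : ZShape} : Con ⟨1, 2 * r, α, β⟩ z ↔
    z.c = r ∧ min (2 * z.a) (2 * z.b) ≤ α ∧ β ≤ max (2 * z.a) (2 * z.b) := within_column

/-- The paths that contain one of three intervals and meet the next one. -/
def Cand (T₁ T₂ T₃ : Track) (z : ZShape) : Prop :=
  (T₁.Con z ∧ T₂.Touch z) ∨ (T₂.Con z ∧ T₃.Touch z) ∨ (T₃.Con z ∧ T₁.Touch z)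

/-- Up to a shift by at most one, `t` is the double of a coordinate of a path of `K`. -/
def IsVal (K : Finset ZShape) (t : ℤ) : Prop :=
  ∃ z ∈ K, ∃ x, z.IsCoord x ∧ (t = 2 * x - 1 ∨ t = 2 * x ∨ t = 2 * x + 1)

/-- The data of the interval come from the coordinates of `K`. -/
def Valid (K : Finset ZShape) (T : Track) : Prop :=
  (T.k = 0 ∨ T.k = 1) ∧ IsVal K T.r ∧ IsVal K T.α ∧ IsVal K T.β

/-- The interval consists of a single grid edge. -/
def IsEdge (T : Track) : Prop := T.α = T.β ∧ T.α % 2 = 1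

theorem IsEdge.mem_edges {T : Track} (hT : T.IsEdge) {z : ZShape} (hz : T.Con z) :
    (if T.k = 0 then hEdge (T.α / 2) (T.r / 2) else vEdge (T.r / 2) (T.α / 2)) ∈ z.edges := by
  obtain ⟨h0, h⟩ := hT
  unfold Con Within at hz
  rw [← h0] at hz
  generalize T.α = α at *
  generalize T.r = r at *
  have := z.he
  have := z.hf
  rcases hz with ⟨hk, hz | hz⟩ | ⟨hk, hz⟩
  · rw [if_pos hk, hEdge_mem_edges]
    exact .inl (by omega)
  · rw [if_pos hk, hEdge_mem_edges]
    exact .inr (by omega)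
  · rw [if_neg hk, vEdge_mem_edges]
    omega

theorem IsEdge.share {T : Track} (hT : T.IsEdge) {u v : ZShape} (hu : T.Con u) (hv : T.Con v) :
    Share u v :=
  share_iff_exists_edge.2 ⟨_, hT.mem_edges hu, hT.mem_edges hv⟩

theorem IsEdge.touch_iff {T : Track} (hT : T.IsEdge) {z : ZShape} : T.Touch z ↔ T.Con z := by
  rw [Touch, Con, hT.1]

/-- A clique of the form `Cand T₁ T₂ T₃`, with data that come from `K`. -/
def IsCand (K : Finset ZShape) (Y : ZShape → Prop) : Prop :=
  ∃ T₁ T₂ T₃ : Track, T₁.Valid K ∧ T₂.Valid K ∧ T₃.Valid K ∧ Y = Cand T₁ T₂ T₃ ∧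
    ∀ u v, Y u → Y v → Share u v

/-- For single edges, touching and containing coincide, so members contain two of the three edges.
Two pairs out of three have an element in common. -/
theorem isCand_of_isEdge {K : Finset ZShape} {T₁ T₂ T₃ : Track} (h₁ : T₁.IsEdge) (h₂ : T₂.IsEdge)
    (h₃ : T₃.IsEdge) (v₁ : T₁.Valid K) (v₂ : T₂.Valid K) (v₃ : T₃.Valid K) :
    IsCand K (Cand T₁ T₂ T₃) := by
  refine ⟨T₁, T₂, T₃, v₁, v₂, v₃, rfl, fun u v hu hv => ?_⟩
  simp only [Cand, h₁.touch_iff, h₂.touch_iff, h₃.touch_iff] at hu hv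
  rcases hu with ⟨a, b⟩ | ⟨a, b⟩ | ⟨a, b⟩ <;> rcases hv with ⟨c, d⟩ | ⟨c, d⟩ | ⟨c, d⟩ <;>
    first
    | exact h₁.share ‹T₁.Con u› ‹T₁.Con v›
    | exact h₂.share ‹T₂.Con u› ‹T₂.Con v›
    | exact h₃.share ‹T₃.Con u› ‹T₃.Con v›

theorem exists_isCand_of_edge {K S : Finset ZShape} {T : Track} (h : T.IsEdge) (v : T.Valid K)
    (hS : ∀ z ∈ S, T.Con z) : ∃ Y, IsCand K Y ∧ ∀ z ∈ S, Y z :=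
  ⟨_, isCand_of_isEdge h h h v v v, fun z hz => .inl ⟨hS z hz, h.touch_iff.2 (hS z hz)⟩⟩

theorem exists_isCand_of_edges {K S : Finset ZShape} {T₁ T₂ T₃ : Track} (h₁ : T₁.IsEdge)
    (h₂ : T₂.IsEdge) (h₃ : T₃.IsEdge) (v₁ : T₁.Valid K) (v₂ : T₂.Valid K) (v₃ : T₃.Valid K)
    (hS : ∀ z ∈ S, (T₁.Con z ∧ T₂.Con z) ∨ (T₂.Con z ∧ T₃.Con z) ∨ (T₃.Con z ∧ T₁.Con z)) :
    ∃ Y, IsCand K Y ∧ ∀ z ∈ S, Y z := by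
  refine ⟨_, isCand_of_isEdge h₁ h₂ h₃ v₁ v₂ v₃, fun z hz => ?_⟩
  simp only [Cand, h₁.touch_iff, h₂.touch_iff, h₃.touch_iff]
  exact hS z hz

/-- Paths with a common column that pairwise share an edge. -/
theorem exists_isCand_of_column {K S : Finset ZShape} (hS : S.Nonempty) (hSK : S ⊆ K)
    (hK : ∀ u ∈ S, ∀ v ∈ S, Share u v) {c : ℤ} (hc : ∀ z ∈ S, z.c = c) :
    ∃ Y, IsCand K Y ∧ ∀ z ∈ S, Y z := by
  by_cases hov : ∀ u ∈ S, ∀ v ∈ S, min u.a u.b < max v.a v.b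
  -- The vertical segments overlap pairwise, so they all contain the edge directly above the highest
  -- lower end.
  · obtain ⟨w, hw, hmax⟩ := S.exists_max_image (fun z => min z.a z.b) hS
    have hv : ∃ x, w.IsCoord x ∧ min w.a w.b = x := ⟨_, by unfold IsCoord; omega, rfl⟩
    obtain ⟨x, hx, hwx⟩ := hv
    refine exists_isCand_of_edge (T := ⟨1, 2 * c, 2 * x + 1, 2 * x + 1⟩)
      ⟨rfl, by simp only; omega⟩
      ⟨.inr rfl, ⟨w, hSK hw, c, by simp [IsCoord, hc w hw], by simp⟩,
        ⟨w, hSK hw, x, hx, by simp⟩, ⟨w, hSK hw, x, hx, by simp⟩⟩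
      (fun z hz => con_column.2 ⟨hc z hz, ?_⟩)
    have h1 := hmax z hz
    have h2 := hov w hw z hz
    have h3 := hov z hz z hz
    omega
  · push Not at hov
    obtain ⟨v, hv, u, hu, hvu⟩ := hov
    -- The segment of `u` lies below that of `v`, so they share an edge on a row, which must be the
    -- upper row of `u` and the lower row of `v`. There both leave the column on the same side `δ`.
    obtain ⟨r, h1, h2, h3⟩ : ∃ r, u.Has r ∧ v.Has r ∧ Ov (u.tip r) u.c (v.tip r) v.c := by
      rcases share_iff_row_or_column.1 (hK u hu v hv) with h | h
      · exact h
      · unfold Ov at h; omega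
    have hur : max u.a u.b = r := by unfold Has at h1 h2; omega
    have hvr : min v.a v.b = r := by unfold Has at h1 h2; omega
    have huc := hc u hu
    have hvc := hc v hv
    obtain ⟨δ, hδ, hut, hvt⟩ : ∃ δ : ℤ, (δ = 1 ∨ δ = -1) ∧
        (δ = 1 ↔ c < u.tip r) ∧ (δ = 1 ↔ c < v.tip r) := by
      unfold Ov at h3
      rcases lt_or_ge c (u.tip r) with h | h
      · exact ⟨1, by omega, by omega, by omega⟩
      · exact ⟨-1, by omega, by omega, by omega⟩
    have hwr : ∃ w ∈ K, w.IsCoord r := ⟨u, hSK hu, by unfold IsCoord; omega⟩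
    have hwc : ∃ w ∈ K, w.IsCoord c := ⟨u, hSK hu, by unfold IsCoord; omega⟩
    have val : ∀ {x y : ℤ}, (∃ w ∈ K, w.IsCoord x) → (y = 2 * x - 1 ∨ y = 2 * x ∨ y = 2 * x + 1) →
        IsVal K y := fun ⟨w, hw, hwx⟩ hy => ⟨w, hw, _, hwx, hy⟩
    -- Three edges at the grid point `(c, r)`: down, up and towards side `δ`. A path that does not
    -- cross row `r` vertically is vertically disjoint from `u` or from `v`, so it shares a
    -- horizontal edge with that one on row `r`.
    refine exists_isCand_of_edges (T₁ := ⟨1, 2 * c, 2 * r - 1, 2 * r - 1⟩)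
      (T₂ := ⟨1, 2 * c, 2 * r + 1, 2 * r + 1⟩) (T₃ := ⟨0, 2 * r, 2 * c + δ, 2 * c + δ⟩)
      ⟨rfl, by simp only; omega⟩ ⟨rfl, by simp only; omega⟩ ⟨rfl, by simp only; omega⟩
      ⟨.inr rfl, val hwc (by simp), val hwr (by simp), val hwr (by simp)⟩
      ⟨.inr rfl, val hwc (by simp), val hwr (by simp), val hwr (by simp)⟩
      ⟨.inl rfl, val hwr (by simp), val hwc (by simp only; omega), val hwc (by simp only; omega)⟩
      (fun z hz => ?_)
    simp only [con_row, con_column]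
    have hzc := hc z hz
    have hz0 := z.hab
    by_cases hz1 : r ≤ min z.a z.b
    · obtain ⟨r', g1, g2, g3⟩ : ∃ r, z.Has r ∧ u.Has r ∧ Ov (z.tip r) z.c (u.tip r) u.c := by
        rcases share_iff_row_or_column.1 (hK z hz u hu) with h | h
        · exact h
        · unfold Ov at h; omega
      obtain rfl : r' = r := by unfold Has at g1 g2; omega
      have := z.tip_ne r'
      unfold Ov at g3
      exact .inr (.inl ⟨⟨hzc, by unfold Has at g1; omega⟩, g1, by unfold lo hi; omega⟩)
    · by_cases hz2 : max z.a z.b ≤ r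
      · obtain ⟨r', g1, g2, g3⟩ : ∃ r, z.Has r ∧ v.Has r ∧ Ov (z.tip r) z.c (v.tip r) v.c := by
          rcases share_iff_row_or_column.1 (hK z hz v hv) with h | h
          · exact h
          · unfold Ov at h; omega
        obtain rfl : r' = r := by unfold Has at g1 g2; omega
        have := z.tip_ne r'
        unfold Ov at g3
        exact .inr (.inr ⟨⟨g1, by unfold lo hi; omega⟩, hzc, by unfold Has at g1; omega⟩)
      · exact .inl ⟨⟨hzc, by omega⟩, hzc, by omega⟩

end Track

end EPG

/-! ### Cliques through a common position of a row, and cliques on two rows. -/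

namespace EPG

open ZShape

namespace ZShape

theorem min_max_of_has {z : ZShape} {p q : ℤ} (hp : z.Has p) (hq : z.Has q) (h : p ≠ q) :
    min z.a z.b = min p q ∧ max z.a z.b = max p q := by
  unfold Has at hp hq
  omega

theorem Has.eq_or_eq {z : ZShape} {p q r : ℤ} (hp : z.Has p) (hq : z.Has q) (h : p ≠ q)
    (hr : z.Has r) : r = p ∨ r = q := by
  unfold Has at hp hq hr
  omega

theorem ov_of_has {u v : ZShape} {p q s t : ℤ} (hp : u.Has p) (hq : u.Has q) (hpq : p ≠ q)
    (hs : v.Has s) (ht : v.Has t) (hst : s ≠ t) : Ov u.a u.b v.a v.b ↔ Ov p q s t := by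
  have h1 := min_max_of_has hp hq hpq
  have h2 := min_max_of_has hs ht hst
  unfold Ov
  rw [h1.1, h1.2, h2.1, h2.2]

theorem exists_has_ne (z : ZShape) (r : ℤ) : ∃ s, z.Has s ∧ s ≠ r := by
  have := z.hab
  by_cases h : z.a = r
  · exact ⟨z.b, .inr rfl, by omega⟩
  · exact ⟨z.a, .inl rfl, h⟩

theorem isCoord_tip (z : ZShape) (r : ℤ) : z.IsCoord (z.tip r) := by
  unfold IsCoord tip
  split_ifs <;> simp

theorem isCoord_of_has {z : ZShape} {r : ℤ} (h : z.Has r) : z.IsCoord r := by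
  unfold Has at h
  unfold IsCoord
  omega

theorem isCoord_c (z : ZShape) : z.IsCoord z.c := .inr (.inl rfl)

theorem Share.exists_meet {u v : ZShape} (h : Share u v) {r : ℤ} (hu : u.Has r) (hv : v.Has r) :
    ∃ s, Meet s u v := by
  by_cases hc : u.c = v.c
  · exact ⟨r, meet_of_c_eq hc hu hv⟩
  · exact (share_iff_meet hc).1 h

/-- Two paths that share only one row, and share an edge, meet on this row. -/
theorem Share.meet {u v : ZShape} (h : Share u v) {r s : ℤ} (hur : u.Has r) (hvr : v.Has r)
    (hvs : v.Has s) (hrs : r ≠ s) (hus : ¬ u.Has s) : Meet r u v := by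
  obtain ⟨t, ht⟩ := h.exists_meet hur hvr
  rcases hvr.eq_or_eq hvs hrs ht.2.1 with rfl | rfl
  · exact ht
  · exact (hus ht.1).elim

end ZShape

namespace Track

theorem IsVal.of_coord {K : Finset ZShape} {z : ZShape} (hz : z ∈ K) {x t : ℤ} (hx : z.IsCoord x)
    (ht : t = 2 * x - 1 ∨ t = 2 * x ∨ t = 2 * x + 1) : IsVal K t :=
  ⟨z, hz, x, hx, ht⟩

/-- The segments on row `r` leave the column on opposite sides. If one path also went up from `r`
and the other down, no edge and no second row would be left to share. -/
theorem left_corner_right_corner {u v : ZShape} (h : Share u v) {r : ℤ} (hc : u.c = v.c)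
    (hur : u.Has r) (hvr : v.Has r) (hu : u.tip r < u.c) (hv : v.c < v.tip r) :
    r = min u.a u.b ↔ r = min v.a v.b := by
  have h1 := u.hab
  have h2 := v.hab
  rcases share_iff_row_or_column.1 h with ⟨s, hs1, hs2, hs⟩ | ⟨-, hs⟩
  · by_cases hrs : r = s
    · subst hrs
      unfold Ov at hs
      omega
    · unfold Has at *
      omega
  · unfold Ov at hs
    unfold Has at *
    omega

/-- Paths that have a common position on a row and pairwise share an edge. -/
theorem exists_isCand_of_position {K S : Finset ZShape} (hS : S.Nonempty) (hSK : S ⊆ K)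
    (hK : ∀ u ∈ S, ∀ v ∈ S, Share u v) {r p : ℤ}
    (hp : ∀ z ∈ S, z.Has r ∧ z.lo r ≤ p ∧ p ≤ z.hi r) :
    ∃ Y, IsCand K Y ∧ ∀ z ∈ S, Y z := by
  -- All paths contain the position `w.lo r`. An odd position is an edge and suffices; an even one
  -- is the bend of `w`.
  obtain ⟨w, hw, hmax⟩ := S.exists_max_image (fun z => z.lo r) hS
  have hwr : IsVal K (2 * r) := .of_coord (hSK hw) (isCoord_of_has (hp w hw).1) (by simp)
  have hlo : ∀ z ∈ S, w.lo r ≤ z.hi r := fun z hz => by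
    have h1 := hp w hw
    have h2 := hp z hz
    omega
  by_cases hodd : w.lo r = 2 * w.tip r + 1
  · have hv : IsVal K (w.lo r) := .of_coord (hSK hw) (w.isCoord_tip r) (by omega)
    exact exists_isCand_of_edge (T := ⟨0, 2 * r, w.lo r, w.lo r⟩) ⟨rfl, by simp only; omega⟩
      ⟨.inl rfl, hwr, hv, hv⟩ (fun z hz => con_row.2 ⟨(hp z hz).1, hmax z hz, hlo z hz⟩)
  have hwc : w.lo r = 2 * w.c := by
    unfold lo at hodd ⊢
    omega
  have hval : ∀ t, (t = 2 * w.c - 1 ∨ t = 2 * w.c ∨ t = 2 * w.c + 1) → IsVal K t :=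
    fun t ht => .of_coord (hSK hw) w.isCoord_c ht
  have hvL : Valid K ⟨0, 2 * r, 2 * w.c - 1, 2 * w.c - 1⟩ :=
    ⟨.inl rfl, hwr, hval _ (by simp), hval _ (by simp)⟩
  have hvR : Valid K ⟨0, 2 * r, 2 * w.c + 1, 2 * w.c + 1⟩ :=
    ⟨.inl rfl, hwr, hval _ (by simp), hval _ (by simp)⟩
  by_cases hR : ∀ z ∈ S, 2 * w.c + 1 ≤ z.hi r
  · refine exists_isCand_of_edge (T := ⟨0, 2 * r, 2 * w.c + 1, 2 * w.c + 1⟩)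
      ⟨rfl, by simp only; omega⟩ hvR (fun z hz => con_row.2 ⟨(hp z hz).1, ?_, hR z hz⟩)
    have := hmax z hz
    omega
  by_cases hL : ∀ z ∈ S, z.lo r ≤ 2 * w.c - 1
  · refine exists_isCand_of_edge (T := ⟨0, 2 * r, 2 * w.c - 1, 2 * w.c - 1⟩)
      ⟨rfl, by simp only; omega⟩ hvL (fun z hz => con_row.2 ⟨(hp z hz).1, hL z hz, ?_⟩)
    have := hlo z hz
    omega
  have left : ∀ z ∈ S, z.hi r < 2 * w.c + 1 → z.c = w.c ∧ z.tip r < z.c := by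
    intro z hz h
    have := hlo z hz
    have := z.tip_ne r
    unfold hi at *
    omega
  have right : ∀ z ∈ S, 2 * w.c - 1 < z.lo r → z.c = w.c ∧ z.c < z.tip r := by
    intro z hz h
    have := hmax z hz
    have := z.tip_ne r
    unfold lo at *
    omega
  push Not at hR hL
  -- Here `z₁` ends and `z₂` begins at this even position, so both bend there and leave on opposite
  -- sides. By the corner lemma all paths that bend there leave row `r` in the same vertical
  -- direction.
  obtain ⟨z₁, hz₁, h₁⟩ := hR
  obtain ⟨z₂, hz₂, h₂⟩ := hL
  have l₁ := left z₁ hz₁ h₁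
  have l₂ := right z₂ hz₂ h₂
  have key : ∀ z ∈ S, (z.hi r < 2 * w.c + 1 ∨ 2 * w.c - 1 < z.lo r) → z.c = w.c ∧
      (r = min z.a z.b ↔ r = min z₁.a z₁.b) := by
    have h12 := left_corner_right_corner (hK z₁ hz₁ z₂ hz₂) (by omega) (hp z₁ hz₁).1 (hp z₂ hz₂).1
      l₁.2 l₂.2
    rintro z hz (h | h)
    · have l := left z hz h
      exact ⟨l.1, (left_corner_right_corner (hK z hz z₂ hz₂) (by omega) (hp z hz).1 (hp z₂ hz₂).1
        l.2 l₂.2).trans h12.symm⟩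
    · have l := right z hz h
      exact ⟨l.1, (left_corner_right_corner (hK z₁ hz₁ z hz) (by omega) (hp z₁ hz₁).1 (hp z hz).1
        l₁.2 l.2).symm⟩
  obtain ⟨δ, hδ, hδ'⟩ : ∃ δ : ℤ, (δ = 1 ∨ δ = -1) ∧ (δ = 1 ↔ r = min z₁.a z₁.b) := by
    by_cases h : r = min z₁.a z₁.b
    · exact ⟨1, by omega, by omega⟩
    · exact ⟨-1, by omega, by omega⟩
  have hvr : IsVal K (2 * r + δ) :=
    .of_coord (hSK hw) (isCoord_of_has (hp w hw).1) (by omega)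
  -- A path through the point contains both horizontal edges, or one of them and the vertical edge
  -- on side `δ`.
  refine exists_isCand_of_edges (T₁ := ⟨0, 2 * r, 2 * w.c - 1, 2 * w.c - 1⟩)
      (T₂ := ⟨0, 2 * r, 2 * w.c + 1, 2 * w.c + 1⟩) (T₃ := ⟨1, 2 * w.c, 2 * r + δ, 2 * r + δ⟩)
      ⟨rfl, by simp only; omega⟩ ⟨rfl, by simp only; omega⟩ ⟨rfl, by simp only; omega⟩
      hvL hvR ⟨.inr rfl, hval _ (by simp), hvr, hvr⟩ (fun z hz => ?_)
  simp only [con_row, con_column]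
  obtain ⟨g1, g2, g3⟩ := hp z hz
  have h1 := hmax z hz
  have h2 := hlo z hz
  have h0 := z.hab
  by_cases hr : z.hi r < 2 * w.c + 1
  · obtain ⟨k1, k2⟩ := key z hz (.inl hr)
    have := left z hz hr
    refine .inr (.inr ⟨⟨k1, ?_⟩, g1, ?_⟩)
    · unfold Has at g1; omega
    · unfold lo; omega
  · by_cases hl : 2 * w.c - 1 < z.lo r
    · obtain ⟨k1, k2⟩ := key z hz (.inr hl)
      refine .inr (.inl ⟨⟨g1, ?_⟩, k1, ?_⟩)
      · omega
      · unfold Has at g1; omega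
    · exact .inl ⟨⟨g1, by omega⟩, g1, by omega⟩

/-- The clique is covered by two cliques of the simple form. -/
def Covered (K : Finset ZShape) : Prop :=
  ∃ Y Y', IsCand K Y ∧ IsCand K Y' ∧ ∀ z ∈ K, Y z ∨ Y' z

theorem covered_of_union {K S S' : Finset ZShape} (hK : K.Nonempty)
    (hS : S.Nonempty → ∃ Y, IsCand K Y ∧ ∀ z ∈ S, Y z)
    (hS' : S'.Nonempty → ∃ Y, IsCand K Y ∧ ∀ z ∈ S', Y z) (h : ∀ z ∈ K, z ∈ S ∨ z ∈ S') :
    Covered K := by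
  obtain ⟨w, hw⟩ := hK
  have H : ∀ S : Finset ZShape, (S.Nonempty → ∃ Y, IsCand K Y ∧ ∀ z ∈ S, Y z) →
      ∃ Y, IsCand K Y ∧ ∀ z ∈ S, Y z := by
    intro S hS
    rcases S.eq_empty_or_nonempty with rfl | hne
    -- An empty part still needs a candidate; one around an arbitrary path will do.
    · obtain ⟨Y, hY, -⟩ := exists_isCand_of_column (K := K) (S := {w}) (by simp) (by simpa)
        (by simp [share_self]) (c := w.c) (by simp)
      exact ⟨Y, hY, by simp⟩
    · exact hS hne
  obtain ⟨Y, hY, hY'⟩ := H S hS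
  obtain ⟨Z, hZ, hZ'⟩ := H S' hS'
  exact ⟨Y, Z, hY, hZ, fun z hz => (h z hz).imp (hY' z) (hZ' z)⟩

/-- A clique of paths each of which uses one of two rows. -/
theorem covered_of_rows {K : Finset ZShape} (hK : K.Nonempty)
    (hKK : ∀ u ∈ K, ∀ v ∈ K, Share u v) {p q : ℤ} (hpq : p ≠ q)
    (hcov : ∀ z ∈ K, z.Has p ∨ z.Has q)
    (hA : ∀ u ∈ K, ∀ v ∈ K, u.Has p → v.Has p → ¬ u.Has q → ¬ v.Has q → Meet p u v)
    (hB : ∀ u ∈ K, ∀ v ∈ K, u.Has q → v.Has q → ¬ u.Has p → ¬ v.Has p → Meet q u v) :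
    Covered K := by
  classical
  -- The tracks are the rows `p` and `q`; the families are the paths on `p` only, on `q` only, and
  -- on both.
  obtain ⟨x, y, h1, h2, h3⟩ := exists_two_points (K.filter (fun z => ¬ z.Has q))
    (K.filter (fun z => ¬ z.Has p)) (K.filter (fun z => z.Has p ∧ z.Has q))
    (fun z => z.lo p) (fun z => z.hi p) (fun z => z.lo q) (fun z => z.hi q)
    (fun z _ => z.lo_le_hi p) (fun z _ => z.lo_le_hi q)
    (by
      intro u hu v hv
      rw [Finset.mem_filter] at hu hv
      exact (hA u hu.1 v hv.1 ((hcov u hu.1).resolve_right hu.2) ((hcov v hv.1).resolve_right hv.2)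
        hu.2 hv.2).2.2.1)
    (by
      intro u hu v hv
      rw [Finset.mem_filter] at hu hv
      exact ((hKK u hu.1 v hv.1).meet ((hcov u hu.1).resolve_right hu.2) hv.2.1 hv.2.2 hpq
        hu.2).2.2)
    (by
      intro u hu v hv
      rw [Finset.mem_filter] at hu hv
      exact (hB u hu.1 v hv.1 ((hcov u hu.1).resolve_left hu.2) ((hcov v hv.1).resolve_left hv.2)
        hu.2 hv.2).2.2.1)
    (by
      intro u hu v hv
      rw [Finset.mem_filter] at hu hv
      exact ((hKK u hu.1 v hv.1).meet ((hcov u hu.1).resolve_left hu.2) hv.2.2 hv.2.1 hpq.symm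
        hu.2).2.2)
    (by
      intro u hu v hv
      rw [Finset.mem_filter] at hu hv
      obtain ⟨s, hs⟩ := (hKK u hu.1 v hv.1).exists_meet hu.2.1 hv.2.1
      rcases hu.2.1.eq_or_eq hu.2.2 hpq hs.1 with rfl | rfl
      · exact .inl hs.2.2
      · exact .inr hs.2.2)
  refine covered_of_union (S := K.filter (fun z => z.Has p ∧ z.lo p ≤ x ∧ x ≤ z.hi p))
    (S' := K.filter (fun z => z.Has q ∧ z.lo q ≤ y ∧ y ≤ z.hi q)) hK ?_ ?_ ?_
  · exact fun hne => exists_isCand_of_position hne (Finset.filter_subset _ _)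
      (fun u hu v hv => hKK u (Finset.mem_filter.1 hu).1 v (Finset.mem_filter.1 hv).1)
      (fun z hz => (Finset.mem_filter.1 hz).2)
  · exact fun hne => exists_isCand_of_position hne (Finset.filter_subset _ _)
      (fun u hu v hv => hKK u (Finset.mem_filter.1 hu).1 v (Finset.mem_filter.1 hv).1)
      (fun z hz => (Finset.mem_filter.1 hz).2)
  · intro z hz
    simp only [Finset.mem_filter, hz, true_and] at h1 h2 h3 ⊢
    by_cases hzp : z.Has p
    · by_cases hzq : z.Has q
      · have := h3 z ⟨hz, hzp, hzq⟩
        tauto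
      · exact .inl ⟨hzp, h1 z ⟨hz, hzq⟩⟩
    · exact .inr ⟨(hcov z hz).resolve_left hzp, h2 z ⟨hz, hzp⟩⟩

end Track

end EPG

/-! ### Cliques on three rows, and the covering theorem. -/

namespace EPG

open ZShape

namespace Track

/-- The paths have the rows `r` and `s` and do not meet on row `r`. -/
def Apart (K : Finset ZShape) (r s : ℤ) (x y : ZShape) : Prop :=
  x ∈ K ∧ y ∈ K ∧ r ≠ s ∧ (x.Has r ∧ x.Has s) ∧ (y.Has r ∧ y.Has s) ∧ ¬ Meet r x y

theorem exists_apart {K : Finset ZShape} (hKK : ∀ u ∈ K, ∀ v ∈ K, Share u v) {u v : ZShape}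
    (hu : u ∈ K) (hv : v ∈ K) {r : ℤ} (hur : u.Has r) (hvr : v.Has r) (h : ¬ Meet r u v) :
    ∃ s, Apart K r s u v := by
  obtain ⟨s, hs⟩ := (hKK u hu v hv).exists_meet hur hvr
  have : r ≠ s := by rintro rfl; exact h hs
  exact ⟨s, hu, hv, this, ⟨hur, hs.1⟩, ⟨hvr, hs.2.1⟩, h⟩

theorem Apart.c_ne {K : Finset ZShape} {r s : ℤ} {x y : ZShape} (h : Apart K r s x y) :
    x.c ≠ y.c :=
  fun hc => h.2.2.2.2.2 (meet_of_c_eq hc h.2.2.2.1.1 h.2.2.2.2.1.1)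

/-- The columns of `x` and `y` differ, so `w` is in a different column from one of them and must
meet it on a row. -/
theorem Apart.has_or_has {K : Finset ZShape} (hKK : ∀ u ∈ K, ∀ v ∈ K, Share u v) {r s : ℤ}
    {x y : ZShape} (h : Apart K r s x y) {w : ZShape} (hw : w ∈ K) : w.Has r ∨ w.Has s := by
  have hc := h.c_ne
  obtain ⟨hx, hy, hrs, hxr, hyr, -⟩ := h
  by_cases hwx : w.c = x.c
  · obtain ⟨t, ht⟩ := (share_iff_meet (by omega)).1 (hKK w hw y hy)
    rcases hyr.1.eq_or_eq hyr.2 hrs ht.2.1 with rfl | rfl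
    · exact .inl ht.1
    · exact .inr ht.1
  · obtain ⟨t, ht⟩ := (share_iff_meet hwx).1 (hKK w hw x hx)
    rcases hxr.1.eq_or_eq hxr.2 hrs ht.2.1 with rfl | rfl
    · exact .inl ht.1
    · exact .inr ht.1

/-- A path on `r` without `s` meets both `x` and `y` on `r`, so it spans the gap between them. The
two consecutive positions obtained include an odd one, which `exists_interval` uses. -/
theorem Apart.exists_gap {K : Finset ZShape} (hKK : ∀ u ∈ K, ∀ v ∈ K, Share u v) {r s : ℤ}
    {x y : ZShape} (h : Apart K r s x y) :
    ∃ g, ∀ w ∈ K, w.Has r → ¬ w.Has s → w.lo r ≤ g ∧ g + 1 ≤ w.hi r := by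
  obtain ⟨hx, hy, hrs, hxr, hyr, hd⟩ := h
  have key : ∀ w ∈ K, w.Has r → ¬ w.Has s → Meet r w x ∧ Meet r w y := fun w hw hwr hws =>
    ⟨(hKK w hw x hx).meet hwr hxr.1 hxr.2 hrs hws, (hKK w hw y hy).meet hwr hyr.1 hyr.2 hrs hws⟩
  have hx0 := x.lo_le_hi r
  have hy0 := y.lo_le_hi r
  refine ⟨min (x.hi r) (y.hi r), fun w hw hwr hws => ?_⟩
  obtain ⟨⟨-, -, h1⟩, -, -, h2⟩ := key w hw hwr hws
  have h3 : ¬ (x.lo r ≤ y.hi r ∧ y.lo r ≤ x.hi r) := fun h3 => hd ⟨hxr.1, hyr.1, h3⟩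
  omega

theorem Apart.meet {K : Finset ZShape} (hKK : ∀ u ∈ K, ∀ v ∈ K, Share u v) {r s : ℤ}
    {x y : ZShape} (h : Apart K r s x y) {u v : ZShape} (hu : u ∈ K) (hv : v ∈ K) (hur : u.Has r)
    (hvr : v.Has r) (hus : ¬ u.Has s) (hvs : ¬ v.Has s) : Meet r u v := by
  obtain ⟨g, hg⟩ := h.exists_gap hKK
  have h1 := hg u hu hur hus
  have h2 := hg v hv hvr hvs
  exact ⟨hur, hvr, by omega, by omega⟩

/-- Row `r` is strictly between the rows `s` and `t`. -/
def Between (r s t : ℤ) : Prop := min s t < r ∧ r < max s t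

/-- Only equal columns are delicate. If `r` is not between `s` and `t`, the vertical segments leave
`r` in the same direction. Otherwise the parity of the ends forces both paths to the same side of
the column on row `r`. -/
theorem share_of_con_touch {u v : ZShape} {r s t α β : ℤ} (hrs : r ≠ s) (hrt : r ≠ t)
    (hb : Between r s t → α % 2 = 1 ∧ β % 2 = 1)
    (hu : Touch ⟨0, 2 * r, α, β⟩ u) (hus : u.Has s) (hv : Con ⟨0, 2 * r, α, β⟩ v) (hvt : v.Has t) :
    Share u v := by
  rw [touch_row] at hu
  rw [con_row] at hv
  by_cases hc : u.c = v.c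
  · rw [share_iff_row_or_column]
    by_cases h : Between r s t
    · refine .inl ⟨r, hu.1, hv.1, ?_⟩
      have := hb h
      have h1 := u.tip_ne r
      have h2 := v.tip_ne r
      obtain ⟨-, hu⟩ := hu
      obtain ⟨-, hv⟩ := hv
      unfold lo hi at hu hv
      unfold Ov
      omega
    · refine .inr ⟨hc, (ov_of_has hu.1 hus hrs hv.1 hvt hrt).2 ?_⟩
      unfold Between at h
      unfold Ov
      omega
  · exact (share_iff_meet hc).2 ⟨r, hu.1, hv.1, by omega, by omega⟩

theorem share_of_con {u v : ZShape} {r s α β : ℤ} (hrs : r ≠ s) (hαβ : α ≤ β)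
    (hu : Con ⟨0, 2 * r, α, β⟩ u) (hus : u.Has s) (hv : Con ⟨0, 2 * r, α, β⟩ v) (hvs : v.Has s) :
    Share u v := by
  rw [con_row] at hu hv
  by_cases hc : u.c = v.c
  · exact share_iff_row_or_column.2 (.inr ⟨hc, (ov_of_has hu.1 hus hrs hv.1 hvs hrs).2
      (by unfold Ov; omega)⟩)
  · exact (share_iff_meet hc).2 ⟨r, hu.1, hv.1, by omega, by omega⟩

/-- The interval is the intersection on row `r` of all paths with rows `r` and `t`. It is nonempty
because they all span the gap of `x` and `y`, and a path with rows `r` and `s` touches it because it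
meets each of them. -/
theorem exists_interval {K : Finset ZShape} (hKK : ∀ u ∈ K, ∀ v ∈ K, Share u v) {r s t : ℤ}
    (hrs : r ≠ s) (hrt : r ≠ t) (hst : s ≠ t) {x y : ZShape} (h : Apart K r s x y)
    (hne : ∃ z ∈ K, z.Has r ∧ z.Has t) :
    ∃ α β, Valid K ⟨0, 2 * r, α, β⟩ ∧ α ≤ β ∧ (Between r s t → α % 2 = 1 ∧ β % 2 = 1) ∧
      (∀ z ∈ K, z.Has r → z.Has t → Con ⟨0, 2 * r, α, β⟩ z) ∧
      (∀ z ∈ K, z.Has r → z.Has s → Touch ⟨0, 2 * r, α, β⟩ z) := by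
  classical
  obtain ⟨g, hg⟩ := h.exists_gap hKK
  have hgap : ∀ w ∈ K, w.Has r → w.Has t → w.lo r ≤ g ∧ g + 1 ≤ w.hi r := fun w hw hr ht =>
    hg w hw hr fun hs => by rcases hr.eq_or_eq ht hrt hs with h | h <;> omega
  obtain ⟨a, b, hab, hodd, hz⟩ : ∃ a b : ZShape → ℤ,
      (∀ z ∈ K, z.Has r → z.Has t → ∀ w ∈ K, w.Has r → w.Has t → a z ≤ b w) ∧
      (Between r s t → ∀ z, a z % 2 = 1 ∧ b z % 2 = 1) ∧
      ∀ z ∈ K, z.Has r → z.Has t → z.lo r ≤ a z ∧ b z ≤ z.hi r ∧ IsVal K (a z) ∧ IsVal K (b z) ∧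
        ∀ u ∈ K, u.Has r → u.Has s → u.lo r ≤ b z ∧ a z ≤ u.hi r := by
    by_cases hb : Between r s t
    -- When `r` is between the other rows, the ends are rounded inwards to edges. Touching survives,
    -- since the paths concerned then share an actual edge on row `r`.
    · refine ⟨fun z => z.lo r + (1 - z.lo r % 2), fun z => z.hi r - (1 - z.hi r % 2), ?_,
        fun _ z => by simp only; omega, ?_⟩
      · intro z hz hzr hzt w hw hwr hwt
        have h1 := hgap z hz hzr hzt
        have h2 := hgap w hw hwr hwt
        simp only
        omega
      · intro z hz hzr hzt
        have htip := z.tip_ne r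
        refine ⟨by simp only; omega, by simp only; omega, ?_, ?_, ?_⟩
        · by_cases hodd : z.lo r = 2 * z.c
          · exact .of_coord hz z.isCoord_c (by simp only; omega)
          · exact .of_coord hz (z.isCoord_tip r) (by unfold lo at *; simp only; omega)
        · by_cases hodd : z.hi r = 2 * z.c
          · exact .of_coord hz z.isCoord_c (by simp only; omega)
          · exact .of_coord hz (z.isCoord_tip r) (by unfold hi at *; simp only; omega)
        · intro u hu hur hus
          have hutip := u.tip_ne r
          by_cases hc : u.c = z.c
          · rcases share_iff_row_or_column.1 (hKK u hu z hz) with ⟨r', h1, h2, h3⟩ | ⟨-, h3⟩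
            · obtain rfl : r' = r := by
                rcases hzr.eq_or_eq hzt hrt h2 with h | rfl
                · exact h
                · rcases hur.eq_or_eq hus hrs h1 with h | h <;> omega
              unfold Ov at h3
              unfold lo hi
              simp only
              omega
            · rw [ov_of_has hur hus hrs hzr hzt hrt] at h3
              unfold Ov at h3
              unfold Between at hb
              omega
          · have hm := (hKK u hu z hz).symm.meet hzr hur hus hrs
              fun h => by rcases hzr.eq_or_eq hzt hrt h with h | h <;> omega
            obtain ⟨-, -, hm⟩ := hm
            unfold lo hi at *
            simp only
            omega
    · refine ⟨fun z => z.lo r, fun z => z.hi r, ?_, fun h => (hb h).elim, ?_⟩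
      · intro z hz hzr hzt w hw hwr hwt
        have h1 := hgap z hz hzr hzt
        have h2 := hgap w hw hwr hwt
        simp only
        omega
      · intro z hz hzr hzt
        refine ⟨le_rfl, le_rfl, ?_, ?_, ?_⟩
        · by_cases hodd : z.lo r = 2 * z.c
          · exact .of_coord hz z.isCoord_c (by simp only; omega)
          · exact .of_coord hz (z.isCoord_tip r) (by unfold lo at *; simp only; omega)
        · by_cases hodd : z.hi r = 2 * z.c
          · exact .of_coord hz z.isCoord_c (by simp only; omega)
          · exact .of_coord hz (z.isCoord_tip r) (by unfold hi at *; simp only; omega)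
        · intro u hu hur hus
          have hm := (hKK u hu z hz).symm.meet hzr hur hus hrs
            fun h => by rcases hzr.eq_or_eq hzt hrt h with h | h <;> omega
          exact ⟨hm.2.2.2, hm.2.2.1⟩
  obtain ⟨z₀, hz₀, hr₀, ht₀⟩ := hne
  have hF : (K.filter (fun z => z.Has r ∧ z.Has t)).Nonempty :=
    ⟨z₀, Finset.mem_filter.2 ⟨hz₀, hr₀, ht₀⟩⟩
  obtain ⟨v, hv, hvmax⟩ := Finset.exists_max_image _ a hF
  obtain ⟨w, hw, hwmin⟩ := Finset.exists_min_image _ b hF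
  simp only [Finset.mem_filter] at hv hw hvmax hwmin
  have hv' := hz v hv.1 hv.2.1 hv.2.2
  have hw' := hz w hw.1 hw.2.1 hw.2.2
  refine ⟨a v, b w, ⟨.inl rfl, .of_coord hz₀ (isCoord_of_has hr₀) (by simp), hv'.2.2.1,
    hw'.2.2.2.1⟩, hab v hv.1 hv.2.1 hv.2.2 w hw.1 hw.2.1 hw.2.2,
    fun h => ⟨(hodd h v).1, (hodd h w).2⟩, fun z hzK hzr hzt => ?_, fun z hzK hzr hzs => ?_⟩
  · have h1 := hz z hzK hzr hzt
    have h2 := hvmax z ⟨hzK, hzr, hzt⟩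
    have h3 := hwmin z ⟨hzK, hzr, hzt⟩
    exact con_row.2 ⟨hzr, by omega, by omega⟩
  · exact touch_row.2 ⟨hzr, (hw'.2.2.2.2 z hzK hzr hzs).1, (hv'.2.2.2.2 z hzK hzr hzs).2⟩

theorem between_comm {r s t : ℤ} : Between r s t ↔ Between r t s := by
  unfold Between
  rw [min_comm, max_comm]

/-- Paths on three rows, in the case that for each pair of rows there are two paths on these rows
that do not meet on the first of them. -/
theorem covered_of_triangle {K : Finset ZShape} (hKK : ∀ u ∈ K, ∀ v ∈ K, Share u v) {r s t : ℤ}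
    (hrt : r ≠ t) {x₁ y₁ x₂ y₂ x₃ y₃ : ZShape} (h₁ : Apart K r s x₁ y₁) (h₂ : Apart K s t x₂ y₂)
    (h₃ : Apart K t r x₃ y₃) : Covered K := by
  have hrs := h₁.2.2.1
  have hst := h₂.2.2.1
  obtain ⟨α₁, β₁, v₁, i₁, b₁, c₁, t₁⟩ := exists_interval hKK hrs hrt hst h₁
    ⟨x₃, h₃.1, h₃.2.2.2.1.2, h₃.2.2.2.1.1⟩
  obtain ⟨α₂, β₂, v₂, i₂, b₂, c₂, t₂⟩ := exists_interval hKK hst hrs.symm hrt.symm h₂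
    ⟨x₁, h₁.1, h₁.2.2.2.1.2, h₁.2.2.2.1.1⟩
  obtain ⟨α₃, β₃, v₃, i₃, b₃, c₃, t₃⟩ := exists_interval hKK hrt.symm hst.symm hrs h₃
    ⟨x₂, h₂.1, h₂.2.2.2.1.2, h₂.2.2.2.1.1⟩
  -- The cyclic order is `s`, `r`, `t`: paths on `r` and `t` contain the interval of row `r`, paths
  -- on `r` and `s` only touch it, and likewise around the cycle.
  have hY : IsCand K (Cand ⟨0, 2 * s, α₂, β₂⟩ ⟨0, 2 * r, α₁, β₁⟩ ⟨0, 2 * t, α₃, β₃⟩) := by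
    have con_has : ∀ {r α β : ℤ} {z : ZShape}, Con ⟨0, 2 * r, α, β⟩ z → z.Has r :=
      fun h => (con_row.1 h).1
    have touch_has : ∀ {r α β : ℤ} {z : ZShape}, Touch ⟨0, 2 * r, α, β⟩ z → z.Has r :=
      fun h => (touch_row.1 h).1
    refine ⟨_, _, _, v₂, v₁, v₃, rfl, fun u v hu hv => ?_⟩
    have b₁' : Between r t s → _ := fun h => b₁ (between_comm.1 h)
    rcases hu with ⟨hu, hu'⟩ | ⟨hu, hu'⟩ | ⟨hu, hu'⟩ <;>
      rcases hv with ⟨hv, hv'⟩ | ⟨hv, hv'⟩ | ⟨hv, hv'⟩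
    · exact share_of_con hrs.symm i₂ hu (touch_has hu') hv (touch_has hv')
    · exact share_of_con_touch hrs hrt b₁ hu' (con_has hu) hv (touch_has hv')
    · exact (share_of_con_touch hst hrs.symm b₂ hv' (con_has hv) hu (touch_has hu')).symm
    · exact (share_of_con_touch hrs hrt b₁ hv' (con_has hv) hu (touch_has hu')).symm
    · exact share_of_con hrt i₁ hu (touch_has hu') hv (touch_has hv')
    · exact share_of_con_touch hrt.symm hst.symm b₃ hu' (con_has hu) hv (touch_has hv')
    · exact share_of_con_touch hst hrs.symm b₂ hu' (con_has hu) hv (touch_has hv')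
    · exact (share_of_con_touch hrt.symm hst.symm b₃ hv' (con_has hv) hu (touch_has hu')).symm
    · exact share_of_con hst.symm i₃ hu (touch_has hu') hv (touch_has hv')
  refine ⟨_, _, hY, hY, fun z hz => .inl ?_⟩
  by_cases hr : z.Has r
  · by_cases hs : z.Has s
    · exact .inl ⟨c₂ z hz hs hr, t₁ z hz hr hs⟩
    · have ht := (h₂.has_or_has hKK hz).resolve_left hs
      exact .inr (.inl ⟨c₁ z hz hr ht, t₃ z hz ht hr⟩)
  · have hs := (h₁.has_or_has hKK hz).resolve_left hr
    have ht := (h₃.has_or_has hKK hz).resolve_right hr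
    exact .inr (.inr ⟨c₃ z hz ht hs, t₂ z hz hs ht⟩)

/-- The two rows suffice unless some paths on `s` without `r` fail to meet, which produces an apart
pair on `s` and a third row. Repeating the argument leads back to `r` and closes the triangle. -/
theorem covered_of_apart {K : Finset ZShape} (hKK : ∀ u ∈ K, ∀ v ∈ K, Share u v) {r s : ℤ}
    {x y : ZShape} (h : Apart K r s x y) : Covered K := by
  have pair : ∀ {r s : ℤ} {x y : ZShape}, Apart K r s x y →
      (∀ t x' y', t ≠ r → ¬ Apart K s t x' y') → Covered K := by
    intro r s x y h hn
    refine covered_of_rows ⟨x, h.1⟩ hKK h.2.2.1 (fun z hz => h.has_or_has hKK hz)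
      (fun u hu v hv hur hvr hus hvs => h.meet hKK hu hv hur hvr hus hvs)
      (fun u hu v hv hus hvs hur hvr => ?_)
    by_contra hm
    obtain ⟨t, ht⟩ := exists_apart hKK hu hv hus hvs hm
    refine hn t u v ?_ ht
    rintro rfl
    exact hur ht.2.2.2.1.2
  by_contra hcov
  obtain ⟨t, x', y', htr, h'⟩ : ∃ t x' y', t ≠ r ∧ Apart K s t x' y' := by
    by_contra hc
    push Not at hc
    exact hcov (pair h hc)
  obtain ⟨r', x'', y'', hr's, h''⟩ : ∃ r' x'' y'', r' ≠ s ∧ Apart K t r' x'' y'' := by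
    by_contra hc
    push Not at hc
    exact hcov (pair h' hc)
  have hrs := h.2.2.1
  have hst := h'.2.2.1
  have hx := h.2.2.2.1
  obtain rfl : r' = r := by
    rcases h''.has_or_has hKK h.1 with hh | hh <;> rcases hx.1.eq_or_eq hx.2 hrs hh with h1 | h1 <;>
      omega
  exact hcov (covered_of_triangle hKK htr.symm h h' h'')

/-- A clique of paths with three segments is covered by two cliques of a simple form. -/
theorem covered {K : Finset ZShape} (hK : K.Nonempty) (hKK : ∀ u ∈ K, ∀ v ∈ K, Share u v) :
    Covered K := by
  classical
  by_cases hap : ∃ r s x y, Apart K r s x y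
  · obtain ⟨r, s, x, y, h⟩ := hap
    exact covered_of_apart hKK h
  push Not at hap
  have hmeet : ∀ r, ∀ u ∈ K, ∀ v ∈ K, u.Has r → v.Has r → Meet r u v := by
    intro r u hu v hv hur hvr
    by_contra hc
    obtain ⟨s, hs⟩ := exists_apart hKK hu hv hur hvr hc
    exact hap _ _ _ _ hs
  have rows : ∀ p q, p ≠ q → (∀ z ∈ K, z.Has p ∨ z.Has q) → Covered K := fun p q hpq hc =>
    covered_of_rows hK hKK hpq hc (fun u hu v hv hp hq _ _ => hmeet _ u hu v hv hp hq)
      (fun u hu v hv hp hq _ _ => hmeet _ u hu v hv hp hq)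
  by_cases hdis : ∀ u ∈ K, ∀ v ∈ K, ∃ r, u.Has r ∧ v.Has r
  · obtain ⟨w, hw⟩ := hK
    refine rows w.a w.b w.hab fun z hz => ?_
    obtain ⟨r, rfl | rfl, hr⟩ := hdis w hw z hz
    · exact .inl hr
    · exact .inr hr
  push Not at hdis
  obtain ⟨u, hu, v, hv, huv⟩ := hdis
  have row : ∀ x ∈ K, ∀ y ∈ K, x.c ≠ y.c → ∃ r, x.Has r ∧ y.Has r := fun x hx y hy hc => by
    obtain ⟨r, hr⟩ := (share_iff_meet hc).1 (hKK x hx y hy)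
    exact ⟨r, hr.1, hr.2.1⟩
  have column : ∀ {x y}, x ∈ K → y ∈ K → (∀ r, x.Has r → ¬ y.Has r) → x.c = y.c := by
    intro x y hx hy h
    by_contra hc
    obtain ⟨r, hr, hr'⟩ := row x hx y hy hc
    exact h r hr hr'
  have hcuv := column hu hv huv
  -- If this fails, at most two columns occur, and each of them gives one candidate.
  by_cases hcol : ∃ w ∈ K, ∃ w' ∈ K, w.c ≠ u.c ∧ w'.c ≠ u.c ∧ w.c ≠ w'.c
  swap
  · push Not at hcol
    by_cases hw : ∃ w ∈ K, w.c ≠ u.c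
    · obtain ⟨w, hw, hwu⟩ := hw
      refine covered_of_union (S := K.filter (fun z => z.c = u.c))
        (S' := K.filter (fun z => z.c = w.c)) hK ?_ ?_ ?_
      · exact fun hne => exists_isCand_of_column hne (Finset.filter_subset _ _)
          (fun u hu v hv => hKK u (Finset.mem_filter.1 hu).1 v (Finset.mem_filter.1 hv).1)
          (fun z hz => (Finset.mem_filter.1 hz).2)
      · exact fun hne => exists_isCand_of_column hne (Finset.filter_subset _ _)
          (fun u hu v hv => hKK u (Finset.mem_filter.1 hu).1 v (Finset.mem_filter.1 hv).1)
          (fun z hz => (Finset.mem_filter.1 hz).2)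
      · intro z hz
        simp only [Finset.mem_filter, hz, true_and]
        by_cases hzu : z.c = u.c
        · exact .inl hzu
        · exact .inr (hcol w hw z hz hwu hzu).symm
    · push Not at hw
      have := exists_isCand_of_column hK (Finset.Subset.refl K) hKK hw
      exact covered_of_union (S := K) (S' := K) hK (fun _ => this) (fun _ => this)
        fun z hz => .inl hz
  obtain ⟨w, hw, w', hw', hwu, hwu', hww⟩ := hcol
  obtain ⟨p, hup, hwp⟩ := row u hu w hw hwu.symm
  obtain ⟨q, hvq, hwq⟩ := row v hv w hw (by omega)
  obtain ⟨p', hup', hpp'⟩ := u.exists_has_ne p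
  obtain ⟨q', hvq', hqq'⟩ := v.exists_has_ne q
  have hpq : p ≠ q := fun h => huv p hup (h ▸ hvq)
  have hpq' : p ≠ q' := fun h => huv p hup (h ▸ hvq')
  have hp'q : p' ≠ q := fun h => huv p' hup' (h ▸ hvq)
  have hp'q' : p' ≠ q' := fun h => huv p' hup' (h ▸ hvq')
  by_contra hcov
  have avoid : ∀ p q, p ≠ q → ∃ z ∈ K, ¬ z.Has p ∧ ¬ z.Has q := by
    intro p q hpq
    by_contra hc
    push Not at hc
    exact hcov (rows p q hpq fun z hz => or_iff_not_imp_left.2 (hc z hz))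
  have opposite : ∀ {x y p q}, x ∈ K → y ∈ K → x.Has p → x.Has q → p ≠ q → ¬ y.Has p →
      ¬ y.Has q → y.c = x.c := by
    intro x y p q hx hy hp hq hpq hp' hq'
    refine column hy hx fun r hr hr' => ?_
    rcases hp.eq_or_eq hq hpq hr' with rfl | rfl
    · exact hp' hr
    · exact hq' hr
  have hasu : ∀ z ∈ K, z.c ≠ u.c → z.Has p ∨ z.Has p' := by
    intro z hz hc
    obtain ⟨r, hr, hr'⟩ := row z hz u hu hc
    rcases hup.eq_or_eq hup' hpp'.symm hr' with rfl | rfl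
    · exact .inl hr
    · exact .inr hr
  have hasv : ∀ z ∈ K, z.c ≠ u.c → z.Has q ∨ z.Has q' := by
    intro z hz hc
    obtain ⟨r, hr, hr'⟩ := row z hz v hv (by omega)
    rcases hvq.eq_or_eq hvq' hqq'.symm hr' with rfl | rfl
    · exact .inl hr
    · exact .inr hr
  have cross : ∀ {x y p q s t}, x ∈ K → y ∈ K → x.Has p → x.Has q → p ≠ q → y.Has s → y.Has t →
      s ≠ t → p ≠ s → p ≠ t → q ≠ s → q ≠ t → Ov p q s t := by
    intro x y p q s t hx hy hp hq hpq hs ht hst h1 h2 h3 h4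
    rcases share_iff_row_or_column.1 (hKK x hx y hy) with ⟨r, hr, hr', -⟩ | ⟨-, h⟩
    · rcases hp.eq_or_eq hq hpq hr with h | h <;> rcases hs.eq_or_eq ht hst hr' with h' | h' <;>
        omega
    · exact (ov_of_has hp hq hpq hs ht hst).1 h
  -- The path `k` has no row of `w`, so it lies in the column of `w` and not in that of `u` and `v`.
  -- It shares a row with `u` and one with `v`, and only `p'` and `q'` remain.
  obtain ⟨k, hk, hkp, hkq⟩ := avoid p q hpq
  have hkc := opposite hw hk hwp hwq hpq hkp hkq
  have hkp' := (hasu k hk (by omega)).resolve_left hkp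
  have hkq' := (hasv k hk (by omega)).resolve_left hkq
  have o1 := cross hu hv hup hup' hpp'.symm hvq hvq' hqq'.symm hpq hpq' hp'q hp'q'
  have o2 := cross hw hk hwp hwq hpq hkp' hkq' hp'q' hpp'.symm hpq' hp'q.symm hqq'.symm
  -- The path `w'` has a row in common with each of `u`, `v`, `w`, `k`, so its rows are `p`, `q'` or
  -- `p'`, `q`. A path that avoids both then has the complementary pair.
  obtain ⟨r, hr, hr'⟩ := row w hw w' hw' hww
  rcases hwp.eq_or_eq hwq hpq hr with rfl | rfl
  · obtain ⟨r', hr1, hr2⟩ := row w' hw' k hk (by omega)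
    rcases hkp'.eq_or_eq hkq' hp'q' hr2 with rfl | rfl
    · rcases hasv w' hw' hwu' with h | h <;>
        rcases hr'.eq_or_eq hr1 hpp'.symm h with h | h <;> omega
    · obtain ⟨l, hl, hlp, hlq⟩ := avoid r r' hpq'
      have hlc := opposite hw' hl hr' hr1 hpq' hlp hlq
      have hlp' := (hasu l hl (by omega)).resolve_left hlp
      have hlq' := (hasv l hl (by omega)).resolve_right hlq
      have o3 := cross hw' hl hr' hr1 hpq' hlp' hlq' hp'q hpp'.symm hpq hp'q'.symm hqq'
      -- One of the three splittings of four distinct rows separates the two lowest from the two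
      -- highest, and its pairs do not overlap.
      unfold Ov at o1 o2 o3
      omega
  · obtain ⟨r', hr1, hr2⟩ := row w' hw' k hk (by omega)
    rcases hkp'.eq_or_eq hkq' hp'q' hr2 with rfl | rfl
    · obtain ⟨l, hl, hlp, hlq⟩ := avoid r' r hp'q
      have hlc := opposite hw' hl hr1 hr' hp'q hlp hlq
      have hlp' := (hasu l hl (by omega)).resolve_right hlp
      have hlq' := (hasv l hl (by omega)).resolve_left hlq
      have o3 := cross hw' hl hr1 hr' hp'q hlp' hlq' hpq' hpp' hp'q' hpq.symm hqq'.symm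
      unfold Ov at o1 o2 o3
      omega
    · rcases hasu w' hw' hwu' with h | h <;>
        rcases hr'.eq_or_eq hr1 hqq'.symm h with h | h <;> omega

end Track

end EPG

namespace EPG

/-! ### Independent sets of bipartite graphs by an auction -/

namespace Auction

variable {n : ℕ} {A B : ℕ → Prop} {R : ℕ → ℕ → Prop} {X Y : ℕ → ℤ}

/-- The state of an auction in which the elements of `A` bid for those of `B` along the edges `R`:
`X b` is the price of `b`, and `Y b = a + 1` when `b` belongs to `a`. -/
structure Inv (n : ℕ) (A B : ℕ → Prop) (R : ℕ → ℕ → Prop) (X Y : ℕ → ℤ) : Prop where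
  nonneg : ∀ b < n, 0 ≤ X b
  le : ∀ b < n, X b ≤ n + 1
  owner : ∀ b < n, 0 < X b → B b ∧ ∃ a < n, A a ∧ R a b ∧ Y b = a + 1 ∧
    ∀ b' < n, B b' → R a b' → X b ≤ X b' + 1
  free : ∀ b < n, X b = 0 → Y b = 0
  unique : ∀ b < n, ∀ b' < n, Y b = Y b' → 0 < Y b → b = b'

/-- The element `a` owns an element of `B`. -/
def Owns (n : ℕ) (B : ℕ → Prop) (Y : ℕ → ℤ) (a : ℕ) : Prop := ∃ b < n, B b ∧ Y b = a + 1

/-- Nobody wants to bid. -/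
def Stable (n : ℕ) (A B : ℕ → Prop) (R : ℕ → ℕ → Prop) (X Y : ℕ → ℤ) : Prop :=
  ∀ a < n, A a → Owns n B Y a ∨ ∀ b < n, B b → R a b → (n : ℤ) + 1 ≤ X b

theorem Inv.start (hX : ∀ b < n, X b = 0) (hY : ∀ b < n, Y b = 0) : Inv n A B R X Y where
  nonneg b hb := (hX b hb).ge
  le b hb := by rw [hX b hb]; positivity
  owner b hb h := by rw [hX b hb] at h; exact absurd h (lt_irrefl _)
  free b hb _ := hY b hb
  unique b hb _ _ _ h := by rw [hY b hb] at h; exact absurd h (lt_irrefl _)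

theorem Inv.pos_of_pos (h : Inv n A B R X Y) {b : ℕ} (hb : b < n) (hY : 0 < Y b) : 0 < X b := by
  have := h.nonneg b hb
  have := h.free b hb
  omega

/-- Bidding one more on a cheapest neighbour keeps the slack of one for the new owner. Prices never
fall, so it persists for the others, and the previous owner is simply overwritten. -/
theorem Inv.bid (h : Inv n A B R X Y) {a b : ℕ} (ha : a < n) (hA : A a) (hown : ¬ Owns n B Y a)
    (hb : b < n) (hB : B b) (hR : R a b) (hX : X b < n + 1)
    (hmin : ∀ b' < n, B b' → R a b' → X b ≤ X b') :
    Inv n A B R (Function.update X b (X b + 1)) (Function.update Y b (a + 1)) := by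
  have mono : ∀ c, X c ≤ Function.update X b (X b + 1) c := by
    intro c
    rw [Function.update_apply]
    split_ifs with hc
    · subst hc; omega
    · exact le_rfl
  refine ⟨fun c hc => (h.nonneg c hc).trans (mono c), fun c hc => ?_, fun c hc hpos => ?_,
    fun c hc h0 => ?_, fun c hc d hd hcd hpos => ?_⟩
  · rw [Function.update_apply]
    split_ifs
    · omega
    · exact h.le c hc
  · by_cases hcb : c = b
    · subst hcb
      refine ⟨hB, a, ha, hA, hR, by simp, fun b' hb' hBb' hRb' => ?_⟩
      have h1 := hmin b' hb' hBb' hRb'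
      have h2 := mono b'
      rw [Function.update_self]
      omega
    · rw [Function.update_of_ne hcb] at hpos
      obtain ⟨h1, a', h2, h3, h4, h5, h6⟩ := h.owner c hc hpos
      refine ⟨h1, a', h2, h3, h4, by rw [Function.update_of_ne hcb, h5], fun b' hb' g1 g2 => ?_⟩
      have g3 := h6 b' hb' g1 g2
      have g4 := mono b'
      rw [Function.update_of_ne hcb]
      omega
  · by_cases hcb : c = b
    · subst hcb
      have := h.nonneg c hc
      rw [Function.update_self] at h0
      omega
    · rw [Function.update_of_ne hcb] at h0 ⊢
      exact h.free c hc h0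
  · have key : ∀ e < n, e ≠ b → Y e ≠ a + 1 := by
      intro e he _ hYe
      exact hown ⟨e, he, (h.owner e he (h.pos_of_pos he (by omega))).1, hYe⟩
    by_cases hcb : c = b <;> by_cases hdb : d = b
    · rw [hcb, hdb]
    · subst hcb
      rw [Function.update_self, Function.update_of_ne hdb] at hcd
      exact absurd hcd.symm (key d hd hdb)
    · subst hdb
      rw [Function.update_self, Function.update_of_ne hcb] at hcd
      exact absurd hcd (key c hc hcb)
    · rw [Function.update_of_ne hcb] at hcd hpos
      rw [Function.update_of_ne hdb] at hcd
      exact h.unique c hc d hd hcd hpos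

theorem sum_update {b : ℕ} (hb : b < n) :
    ∑ i ∈ Finset.range n, Function.update X b (X b + 1) i = ∑ i ∈ Finset.range n, X i + 1 := by
  rw [Finset.sum_update_of_mem (Finset.mem_range.2 hb),
    ← Finset.add_sum_erase _ _ (Finset.mem_range.2 hb), Finset.sdiff_singleton_eq_erase]
  ring

theorem Inv.sum_le (h : Inv n A B R X Y) : ∑ i ∈ Finset.range n, X i ≤ n * (n + 1) := by
  have := Finset.sum_le_card_nsmul (Finset.range n) X (n + 1)
    fun i hi => h.le i (Finset.mem_range.1 hi)
  simpa using this

open Classical in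
/-- The number of elements of `A` and of elements of `B` without an owner. -/
noncomputable def value (n : ℕ) (A B : ℕ → Prop) (X : ℕ → ℤ) : ℕ :=
  ((Finset.range n).filter A).card + ((Finset.range n).filter (fun b => B b ∧ ¬ 0 < X b)).card

/-- No set without edges has more elements than the value of the auction. -/
theorem Inv.card_le_value (h : Inv n A B R X Y) {s : Finset ℕ} (hs : ∀ v ∈ s, v < n ∧ (A v ∨ B v))
    (hAB : ∀ v, A v → ¬ B v) (hind : ∀ a ∈ s, ∀ b ∈ s, A a → B b → ¬ R a b) :
    s.card ≤ value n A B X := by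
  classical
  rw [value, ← Finset.card_union_of_disjoint (Finset.disjoint_filter.2
    fun v _ hA hB => hAB v hA hB.1)]
  -- An owned element goes to its owner, which is joined to it by an edge and hence not in `s`.
  refine Finset.card_le_card_of_injOn (fun v => if A v ∨ ¬ 0 < X v then v else (Y v - 1).toNat)
    ?_ ?_
  · intro v hv
    obtain ⟨hvn, hv'⟩ := hs v hv
    simp only [Finset.coe_union, Finset.coe_filter, Finset.mem_range, Set.mem_union,
      Set.mem_ofPred_eq]
    split_ifs with hc
    · by_cases hA : A v
      · exact .inl ⟨hvn, hA⟩
      · exact .inr ⟨hvn, hv'.resolve_left hA, hc.resolve_left hA⟩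
    · push Not at hc
      obtain ⟨-, a, ha, hAa, -, hY, -⟩ := h.owner v hvn hc.2
      rw [hY]
      simpa using Or.inl ⟨ha, hAa⟩
  · intro v hv w hw hvw
    obtain ⟨hvn, hv'⟩ := hs v hv
    obtain ⟨hwn, hw'⟩ := hs w hw
    have key : ∀ v ∈ s, ∀ w ∈ s, v < n → w < n → (A v ∨ ¬ 0 < X v) → ¬ (A w ∨ ¬ 0 < X w) →
        v ≠ (Y w - 1).toNat := by
      intro v hv w hw hvn hwn hcv hcw heq
      push Not at hcw
      obtain ⟨hBw, a, ha, hAa, hR, hY, -⟩ := h.owner w hwn hcw.2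
      rw [hY] at heq
      have : v = a := by simpa using heq
      subst this
      exact hind v hv w hw hAa hBw hR
    simp only at hvw
    split_ifs at hvw with h1 h2 h2
    · exact hvw
    · exact absurd hvw (key v hv w hw hvn hwn h1 h2)
    · exact absurd hvw.symm (key w hw v hv hwn hvn h2 h1)
    · push Not at h1 h2
      obtain ⟨-, a, -, -, -, hY, -⟩ := h.owner v hvn h1.2
      obtain ⟨-, a', -, -, -, hY', -⟩ := h.owner w hwn h2.2
      refine h.unique v hvn w hwn ?_ (by omega)
      rw [hY, hY'] at hvw ⊢
      have : a = a' := by simpa using hvw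
      rw [this]

/-- When nobody wants to bid, there is a set without edges whose size is the value. -/
theorem Inv.exists_card_eq_value (h : Inv n A B R X Y) (hst : Stable n A B R X Y)
    (hAB : ∀ v, A v → ¬ B v) :
    ∃ s : Finset ℕ, s.card = value n A B X ∧ (∀ v ∈ s, v < n ∧ (A v ∨ B v)) ∧
      ∀ a ∈ s, ∀ b ∈ s, A a → B b → ¬ R a b := by
  classical
  -- Among `n + 1` price levels one is not attained. Cutting there gives the set: the elements of
  -- `B` below level `k`, and the elements of `A` that own none of them.
  obtain ⟨k, hk, hk'⟩ : ∃ k ∈ Finset.Icc (1 : ℤ) (n + 1), k ∉ (Finset.range n).image X := by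
    refine Finset.exists_mem_notMem_of_card_lt_card ?_
    calc ((Finset.range n).image X).card ≤ n := by
          simpa using Finset.card_image_le (s := Finset.range n) (f := X)
      _ < _ := by simp
  rw [Finset.mem_Icc] at hk
  have hk'' : ∀ b < n, X b ≠ k := fun b hb hbk =>
    hk' (Finset.mem_image.2 ⟨b, Finset.mem_range.2 hb, hbk⟩)
  let L := (Finset.range n).filter (fun b => 0 < X b ∧ X b < k)
  let C := L.image (fun b => (Y b - 1).toNat)
  have hCc : C.card = L.card := by
    refine Finset.card_image_of_injOn fun v hv w hw hvw => ?_
    simp only [L, Finset.coe_filter, Finset.mem_range, Set.mem_ofPred_eq] at hv hw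
    obtain ⟨-, a, -, -, -, hY, -⟩ := h.owner v hv.1 hv.2.1
    obtain ⟨-, a', -, -, -, hY', -⟩ := h.owner w hw.1 hw.2.1
    refine h.unique v hv.1 w hw.1 ?_ (by omega)
    simp only [hY, hY'] at hvw ⊢
    omega
  have hCA : C ⊆ (Finset.range n).filter A := by
    intro a ha
    obtain ⟨b, hb, rfl⟩ := Finset.mem_image.1 ha
    simp only [L, Finset.mem_filter, Finset.mem_range] at hb
    obtain ⟨-, a, ha, hA, -, hY, -⟩ := h.owner b hb.1 hb.2.1
    rw [hY]
    simpa using ⟨ha, hA⟩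
  let F := (Finset.range n).filter (fun b => B b ∧ ¬ 0 < X b)
  have hFL : Disjoint F L := Finset.disjoint_filter.2 fun b _ h1 h2 => h1.2 h2.1
  have hL : ∀ b ∈ F ∪ L, b < n ∧ B b ∧ X b < k := by
    intro b hb
    simp only [F, L, Finset.mem_union, Finset.mem_filter, Finset.mem_range] at hb
    rcases hb with hb | hb
    · exact ⟨hb.1, hb.2.1, by omega⟩
    · exact ⟨hb.1, (h.owner b hb.1 hb.2.1).1, hb.2.2⟩
  refine ⟨((Finset.range n).filter A \ C) ∪ (F ∪ L), ?_, ?_, ?_⟩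
  · rw [Finset.card_union_of_disjoint, Finset.card_union_of_disjoint hFL,
      Finset.card_sdiff_of_subset hCA, hCc]
    · have := Finset.card_le_card hCA
      rw [hCc] at this
      change _ = ((Finset.range n).filter A).card + F.card
      omega
    · refine Finset.disjoint_left.2 fun v hv hv' => ?_
      rw [Finset.mem_sdiff, Finset.mem_filter] at hv
      exact hAB v hv.1.2 (hL v hv').2.1
  · intro v hv
    rcases Finset.mem_union.1 hv with hv | hv
    · rw [Finset.mem_sdiff, Finset.mem_filter, Finset.mem_range] at hv
      exact ⟨hv.1.1, .inl hv.1.2⟩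
    · exact ⟨(hL v hv).1, .inr (hL v hv).2.1⟩
  · intro a ha b hb hA hB hR
    have ha' : a < n ∧ a ∉ C := by
      rcases Finset.mem_union.1 ha with ha | ha
      · rw [Finset.mem_sdiff, Finset.mem_filter, Finset.mem_range] at ha
        exact ⟨ha.1.1, ha.2⟩
      · exact absurd (hL a ha).2.1 (hAB a hA)
    have hb' : b < n ∧ X b < k := by
      rcases Finset.mem_union.1 hb with hb | hb
      · rw [Finset.mem_sdiff, Finset.mem_filter] at hb
        exact absurd hB (hAB b hb.1.2)
      · exact ⟨(hL b hb).1, (hL b hb).2.2⟩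
    -- If `a` owns `c`, the slack gives `X c ≤ X b + 1 ≤ k`. The level `k` is not attained, so `c`
    -- is below it and `a` was removed.
    rcases hst a ha'.1 hA with ⟨c, hc, hBc, hY⟩ | hall
    · have hpos := h.pos_of_pos hc (by omega)
      obtain ⟨-, a', -, -, -, hY', hmin⟩ := h.owner c hc hpos
      have : a' = a := by omega
      subst this
      have h1 := hmin b hb'.1 hB hR
      have h2 := hk'' c hc
      refine ha'.2 (Finset.mem_image.2 ⟨c, ?_, by simp [hY]⟩)
      simp only [L, Finset.mem_filter, Finset.mem_range]
      exact ⟨hc, hpos, by omega⟩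
    · have := hall b hb'.1 hB hR
      omega

end Auction

end EPG

namespace EPG

/-! ### A structured language with bounded loops -/

namespace Expr

/-- The product of an expression with a numeral. -/
def nmul : ℕ → Expr → Expr
  | 0, _ => const 0
  | k + 1, e => add (nmul k e) e

@[simp] theorem eval_nmul (M : Mem) (k : ℕ) (e : Expr) : (nmul k e).eval M = k * e.eval M := by
  induction k with
  | zero => simp [nmul, eval]
  | succ k ih => simp only [nmul, eval, ih]; push_cast; ring

end Expr

/-- Boolean combinations of comparisons. -/
inductive Test where
  | lt (e f : Expr)
  | and (φ ψ : Test)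
  | or (φ ψ : Test)
  | not (φ : Test)

namespace Test

/-- The truth value of a test. -/
def Sat (M : Mem) : Test → Prop
  | lt e f => e.eval M < f.eval M
  | and φ ψ => Sat M φ ∧ Sat M ψ
  | or φ ψ => Sat M φ ∨ Sat M ψ
  | not φ => ¬ Sat M φ

/-- The expression with value `1` if the test succeeds and `0` if it fails. -/
def toExpr : Test → Expr
  | lt e f => .lt e f
  | and φ ψ => .lt (.const 1) (.add φ.toExpr ψ.toExpr)
  | or φ ψ => .lt (.const 0) (.add φ.toExpr ψ.toExpr)
  | not φ => .sub (.const 1) φ.toExpr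

open Classical in
theorem eval_toExpr (M : Mem) (φ : Test) : φ.toExpr.eval M = if φ.Sat M then 1 else 0 := by
  induction φ with
  | lt e f =>
    simp only [toExpr, Expr.eval, Sat]
    congr
  | and φ ψ hφ hψ =>
    simp only [toExpr, Expr.eval, Sat, hφ, hψ]
    split_ifs <;> simp_all
  | or φ ψ hφ hψ =>
    simp only [toExpr, Expr.eval, Sat, hφ, hψ]
    split_ifs <;> simp_all
  | not φ hφ =>
    simp only [toExpr, Expr.eval, Sat, hφ]
    split_ifs <;> simp_all

theorem eval_toExpr_pos {M : Mem} {φ : Test} : 0 < φ.toExpr.eval M ↔ φ.Sat M := by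
  classical
  rw [eval_toExpr]
  split_ifs <;> simp_all

/-- The test `e ≤ f`. -/
def le (e f : Expr) : Test := not (lt f e)

/-- The test `e = f`. -/
def eq (e f : Expr) : Test := and (le e f) (le f e)

@[simp] theorem sat_lt {M : Mem} {e f : Expr} : (lt e f).Sat M ↔ e.eval M < f.eval M := Iff.rfl

@[simp] theorem sat_and {M : Mem} {φ ψ : Test} : (and φ ψ).Sat M ↔ φ.Sat M ∧ ψ.Sat M := Iff.rfl

@[simp] theorem sat_or {M : Mem} {φ ψ : Test} : (or φ ψ).Sat M ↔ φ.Sat M ∨ ψ.Sat M := Iff.rfl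

@[simp] theorem sat_not {M : Mem} {φ : Test} : (not φ).Sat M ↔ ¬ φ.Sat M := Iff.rfl

@[simp] theorem sat_le {M : Mem} {e f : Expr} : (le e f).Sat M ↔ e.eval M ≤ f.eval M := by
  simp [le]

@[simp] theorem sat_eq {M : Mem} {e f : Expr} : (eq e f).Sat M ↔ e.eval M = f.eval M := by
  simp [eq, le_antisymm_iff]

end Test

/-- The address of the variable number `i`. The input is at the nonnegative addresses, variables are
at `-1, …, -100`, and arrays are below. -/
def var (i : ℕ) : ℤ := -(i + 1)

/-- The value of a variable. -/
def Expr.var (i : ℕ) : Expr := .load (.const (EPG.var i))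

@[simp] theorem Expr.eval_var (M : Mem) (i : ℕ) : (Expr.var i).eval M = M (EPG.var i) := rfl

/-- The expression `a * n + b`, where `n` is the content of the cell `0`. -/
def Expr.bound (a b : ℕ) : Expr := .add (.nmul a (.load (.const 0))) (.const b)

theorem Expr.eval_bound {M : Mem} {n : ℕ} (hn : M 0 = n) (a b : ℕ) :
    (Expr.bound a b).eval M = ((a * n + b : ℕ) : ℤ) := by
  simp [Expr.bound, Expr.eval, hn]

/-- Commands: assignment to a variable, to an array cell, and a loop that runs `a * n + b` times,
where `n` is the content of the cell `0`. -/
inductive Cmd where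
  | nop
  | set (i : ℕ) (e : Expr)
  | put (e f : Expr)
  | seq (c d : Cmd)
  | cond (φ : Test) (c d : Cmd)
  | rep (i a b : ℕ) (c : Cmd)

namespace Cmd

open Classical in
/-- The memory after the execution of a command. -/
noncomputable def den : Cmd → Mem → Mem
  | nop, M => M
  | set i e, M => Function.update M (var i) (e.eval M)
  | put e f, M => if 0 ≤ e.eval M then Function.update M (-101 - e.eval M) (f.eval M) else M
  | seq c d, M => den d (den c M)
  | cond φ c d, M => if φ.Sat M then den c M else den d M
  | rep i a b c, M =>
    (fun M => Function.update (den c M) (var i) (den c M (var i) + 1))^[a * (M 0).toNat + b]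
      (Function.update M (var i) 0)

/-- The variables to which a command assigns. -/
def writes : Cmd → Set ℕ
  | nop => ∅
  | set i _ => {i}
  | put _ _ => ∅
  | seq c d => writes c ∪ writes d
  | cond _ c d => writes c ∪ writes d
  | rep i _ _ c => {i} ∪ writes c

/-- Loop counters are assigned to by their loops only. -/
def Ok : Cmd → Prop
  | nop => True
  | set i _ => i < 100
  | put _ _ => True
  | seq c d => Ok c ∧ Ok d
  | cond _ c d => Ok c ∧ Ok d
  | rep i _ _ c => i < 100 ∧ i ∉ writes c ∧ Ok c

/-- The program that carries out a command. -/
def compile : Cmd → Program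
  | nop => .skip
  | set i e => .store (.const (var i)) e
  | put e f => .ite (Test.le (.const 0) e).toExpr (.store (.sub (.const (-101)) e) f) .skip
  | seq c d => .seq c.compile d.compile
  | cond φ c d => .ite φ.toExpr c.compile d.compile
  | rep i a b c => .seq (.store (.const (var i)) (.const 0))
      (.loop (.lt (.var i) (.bound a b))
        (.seq c.compile (.store (.const (var i)) (.add (.var i) (.const 1)))))

open Polynomial in
/-- A bound for the running time in terms of the content of the cell `0`. -/
noncomputable def time : Cmd → ℕ[X]
  | nop => 1
  | set _ e => C (e.cost + 2)
  | put e f => C ((Test.le (.const 0) e).toExpr.cost + 1 + ((1 + e.cost + 1) + f.cost + 1))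
  | seq c d => time c + time d
  | cond φ c d => C (φ.toExpr.cost + 1) + (time c + time d)
  -- Initialising the counter costs 3. Each round pays the test, 1 for branching and 6 for the
  -- increment. The last summand is the final, failing test.
  | rep i a b c => C 3 + (C a * X + C b) * (time c + C (((Expr.var i).lt (.bound a b)).cost + 7)) +
      C (((Expr.var i).lt (.bound a b)).cost + 1)

theorem var_inj {i j : ℕ} : var i = var j ↔ i = j := by
  unfold var; omega

theorem den_of_notMem {c : Cmd} (hc : c.Ok) {x : ℤ} (hx : -100 ≤ x)
    (hw : ∀ i ∈ c.writes, x ≠ var i) (M : Mem) : den c M x = M x := by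
  induction c generalizing M with
  | nop => rfl
  | set i e => exact Function.update_of_ne (hw i rfl) _ _
  | put e f =>
    rw [den]
    split_ifs
    · exact Function.update_of_ne (by omega) _ _
    · rfl
  | seq c d ihc ihd =>
    rw [den, ihd hc.2 (fun i hi => hw i (.inr hi)), ihc hc.1 (fun i hi => hw i (.inl hi))]
  | cond φ c d ihc ihd =>
    rw [den]
    split_ifs
    · exact ihc hc.1 (fun i hi => hw i (.inl hi)) M
    · exact ihd hc.2 (fun i hi => hw i (.inr hi)) M
  | rep i a b c ih =>
    have hi : x ≠ var i := hw i (.inl rfl)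
    rw [den]
    generalize a * (M 0).toNat + b = N
    have : ∀ M', (fun M => Function.update (den c M) (var i) (den c M (var i) + 1))^[N] M' x =
        M' x := by
      induction N with
      | zero => exact fun _ => rfl
      | succ N ihN =>
        intro M'
        rw [Function.iterate_succ_apply, ihN, Function.update_of_ne hi,
          ih hc.2.2 (fun i hi => hw i (.inr hi))]
    rw [this, Function.update_of_ne hi]

theorem den_nonneg {c : Cmd} (hc : c.Ok) {x : ℤ} (hx : 0 ≤ x) (M : Mem) : den c M x = M x :=
  den_of_notMem hc (by omega) (fun i _ => by unfold var; omega) M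

theorem den_var {c : Cmd} (hc : c.Ok) {i : ℕ} (hi : i < 100) (hw : i ∉ c.writes) (M : Mem) :
    den c M (var i) = M (var i) :=
  den_of_notMem hc (by unfold var; omega) (fun j hj h => hw (by rw [var_inj.1 h]; exact hj)) M

/-- No command writes to the input, so cell `0` and every loop bound stay fixed. The body leaves its
loop counter alone, so the compiled loop makes exactly the prescribed number of rounds. -/
theorem runs_compile {c : Cmd} (hc : c.Ok) {n : ℕ} {M : Mem} (hn : M 0 = n) :
    ∃ t ≤ c.time.eval n, Runs c.compile M t (den c M) := by
  induction c generalizing M with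
  | nop => exact ⟨1, by simp [time], .skip M⟩
  | set i e => exact ⟨_, by simp [time, Expr.cost]; omega, .store _ _ M⟩
  | put e f =>
    rw [den, compile]
    split_ifs with h
    · refine ⟨_, ?_, .ite_pos _ (Test.eval_toExpr_pos.2 (Test.sat_le.2 h)) (.store _ _ M)⟩
      simp [time, Expr.cost]
    · refine ⟨_, ?_, .ite_neg _ (fun h' => h (Test.sat_le.1 (Test.eval_toExpr_pos.1 h')))
        (.skip M)⟩
      simp [time]
  | seq c d ihc ihd =>
    obtain ⟨t, ht, hr⟩ := ihc hc.1 hn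
    obtain ⟨t', ht', hr'⟩ := ihd hc.2 (M := den c M) (by rw [den_nonneg hc.1 le_rfl, hn])
    exact ⟨t + t', by simp only [time, Polynomial.eval_add]; omega, .seq hr hr'⟩
  | cond φ c d ihc ihd =>
    rw [den, compile]
    split_ifs with h
    · obtain ⟨t, ht, hr⟩ := ihc hc.1 hn
      refine ⟨_, ?_, .ite_pos _ (Test.eval_toExpr_pos.2 h) hr⟩
      simp only [time, Polynomial.eval_add, Polynomial.eval_C]
      omega
    · obtain ⟨t, ht, hr⟩ := ihd hc.2 hn
      refine ⟨_, ?_, .ite_neg _ (fun h' => h (Test.eval_toExpr_pos.1 h')) hr⟩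
      simp only [time, Polynomial.eval_add, Polynomial.eval_C]
      omega
  | rep i a b c ih =>
    have hbody : ∀ m : ℕ, ∀ M : Mem, M 0 = n → M (var i) + m = ((a * n + b : ℕ) : ℤ) →
        ∃ t ≤ m * (c.time.eval n + (((Expr.var i).lt (.bound a b)).cost + 7)) +
            (((Expr.var i).lt (.bound a b)).cost + 1),
          Runs (.loop (.lt (.var i) (.bound a b))
            (.seq c.compile (.store (.const (var i)) (.add (.var i) (.const 1))))) M t
            ((fun M => Function.update (den c M) (var i) (den c M (var i) + 1))^[m] M) := by
      intro m
      induction m with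
      | zero =>
        intro M h0 hm
        refine ⟨_, by omega, .loop_neg _ ?_⟩
        rw [Expr.eval, Expr.eval_var, Expr.eval_bound h0, if_neg (by omega)]
        exact lt_irrefl _
      | succ m ihm =>
        intro M h0 hm
        obtain ⟨t, ht, hr⟩ := ih hc.2.2 h0
        have hv := den_var hc.2.2 hc.1 hc.2.1 M
        obtain ⟨t', ht', hr'⟩ := ihm
          (Function.update (den c M) (var i) (den c M (var i) + 1))
          (by rw [Function.update_of_ne (by unfold var; omega), den_nonneg hc.2.2 le_rfl, h0])
          (by rw [Function.update_self, hv]; push_cast at hm ⊢; omega)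
        refine ⟨_, ?_, .loop_pos ?_ (.seq hr (.store _ _ _)) hr'⟩
        · rw [add_mul]
          simp only [Expr.cost, Expr.var] at ht' ⊢
          omega
        · rw [Expr.eval, Expr.eval_var, Expr.eval_bound h0, if_pos (by omega)]
          exact one_pos
    obtain ⟨t, ht, hr⟩ := hbody (a * n + b) (Function.update M (var i) 0)
      (by rw [Function.update_of_ne (by unfold var; omega), hn])
      (by rw [Function.update_self, zero_add])
    rw [den, hn, Int.toNat_natCast, compile]
    refine ⟨3 + t, ?_, .seq (.store _ _ M) hr⟩
    simp only [time, Polynomial.eval_add, Polynomial.eval_mul, Polynomial.eval_C, Polynomial.eval_X]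
    omega

/-- The invariant rule for loops. -/
theorem den_rep {i a b : ℕ} {c : Cmd} (hc : (rep i a b c).Ok) {n : ℕ} {M : Mem} (hn : M 0 = n)
    {I : ℕ → Mem → Prop} (h0 : I 0 (Function.update M (var i) 0))
    (hs : ∀ k < a * n + b, ∀ M : Mem, I k M → M 0 = n → M (var i) = k →
      I (k + 1) (Function.update (den c M) (var i) (k + 1))) :
    I (a * n + b) (den (rep i a b c) M) := by
  rw [den, hn, Int.toNat_natCast]
  suffices H : ∀ k ≤ a * n + b, ∀ M',
      M' = (fun M => Function.update (den c M) (var i) (den c M (var i) + 1))^[k]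
        (Function.update M (var i) 0) → I k M' ∧ M' 0 = n ∧ M' (var i) = k from
    (H _ le_rfl _ rfl).1
  intro k
  induction k with
  | zero =>
    rintro - _ rfl
    exact ⟨h0, by simp [Function.update_of_ne (show (0 : ℤ) ≠ var i by unfold var; omega), hn],
      by simp⟩
  | succ k ih =>
    rintro hk _ rfl
    obtain ⟨h1, h2, h3⟩ := ih (by omega) _ rfl
    rw [Function.iterate_succ_apply']
    generalize (fun M => Function.update (den c M) (var i) (den c M (var i) + 1))^[k]
      (Function.update M (var i) 0) = M' at h1 h2 h3 ⊢
    have hv := den_var hc.2.2 hc.1 hc.2.1 M'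
    rw [hv, h3]
    refine ⟨hs k (by omega) M' h1 h2 h3, ?_, by simp⟩
    rw [Function.update_of_ne (by unfold var; omega), den_nonneg hc.2.2 le_rfl, h2]

end Cmd

end EPG

namespace EPG

/-! ### The auction as a command -/

open Cmd

/-- The prices stored in the memory. -/
def price (M : Mem) (b : ℕ) : ℤ := M (-101 - 2 * b)

/-- The owners stored in the memory. -/
def owner (M : Mem) (b : ℕ) : ℤ := M (-102 - 2 * b)

namespace Expr

/-- The price of an element. -/
def price (e : Expr) : Expr := .load (.sub (.const (-101)) (.nmul 2 e))

/-- The owner of an element. -/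
def owner (e : Expr) : Expr := .load (.sub (.const (-102)) (.nmul 2 e))

theorem eval_price {M : Mem} {e : Expr} {b : ℕ} (h : e.eval M = b) :
    e.price.eval M = EPG.price M b := by
  simp [price, eval, h, EPG.price]

theorem eval_owner {M : Mem} {e : Expr} {b : ℕ} (h : e.eval M = b) :
    e.owner.eval M = EPG.owner M b := by
  simp [owner, eval, h, EPG.owner]

end Expr

namespace Cmd

/-- Set the price of an element. -/
def putPrice (e f : Expr) : Cmd := .put (.nmul 2 e) f

/-- Set the owner of an element. -/
def putOwner (e f : Expr) : Cmd := .put (.add (.nmul 2 e) (.const 1)) f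

theorem den_putPrice {M : Mem} {e f : Expr} {b : ℕ} (h : e.eval M = b) :
    den (putPrice e f) M = Function.update M (-101 - 2 * b) (f.eval M) := by
  rw [putPrice, den, Expr.eval_nmul, h, if_pos (by positivity)]
  rfl

theorem den_putOwner {M : Mem} {e f : Expr} {b : ℕ} (h : e.eval M = b) :
    den (putOwner e f) M = Function.update M (-102 - 2 * b) (f.eval M) := by
  rw [putOwner, den, Expr.eval, Expr.eval_nmul, h, Expr.eval, if_pos (by positivity)]
  congr 1
  push_cast
  ring

end Cmd

theorem update_var (M : Mem) (i j : ℕ) (x : ℤ) :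
    Function.update M (var i) x (var j) = if i = j then x else M (var j) := by
  rw [Function.update_apply]
  simp only [var_inj, eq_comm]

theorem price_update_var {M : Mem} {i : ℕ} (hi : i < 100) {x : ℤ} :
    price (Function.update M (var i) x) = price M :=
  funext fun b => Function.update_of_ne (by unfold var; omega) _ _

theorem owner_update_var {M : Mem} {i : ℕ} (hi : i < 100) {x : ℤ} :
    owner (Function.update M (var i) x) = owner M :=
  funext fun b => Function.update_of_ne (by unfold var; omega) _ _

theorem price_update_price {M : Mem} {b : ℕ} {x : ℤ} :
    price (Function.update M (-101 - 2 * b) x) = Function.update (price M) b x := by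
  funext c
  simp only [price, Function.update_apply]
  congr 1
  simp

theorem owner_update_owner {M : Mem} {b : ℕ} {x : ℤ} :
    owner (Function.update M (-102 - 2 * b) x) = Function.update (owner M) b x := by
  funext c
  simp only [owner, Function.update_apply]
  congr 1
  simp

theorem price_update_owner {M : Mem} {b : ℕ} {x : ℤ} :
    price (Function.update M (-102 - 2 * b) x) = price M :=
  funext fun c => Function.update_of_ne (by omega) _ _

theorem owner_update_price {M : Mem} {b : ℕ} {x : ℤ} :
    owner (Function.update M (-101 - 2 * b) x) = owner M :=
  funext fun c => Function.update_of_ne (by omega) _ _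

/-- The memories agree on the input and on the variables from number `10` on. -/
def Agree (M₀ M : Mem) : Prop :=
  (∀ x, 0 ≤ x → M x = M₀ x) ∧ ∀ j, 10 ≤ j → j < 100 → M (var j) = M₀ (var j)

theorem Agree.refl (M : Mem) : Agree M M := ⟨fun _ _ => rfl, fun _ _ _ => rfl⟩

theorem Agree.den {M₀ M : Mem} (h : Agree M₀ M) {c : Cmd} (hc : c.Ok)
    (hw : ∀ i ∈ c.writes, i < 10) : Agree M₀ (c.den M) :=
  ⟨fun x hx => (den_nonneg hc hx M).trans (h.1 x hx), fun j hj hj' =>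
    (den_var hc hj' (fun hjw => absurd (hw j hjw) (by omega)) M).trans (h.2 j hj hj')⟩

theorem Agree.update {M₀ M : Mem} (h : Agree M₀ M) {i : ℕ} (hi : i < 10) (x : ℤ) :
    Agree M₀ (Function.update M (var i) x) :=
  h.den (c := .set i (.const x)) (show i < 100 by omega) (fun _ hj => by
    rw [show _ = i from hj]; exact hi)

/-- The tests express the predicates on vertices. -/
structure Tests (n : ℕ) (M₀ : Mem) (φA φB : ℕ → Test) (φR : ℕ → ℕ → Test) (A B : ℕ → Prop)
    (R : ℕ → ℕ → Prop) : Prop where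
  n_eq : M₀ 0 = n
  sat_A : ∀ M, Agree M₀ M → ∀ i < 10, ∀ v < n, M (var i) = v → ((φA i).Sat M ↔ A v)
  sat_B : ∀ M, Agree M₀ M → ∀ i < 10, ∀ v < n, M (var i) = v → ((φB i).Sat M ↔ B v)
  sat_R : ∀ M, Agree M₀ M → ∀ i < 10, ∀ j < 10, ∀ v < n, ∀ w < n, M (var i) = v → M (var j) = w →
    ((φR i j).Sat M ↔ R v w)

namespace Cmd

/-- Reset prices and owners. -/
def reset : Cmd :=
  .rep 3 1 0 (.seq (putPrice (.var 3) (.const 0)) (putOwner (.var 3) (.const 0)))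

theorem den_reset {n : ℕ} {M : Mem} (hn : M 0 = n) :
    ∀ b < n, price (den reset M) b = 0 ∧ owner (den reset M) b = 0 := by
  have hc : reset.Ok := by simp [reset, Ok, putPrice, putOwner, writes]
  have := den_rep (I := fun k M => ∀ b < k, price M b = 0 ∧ owner M b = 0) hc hn
    (fun b hb => absurd hb (Nat.not_lt_zero b)) (fun k hk M hI h0 hv b hb => by
      rw [price_update_var (by norm_num), owner_update_var (by norm_num), den,
        den_putPrice (e := .var 3) (b := k) hv, den_putOwner (e := .var 3) (b := k)
          (by rw [Expr.eval_var, Function.update_of_ne (by unfold var; omega), hv])]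
      rw [price_update_owner, price_update_price, owner_update_owner, owner_update_price]
      simp only [Expr.eval, Function.update_apply]
      split_ifs with h
      · exact ⟨rfl, rfl⟩
      · exact hI b (by omega))
  rw [one_mul, add_zero] at this
  exact this

variable (φA φB : ℕ → Test) (φR : ℕ → ℕ → Test)

/-- Record in the variable `1` whether `A` and `B` are cliques. -/
def check : Cmd :=
  .seq (.set 1 (.const 1)) (.rep 3 1 0 (.rep 4 1 0
    (.cond (.and (φR 3 4) (.or (.and (φA 3) (φA 4)) (.and (φB 3) (φB 4)))) (.set 1 (.const 0))
      .nop)))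

/-- Look for the cheapest element for the element in the variable `3`. -/
def scan : Cmd :=
  -- Variable `5` flags ownership, `6` holds the cheapest element (`-1` for none) and `7` its price.
  -- Starting from the cap `n + 1`, the strict comparison ignores elements at the cap.
  .seq (.set 5 (.const 0)) (.seq (.set 6 (.const (-1))) (.seq (.set 7 (.bound 1 1)) (.rep 4 1 0
    (.cond (φB 4)
      (.seq (.cond (.eq (.owner (.var 4)) (.add (.var 3) (.const 1))) (.set 5 (.const 1)) .nop)
        (.cond (.and (φR 3 4) (.lt (.price (.var 4)) (.var 7)))
          (.seq (.set 6 (.var 4)) (.set 7 (.price (.var 4)))) .nop)) .nop))))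

/-- Let the element in the variable `3` bid if it owns nothing. -/
def bid : Cmd :=
  .seq (scan φB φR) (.cond (.and (φA 3) (.and (.le (.var 5) (.const 0)) (.lt (.const (-1)) (.var 6))))
    (.seq (putPrice (.var 6) (.add (.var 7) (.const 1)))
      (putOwner (.var 6) (.add (.var 3) (.const 1)))) .nop)

/-- All rounds of the auction. -/
def auction : Cmd := .rep 8 1 1 (.rep 9 1 1 (.rep 3 1 0 (bid φA φB φR)))

/-- Compute the value of the auction in the variable `2`. -/
def count : Cmd :=
  .seq (.set 2 (.const 0)) (.rep 3 1 0 (.seq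
    (.cond (φA 3) (.set 2 (.add (.var 2) (.const 1))) .nop)
    (.cond (.and (φB 3) (.le (.price (.var 3)) (.const 0))) (.set 2 (.add (.var 2) (.const 1)))
      .nop)))

/-- Improve the number in the variable `0` by the cliques inside the union of `A` and `B`. -/
def improve : Cmd :=
  .seq (check φA φB φR) (.seq reset (.seq (auction φA φB φR) (.seq (count φA φB)
    (.cond (.and (.lt (.const 0) (.var 1)) (.lt (.var 0) (.var 2))) (.set 0 (.var 2)) .nop))))

theorem ok_scan : (scan φB φR).Ok := by simp [scan, Ok, writes]

theorem writes_scan : (scan φB φR).writes ⊆ {4, 5, 6, 7} := by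
  intro i; simp [scan, writes]; tauto

theorem ok_bid : (bid φA φB φR).Ok := by simp [bid, scan, Ok, writes, putPrice, putOwner]

theorem writes_bid : (bid φA φB φR).writes ⊆ {4, 5, 6, 7} := by
  intro i; simp [bid, scan, writes, putPrice, putOwner]; tauto

theorem ok_auction : (auction φA φB φR).Ok := by
  simp [auction, bid, scan, Ok, writes, putPrice, putOwner]

theorem writes_auction : (auction φA φB φR).writes ⊆ {3, 4, 5, 6, 7, 8, 9} := by
  intro i; simp [auction, bid, scan, writes, putPrice, putOwner]; tauto

theorem ok_check : (check φA φB φR).Ok := by simp [check, Ok, writes]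

theorem writes_check : (check φA φB φR).writes ⊆ {1, 3, 4} := by
  intro i; simp [check, writes]; tauto

theorem ok_count : (count φA φB).Ok := by simp [count, Ok, writes]

theorem writes_count : (count φA φB).writes ⊆ {2, 3} := by
  intro i; simp [count, writes]; tauto

theorem ok_reset : reset.Ok := by simp [reset, Ok, writes, putPrice, putOwner]

theorem writes_reset : reset.writes ⊆ {3} := by simp [reset, writes, putPrice, putOwner]

theorem ok_improve : (improve φA φB φR).Ok :=
  ⟨ok_check _ _ _, ok_reset, ok_auction _ _ _, ok_count _ _, by simp [Ok]⟩

theorem writes_improve : ∀ i ∈ (improve φA φB φR).writes, i < 10 := by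
  rintro i (h | h | h | h | h)
  · have := writes_check _ _ _ h
    simp at this; omega
  · have := writes_reset h
    simp at this; omega
  · have := writes_auction _ _ _ h
    simp at this; omega
  · have := writes_count _ _ h
    simp at this; omega
  · simp [writes] at h; omega

end Cmd

namespace Tests

variable {n : ℕ} {M₀ : Mem} {φA φB : ℕ → Test} {φR : ℕ → ℕ → Test} {A B : ℕ → Prop}
  {R : ℕ → ℕ → Prop}

theorem zero_eq (T : Tests n M₀ φA φB φR A B R) {M : Mem} (h : Agree M₀ M) : M 0 = n :=
  (h.1 0 le_rfl).trans T.n_eq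

-- Writing one round of the scan as three unconditional updates lets the invariants of the variables
-- be checked separately.
open Classical in
theorem den_scan_body (T : Tests n M₀ φA φB φR A B R) {M : Mem} (h : Agree M₀ M) {a b : ℕ}
    (ha : a < n) (hb : b < n) (hMa : M (var 3) = a) (hMb : M (var 4) = b) :
    den (.cond (φB 4)
      (.seq (.cond (.eq (.owner (.var 4)) (.add (.var 3) (.const 1))) (.set 5 (.const 1)) .nop)
        (.cond (.and (φR 3 4) (.lt (.price (.var 4)) (.var 7)))
          (.seq (.set 6 (.var 4)) (.set 7 (.price (.var 4)))) .nop)) .nop) M =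
      Function.update (Function.update (Function.update M
        (var 5) (if B b ∧ owner M b = a + 1 then 1 else M (var 5)))
        (var 6) (if B b ∧ R a b ∧ price M b < M (var 7) then (b : ℤ) else M (var 6)))
        (var 7) (if B b ∧ R a b ∧ price M b < M (var 7) then price M b else M (var 7)) := by
  have hB := T.sat_B M h 4 (by norm_num) b hb hMb
  have ho : (Expr.owner (.var 4)).eval M = owner M b := Expr.eval_owner hMb
  have e5 : ∀ x, Function.update M (var 5) x (var 6) = M (var 6) := fun x => by simp [update_var]
  have e5' : ∀ x, Function.update M (var 5) x (var 7) = M (var 7) := fun x => by simp [update_var]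
  by_cases hBb : B b
  · rw [den, if_pos (hB.2 hBb), den]
    have h1 : den (.cond (.eq (.owner (.var 4)) (.add (.var 3) (.const 1))) (.set 5 (.const 1))
        .nop) M = Function.update M (var 5)
          (if B b ∧ owner M b = a + 1 then 1 else M (var 5)) := by
      rw [den, Test.sat_eq, ho]
      simp only [Expr.eval, Expr.eval_var, hMa, hBb, true_and]
      split_ifs
      · rfl
      · rw [Function.update_eq_self]; rfl
    rw [h1]
    generalize (if B b ∧ owner M b = a + 1 then 1 else M (var 5)) = x
    have hA' := h.update (i := 5) (by norm_num) x
    have h3 : Function.update M (var 5) x (var 3) = a := by simp [update_var, hMa]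
    have h4 : Function.update M (var 5) x (var 4) = b := by simp [update_var, hMb]
    have hR := T.sat_R _ hA' 3 (by norm_num) 4 (by norm_num) a ha b hb h3 h4
    have hp : (Expr.price (.var 4)).eval (Function.update M (var 5) x) = price M b := by
      rw [Expr.eval_price (M := Function.update M (var 5) x) (e := .var 4) h4, price_update_var (by norm_num)]
    rw [den, Test.sat_and, hR, Test.sat_lt, hp, Expr.eval_var, e5']
    simp only [hBb, true_and]
    split_ifs
    · rw [den, den, den, Expr.eval_var, h4, Expr.eval_price (e := .var 4) (b := b), price_update_var (by norm_num),
        price_update_var (by norm_num)]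
      rw [Expr.eval_var, update_var, if_neg (by norm_num), h4]
    · rw [den]
      conv_lhs => rw [← Function.update_eq_self (var 6) (Function.update M (var 5) x), e5]
      conv_lhs => rw [← Function.update_eq_self (var 7) (Function.update (Function.update M _ x) _ _)]
      rw [update_var _ 6, if_neg (by norm_num), e5']
  · rw [den, if_neg (fun hs => hBb (hB.1 hs)), den]
    simp only [hBb, false_and, if_false]
    rw [Function.update_eq_self, Function.update_eq_self, Function.update_eq_self]

end Tests

end EPG

/-! ### Correctness of the auction commands. -/

namespace EPG

open Cmd Auction

open Classical in
theorem Auction.value_succ (n : ℕ) (A B : ℕ → Prop) (X : ℕ → ℤ) :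
    value (n + 1) A B X =
      value n A B X + (if A n then 1 else 0) + if B n ∧ X n ≤ 0 then 1 else 0 := by
  simp only [value, Finset.range_add_one, Finset.filter_insert, not_lt]
  split_ifs <;> simp <;> omega

namespace Tests

variable {n : ℕ} {M₀ : Mem} {φA φB : ℕ → Test} {φR : ℕ → ℕ → Test} {A B : ℕ → Prop}
  {R : ℕ → ℕ → Prop}

/-- The variables `5`, `6` and `7` after the inspection of the elements below `k`. -/
def Scanned (n : ℕ) (B : ℕ → Prop) (R : ℕ → ℕ → Prop) (X Y : ℕ → ℤ) (a k : ℕ) (M : Mem) : Prop :=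
  (0 < M (var 5) ↔ Owns k B Y a) ∧
    ((M (var 6) = -1 ∧ M (var 7) = n + 1 ∧ ∀ b < k, B b → R a b → (n : ℤ) + 1 ≤ X b) ∨
      ∃ b < k, M (var 6) = b ∧ M (var 7) = X b ∧ X b < n + 1 ∧ B b ∧ R a b ∧
        ∀ b' < k, B b' → R a b' → X b ≤ X b')

theorem scan_spec (T : Tests n M₀ φA φB φR A B R) {M : Mem} (h : Agree M₀ M) {a : ℕ}
    (ha : a < n) (hMa : M (var 3) = a) :
    price (den (scan φB φR) M) = price M ∧ owner (den (scan φB φR) M) = owner M ∧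
      Scanned n B R (price M) (owner M) a n (den (scan φB φR) M) := by
  classical
  have hok := ok_scan φB φR
  rw [scan, den, den, den]
  set M₁ := den (.set 7 (.bound 1 1)) (den (.set 6 (.const (-1))) (den (.set 5 (.const 0)) M))
    with hM₁
  have hA₁ : Agree M₀ M₁ := ((h.update (by norm_num) _).update (by norm_num) _).update
    (by norm_num) _
  have hX₁ : price M₁ = price M := by
    rw [hM₁, den, den, den, price_update_var (by norm_num), price_update_var (by norm_num),
      price_update_var (by norm_num)]
  have hY₁ : owner M₁ = owner M := by
    rw [hM₁, den, den, den, owner_update_var (by norm_num), owner_update_var (by norm_num),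
      owner_update_var (by norm_num)]
  have h3 : M₁ (var 3) = a := by simp [hM₁, den, update_var, hMa]
  have h5 : M₁ (var 5) = 0 := by simp [hM₁, den, update_var, Expr.eval]
  have h6 : M₁ (var 6) = -1 := by simp [hM₁, den, update_var, Expr.eval]
  have h7 : M₁ (var 7) = n + 1 := by
    rw [hM₁, den, Function.update_self, Expr.eval_bound (n := n)]
    · push_cast; ring
    · exact T.zero_eq ((h.update (by norm_num) _).update (by norm_num) _)
  have := den_rep (I := fun k M' => Agree M₀ M' ∧ M' (var 3) = a ∧ price M' = price M ∧
      owner M' = owner M ∧ Scanned n B R (price M) (owner M) a k M') hok.2.2.2 (T.zero_eq hA₁)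
    ?_ ?_
  · rw [one_mul, add_zero] at this
    exact this.2.2
  · refine ⟨hA₁.update (by norm_num) _, by simp [update_var, h3],
      by rw [price_update_var (by norm_num), hX₁], by rw [owner_update_var (by norm_num), hY₁], ?_,
      .inl ?_⟩
    · simp [update_var, h5, Owns]
    · simp [update_var, h6, h7]
  · rintro k hk M' ⟨hA, hv3, hX, hY, hs1, hs2⟩ h0 hv4
    rw [one_mul, add_zero] at hk
    rw [T.den_scan_body hA ha hk hv3 hv4, hX, hY]
    refine ⟨(((hA.update (by norm_num) _).update (by norm_num) _).update (by norm_num) _).update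
      (by norm_num) _, by simp [update_var, hv3], ?_, ?_, ?_, ?_⟩
    · rw [price_update_var (by norm_num), price_update_var (by norm_num),
        price_update_var (by norm_num), price_update_var (by norm_num), hX]
    · rw [owner_update_var (by norm_num), owner_update_var (by norm_num),
        owner_update_var (by norm_num), owner_update_var (by norm_num), hY]
    · simp only [update_var, Nat.reduceEqDiff, if_false, if_true]
      by_cases hc : B k ∧ owner M k = a + 1
      · simp only [hc, and_self, if_true, one_pos, true_iff]
        exact ⟨k, by omega, hc⟩
      · simp only [hc, if_false, hs1, Owns]
        constructor
        · rintro ⟨b, hb, hb'⟩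
          exact ⟨b, by omega, hb'⟩
        · rintro ⟨b, hb, hb'⟩
          refine ⟨b, ?_, hb'⟩
          rcases Nat.lt_succ_iff_lt_or_eq.1 hb with h | rfl
          · exact h
          · exact absurd hb' hc
    · simp only [update_var, Nat.reduceEqDiff, if_false, if_true]
      by_cases hc : B k ∧ R a k ∧ price M k < M' (var 7)
      · rw [if_pos hc, if_pos hc]
        refine .inr ⟨k, by omega, rfl, rfl, ?_, hc.1, hc.2.1, fun b hb h1 h2 => ?_⟩
        · rcases hs2 with ⟨-, h7', -⟩ | ⟨b, hb, -, h7', hlt, -⟩ <;> omega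
        · rcases Nat.lt_succ_iff_lt_or_eq.1 hb with hb | rfl
          · rcases hs2 with ⟨-, h7', hall⟩ | ⟨c, hc', -, h7', hlt, -, -, hall⟩
            · have := hall b hb h1 h2
              omega
            · have := hall b hb h1 h2
              omega
          · exact le_rfl
      · rw [if_neg hc, if_neg hc]
        rcases hs2 with ⟨h6', h7', hall⟩ | ⟨c, hck, h6', h7', hlt, hBc, hRc, hall⟩
        · refine .inl ⟨h6', h7', fun b hb h1 h2 => ?_⟩
          rcases Nat.lt_succ_iff_lt_or_eq.1 hb with hb | rfl
          · exact hall b hb h1 h2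
          · by_contra hcon
            exact hc ⟨h1, h2, by omega⟩
        · refine .inr ⟨c, by omega, h6', h7', hlt, hBc, hRc, fun b hb h1 h2 => ?_⟩
          rcases Nat.lt_succ_iff_lt_or_eq.1 hb with hb | rfl
          · exact hall b hb h1 h2
          · by_contra hcon
            exact hc ⟨h1, h2, by omega⟩

/-- The element `a` does not want to bid. -/
def Content (n : ℕ) (A B : ℕ → Prop) (R : ℕ → ℕ → Prop) (X Y : ℕ → ℤ) (a : ℕ) : Prop :=
  A a → Owns n B Y a ∨ ∀ b < n, B b → R a b → (n : ℤ) + 1 ≤ X b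

theorem bid_spec (T : Tests n M₀ φA φB φR A B R) {M : Mem} (h : Agree M₀ M) {a : ℕ}
    (ha : a < n) (hMa : M (var 3) = a) (hI : Inv n A B R (price M) (owner M)) :
    Inv n A B R (price (den (bid φA φB φR) M)) (owner (den (bid φA φB φR) M)) ∧
      ((Content n A B R (price M) (owner M) a ∧ price (den (bid φA φB φR) M) = price M ∧
          owner (den (bid φA φB φR) M) = owner M) ∨
        (¬ Content n A B R (price M) (owner M) a ∧
          ∑ i ∈ Finset.range n, price (den (bid φA φB φR) M) i =
            ∑ i ∈ Finset.range n, price M i + 1)) := by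
  classical
  obtain ⟨hX, hY, h5, h6⟩ := T.scan_spec h ha hMa
  have hA' : Agree M₀ (den (scan φB φR) M) := h.den (ok_scan φB φR) fun i hi => by
    have := writes_scan _ _ hi
    simp at this
    omega
  have h3 : den (scan φB φR) M (var 3) = a := by
    rw [den_var (ok_scan φB φR) (by norm_num) (fun hi => by simpa using writes_scan _ _ hi), hMa]
  have hAs := T.sat_A _ hA' 3 (by norm_num) a ha h3
  rw [bid, den, den]
  generalize den (scan φB φR) M = M' at *
  simp only [Test.sat_and, hAs, Test.sat_le, Test.sat_lt, Expr.eval_var, Expr.eval]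
  rw [← hX] at hI h6 ⊢
  rw [← hY] at hI h5 ⊢
  by_cases hc : A a ∧ M' (var 5) ≤ 0 ∧ -1 < M' (var 6)
  · rw [if_pos hc]
    have hown : ¬ Owns n B (owner M') a := fun ho => by have := h5.2 ho; omega
    rcases h6 with ⟨h6, -⟩ | ⟨b, hb, h6, h7, hlt, hBb, hRb, hmin⟩
    · omega
    rw [den, den_putPrice (e := .var 6) (b := b) h6, den_putOwner (e := .var 6) (b := b)
      (by rw [Expr.eval_var, Function.update_of_ne (by unfold var; omega), h6])]
    rw [price_update_owner, price_update_price, owner_update_owner, owner_update_price]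
    simp only [Expr.eval, Expr.eval_var]
    rw [h7, Function.update_of_ne (show var 3 ≠ -101 - 2 * (b : ℤ) by unfold var; omega), h3]
    refine ⟨hI.bid ha hc.1 hown hb hBb hRb hlt hmin, .inr ⟨fun hcont => ?_, sum_update hb⟩⟩
    rcases hcont hc.1 with ho | hall
    · exact hown ho
    · have := hall b hb hBb hRb
      omega
  · rw [if_neg hc]
    refine ⟨hI, .inl ⟨fun hAa => ?_, rfl, rfl⟩⟩
    by_cases ho : Owns n B (owner M') a
    · exact .inl ho
    · have : M' (var 5) ≤ 0 := by
        by_contra hcon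
        exact ho (h5.1 (by omega))
      rcases h6 with ⟨h6, -, hall⟩ | ⟨b, hb, h6, -⟩
      · exact .inr hall
      · exact absurd ⟨hAa, this, by omega⟩ hc

/-- A pass without a bid finds every element content with unchanged prices, which is stability. A
pass with a bid raises the sum of the prices. -/
theorem pass_spec (T : Tests n M₀ φA φB φR A B R) {M : Mem} (h : Agree M₀ M)
    (hI : Inv n A B R (price M) (owner M)) :
    Inv n A B R (price (den (.rep 3 1 0 (bid φA φB φR)) M))
        (owner (den (.rep 3 1 0 (bid φA φB φR)) M)) ∧
      (Stable n A B R (price (den (.rep 3 1 0 (bid φA φB φR)) M))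
          (owner (den (.rep 3 1 0 (bid φA φB φR)) M)) ∨
        ¬ Stable n A B R (price M) (owner M) ∧ ∑ i ∈ Finset.range n, price M i + 1 ≤
            ∑ i ∈ Finset.range n, price (den (.rep 3 1 0 (bid φA φB φR)) M) i) := by
  have hok : (Cmd.rep 3 1 0 (bid φA φB φR)).Ok :=
    ⟨by norm_num, fun hi => by simpa using writes_bid _ _ _ hi, ok_bid _ _ _⟩
  have := den_rep (I := fun k M' => Agree M₀ M' ∧ Inv n A B R (price M') (owner M') ∧
      ((price M' = price M ∧ owner M' = owner M ∧
          ∀ a < k, Content n A B R (price M) (owner M) a) ∨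
        (¬ Stable n A B R (price M) (owner M) ∧ ∑ i ∈ Finset.range n, price M i + 1 ≤
            ∑ i ∈ Finset.range n, price M' i))) hok (T.zero_eq h) ?_ ?_
  · rw [one_mul, add_zero] at this
    obtain ⟨-, h1, ⟨h2, h3, h4⟩ | h2⟩ := this
    · exact ⟨h1, .inl (by rw [h2, h3]; exact h4)⟩
    · exact ⟨h1, .inr h2⟩
  · rw [price_update_var (by norm_num), owner_update_var (by norm_num)]
    exact ⟨h.update (by norm_num) _, hI, .inl ⟨rfl, rfl, by simp⟩⟩
  · rintro k hk M' ⟨hA, hI', hor⟩ h0 hv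
    rw [one_mul, add_zero] at hk
    rw [price_update_var (by norm_num), owner_update_var (by norm_num)]
    obtain ⟨g1, g2⟩ := T.bid_spec hA hk hv hI'
    refine ⟨(hA.den (ok_bid _ _ _) fun i hi => ?_).update (by norm_num) _, g1, ?_⟩
    · have := writes_bid _ _ _ hi
      simp at this
      omega
    rcases hor with ⟨h1, h2, h3⟩ | ⟨h1, h2⟩
    · rw [h1, h2] at g2
      rcases g2 with ⟨g2, g3, g4⟩ | ⟨g2, g3⟩
      · refine .inl ⟨g3, g4, fun a ha => ?_⟩
        rcases Nat.lt_succ_iff_lt_or_eq.1 ha with ha | rfl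
        · exact h3 a ha
        · exact g2
      · exact .inr ⟨fun hst => g2 (hst k hk), g3.ge⟩
    · refine .inr ⟨h1, ?_⟩
      rcases g2 with ⟨-, g3, -⟩ | ⟨-, g3⟩
      · rw [g3]; exact h2
      · omega

theorem auction_spec (T : Tests n M₀ φA φB φR A B R) {M : Mem} (h : Agree M₀ M)
    (hX : ∀ b < n, price M b = 0) (hY : ∀ b < n, owner M b = 0) :
    Inv n A B R (price (den (auction φA φB φR) M)) (owner (den (auction φA φB φR) M)) ∧
      Stable n A B R (price (den (auction φA φB φR) M)) (owner (den (auction φA φB φR) M)) := by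
  have hok := ok_auction φA φB φR
  have hpass : ∀ {M : Mem}, Agree M₀ M → Agree M₀ (den (.rep 3 1 0 (bid φA φB φR)) M) :=
    fun {M} h => h.den hok.2.2.2.2 fun i hi => by
      have := writes_auction φA φB φR (.inr (.inr hi))
      simp at this
      omega
  have step : ∀ {M : Mem} {k : ℕ}, Inv n A B R (price M) (owner M) → Agree M₀ M →
      (Stable n A B R (price M) (owner M) ∨ (k : ℤ) ≤ ∑ i ∈ Finset.range n, price M i) →
      Inv n A B R (price (den (.rep 3 1 0 (bid φA φB φR)) M))
          (owner (den (.rep 3 1 0 (bid φA φB φR)) M)) ∧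
        (Stable n A B R (price (den (.rep 3 1 0 (bid φA φB φR)) M))
            (owner (den (.rep 3 1 0 (bid φA φB φR)) M)) ∨
          ((k + 1 : ℕ) : ℤ) ≤
            ∑ i ∈ Finset.range n, price (den (.rep 3 1 0 (bid φA φB φR)) M) i) := by
    intro M k hI hA hor
    obtain ⟨h1, h2 | ⟨h2, h3⟩⟩ := T.pass_spec hA hI
    · exact ⟨h1, .inl h2⟩
    · exact ⟨h1, .inr (by have := hor.resolve_left h2; push_cast; omega)⟩
  have := den_rep (I := fun k M' => Agree M₀ M' ∧ Inv n A B R (price M') (owner M') ∧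
      (Stable n A B R (price M') (owner M') ∨
        ((k * (n + 1) : ℕ) : ℤ) ≤ ∑ i ∈ Finset.range n, price M' i)) hok (T.zero_eq h) ?_ ?_
  · obtain ⟨-, h1, h2 | h2⟩ := this
    · exact ⟨h1, h2⟩
    -- After `(n + 1) ^ 2` passes without stability, the prices would sum to more than their bound
    -- `n * (n + 1)`.
    · have := h1.sum_le
      push_cast at h2
      nlinarith
  · rw [price_update_var (by norm_num), owner_update_var (by norm_num)]
    exact ⟨h.update (by norm_num) _, .start hX hY, .inr (by
      rw [Finset.sum_eq_zero fun b hb => hX b (Finset.mem_range.1 hb)]; simp)⟩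
  · rintro k hk M' ⟨hA, hI, hor⟩ h0 hv
    rw [price_update_var (by norm_num), owner_update_var (by norm_num)]
    have := den_rep (I := fun j M' => Agree M₀ M' ∧ Inv n A B R (price M') (owner M') ∧
      (Stable n A B R (price M') (owner M') ∨
        ((k * (n + 1) + j : ℕ) : ℤ) ≤ ∑ i ∈ Finset.range n, price M' i)) hok.2.2 h0 ?_ ?_
    · rw [one_mul] at this
      refine ⟨this.1.update (by norm_num) _, this.2.1, ?_⟩
      rw [add_mul, one_mul]
      exact this.2.2
    · rw [price_update_var (by norm_num), owner_update_var (by norm_num)]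
      exact ⟨hA.update (by norm_num) _, hI, hor⟩
    · rintro j hj M'' ⟨hA'', hI'', hor''⟩ h0'' hv''
      rw [price_update_var (by norm_num), owner_update_var (by norm_num)]
      have := step hI'' hA'' hor''
      exact ⟨(hpass hA'').update (by norm_num) _, this⟩

theorem check_spec (T : Tests n M₀ φA φB φR A B R) {M : Mem} (h : Agree M₀ M) :
    0 < den (check φA φB φR) M (var 1) ↔
      ∀ a < n, ∀ b < n, R a b → ¬ ((A a ∧ A b) ∨ (B a ∧ B b)) := by
  classical
  have hok := ok_check φA φB φR
  have h1 := h.update (i := 1) (by norm_num) 1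
  have := den_rep (I := fun k M' => Agree M₀ M' ∧ (0 < M' (var 1) ↔
      ∀ a < k, ∀ b < n, R a b → ¬ ((A a ∧ A b) ∨ (B a ∧ B b)))) hok.2 (T.zero_eq h1) ?_ ?_
  · rw [one_mul, add_zero] at this
    exact this.2
  · exact ⟨h1.update (by norm_num) _, by simp [update_var]⟩
  · rintro k hk M' ⟨hA, hI⟩ h0 hv
    rw [one_mul, add_zero] at hk
    have := den_rep (I := fun j M' => Agree M₀ M' ∧ M' (var 3) = k ∧ (0 < M' (var 1) ↔
      (∀ a < k, ∀ b < n, R a b → ¬ ((A a ∧ A b) ∨ (B a ∧ B b))) ∧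
        ∀ b < j, R k b → ¬ ((A k ∧ A b) ∨ (B k ∧ B b)))) hok.2.2.2 h0 ?_ ?_
    · rw [one_mul, add_zero] at this
      refine ⟨this.1.update (by norm_num) _, ?_⟩
      rw [update_var, if_neg (by norm_num), this.2.2]
      constructor
      · rintro ⟨g1, g2⟩ a ha
        rcases Nat.lt_succ_iff_lt_or_eq.1 ha with ha | rfl
        · exact g1 a ha
        · exact g2
      · exact fun g => ⟨fun a ha => g a (by omega), g k (by omega)⟩
    · refine ⟨hA.update (by norm_num) _, by simp [update_var, hv], ?_⟩
      rw [update_var, if_neg (by norm_num), hI]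
      simp
    · rintro j hj M'' ⟨hA'', hv3, hI''⟩ h0'' hv4
      rw [one_mul, add_zero] at hj
      have hR := T.sat_R _ hA'' 3 (by norm_num) 4 (by norm_num) k hk j hj hv3 hv4
      have hA3 := T.sat_A _ hA'' 3 (by norm_num) k hk hv3
      have hA4 := T.sat_A _ hA'' 4 (by norm_num) j hj hv4
      have hB3 := T.sat_B _ hA'' 3 (by norm_num) k hk hv3
      have hB4 := T.sat_B _ hA'' 4 (by norm_num) j hj hv4
      rw [den]
      simp only [Test.sat_and, Test.sat_or, hR, hA3, hA4, hB3, hB4]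
      split_ifs with hc
      · rw [den]
        refine ⟨(hA''.update (by norm_num) _).update (by norm_num) _, by simp [update_var, hv3], ?_⟩
        simp only [update_var, Nat.reduceEqDiff, if_false, if_true, Expr.eval, lt_irrefl, false_iff]
        exact fun g => g.2 j (by omega) hc.1 hc.2
      · rw [den]
        refine ⟨hA''.update (by norm_num) _, by simp [update_var, hv3], ?_⟩
        rw [update_var, if_neg (by norm_num), hI'']
        refine and_congr_right fun _ => ⟨fun g b hb hRb => ?_, fun g b hb => g b (by omega)⟩
        rcases Nat.lt_succ_iff_lt_or_eq.1 hb with hb | rfl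
        · exact g b hb hRb
        · exact fun g' => hc ⟨hRb, g'⟩

theorem count_spec (T : Tests n M₀ φA φB φR A B R) {M : Mem} (h : Agree M₀ M) :
    den (count φA φB) M (var 2) = value n A B (price M) := by
  classical
  have hok := ok_count φA φB
  have h1 := h.update (i := 2) (by norm_num) 0
  have := den_rep (I := fun k M' => Agree M₀ M' ∧ price M' = price M ∧
      M' (var 2) = value k A B (price M)) hok.2 (T.zero_eq h1) ?_ ?_
  · rw [one_mul, add_zero] at this
    exact this.2.2
  · refine ⟨h1.update (by norm_num) _, ?_, by simp [update_var, value]⟩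
    rw [price_update_var (by norm_num), price_update_var (by norm_num)]
  · rintro k hk M' ⟨hA, hX, hI⟩ h0 hv
    rw [one_mul, add_zero] at hk
    have hA3 := T.sat_A _ hA 3 (by norm_num) k hk hv
    have e1 : den (.cond (φA 3) (.set 2 (.add (.var 2) (.const 1))) .nop) M' =
        Function.update M' (var 2) (M' (var 2) + if A k then 1 else 0) := by
      rw [den]
      simp only [hA3]
      split_ifs
      · rfl
      · rw [add_zero, Function.update_eq_self]; rfl
    rw [den, e1]
    have hA' := hA.update (i := 2) (by norm_num) (M' (var 2) + if A k then 1 else 0)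
    have hv' : Function.update M' (var 2) (M' (var 2) + if A k then 1 else 0) (var 3) = k := by
      rw [update_var, if_neg (by norm_num), hv]
    have hB3 := T.sat_B _ hA' 3 (by norm_num) k hk hv'
    have hX' : price (Function.update M' (var 2) (M' (var 2) + if A k then 1 else 0)) = price M := by
      rw [price_update_var (by norm_num), hX]
    have hv2 : Function.update M' (var 2) (M' (var 2) + if A k then 1 else 0) (var 2) =
        value k A B (price M) + if A k then 1 else 0 := by
      rw [Function.update_self, hI]
    generalize Function.update M' (var 2) (M' (var 2) + if A k then 1 else 0) = M'' at *
    have hp : (Expr.price (.var 3)).eval M'' = price M k := by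
      rw [Expr.eval_price (e := .var 3) hv', hX']
    rw [value_succ, den]
    simp only [Test.sat_and, hB3, Test.sat_le, hp, Expr.eval]
    split_ifs with h1 h2 h2
    · refine ⟨(hA'.update (by norm_num) _).update (by norm_num) _, ?_, ?_⟩
      · rw [price_update_var (by norm_num), den, price_update_var (by norm_num), hX']
      · simp [update_var, den, Expr.eval, hv2, h2]
    · refine ⟨(hA'.update (by norm_num) _).update (by norm_num) _, ?_, ?_⟩
      · rw [price_update_var (by norm_num), den, price_update_var (by norm_num), hX']
      · simp [update_var, den, Expr.eval, hv2, h2]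
    · refine ⟨hA'.update (by norm_num) _, ?_, ?_⟩
      · rw [price_update_var (by norm_num), den, hX']
      · simp [update_var, den, hv2, h2]
    · refine ⟨hA'.update (by norm_num) _, ?_, ?_⟩
      · rw [price_update_var (by norm_num), den, hX']
      · simp [update_var, den, hv2, h2]

end Tests

end EPG

/-! ### Improving the record by one pair of cliques, and searching all parameters. -/

namespace EPG

open Cmd Auction

namespace Tests

variable {n : ℕ} {M : Mem} {φA φB : ℕ → Test} {φR : ℕ → ℕ → Test} {A B : ℕ → Prop}
  {R : ℕ → ℕ → Prop}

/-- With `R` as non-adjacency, sets without `R`-edges are cliques. The auction sees only the edges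
between `A` and `B`, so its value counts only when the check has shown both to be cliques. -/
theorem improve_spec (T : Tests n M φA φB φR A B R) (hAB : ∀ v, A v → ¬ B v)
    (hR : ∀ a b, R a b → R b a) {ω : ℕ}
    (hω : ∀ s : Finset ℕ, (∀ v ∈ s, v < n) → (∀ a ∈ s, ∀ b ∈ s, ¬ R a b) → s.card ≤ ω) :
    M (var 0) ≤ den (improve φA φB φR) M (var 0) ∧
      (M (var 0) ≤ ω → den (improve φA φB φR) M (var 0) ≤ ω) ∧
      ((∀ a < n, ∀ b < n, R a b → ¬ ((A a ∧ A b) ∨ (B a ∧ B b))) →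
        (∃ s : Finset ℕ, s.card = ω ∧ (∀ v ∈ s, v < n ∧ (A v ∨ B v)) ∧
          ∀ a ∈ s, ∀ b ∈ s, ¬ R a b) → ω ≤ den (improve φA φB φR) M (var 0)) := by
  classical
  have step : ∀ {M' : Mem} {c : Cmd} {S : Set ℕ}, Agree M M' → c.Ok → c.writes ⊆ S →
      (∀ i ∈ S, i < 10) → Agree M (den c M') :=
    fun h hc hS hS' => h.den hc fun i hi => hS' i (hS hi)
  have a1 := step (Agree.refl M) (ok_check φA φB φR) (writes_check φA φB φR) (by simp)
  have a2 := step a1 ok_reset writes_reset (by simp)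
  have a3 := step a2 (ok_auction φA φB φR) (writes_auction φA φB φR) (by simp)
  have r1 := T.check_spec (Agree.refl M)
  have r2 := den_reset (T.zero_eq a1)
  obtain ⟨i1, i2⟩ := T.auction_spec a2 (fun b hb => (r2 b hb).1) (fun b hb => (r2 b hb).2)
  have c1 := T.count_spec a3
  have v0 : den (count φA φB) (den (auction φA φB φR) (den reset (den (check φA φB φR) M))) (var 0)
      = M (var 0) := by
    rw [den_var (ok_count _ _) (by norm_num) (fun h => by simpa using writes_count _ _ h),
      den_var (ok_auction _ _ _) (by norm_num) (fun h => by simpa using writes_auction _ _ _ h),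
      den_var ok_reset (by norm_num) (fun h => by simpa using writes_reset h),
      den_var (ok_check _ _ _) (by norm_num) (fun h => by simpa using writes_check _ _ _ h)]
  have v1 : den (count φA φB) (den (auction φA φB φR) (den reset (den (check φA φB φR) M))) (var 1)
      = den (check φA φB φR) M (var 1) := by
    rw [den_var (ok_count _ _) (by norm_num) (fun h => by simpa using writes_count _ _ h),
      den_var (ok_auction _ _ _) (by norm_num) (fun h => by simpa using writes_auction _ _ _ h),
      den_var ok_reset (by norm_num) (fun h => by simpa using writes_reset h)]
  rw [improve, den, den, den, den, den]
  simp only [Test.sat_and, Test.sat_lt, Expr.eval_var, Expr.eval, v0, v1, r1, c1]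
  obtain ⟨s, hs, hs1, hs2⟩ := i1.exists_card_eq_value i2 hAB
  have hle := @Inv.card_le_value _ _ _ _ _ _ i1
  generalize price (den (auction φA φB φR) (den reset (den (check φA φB φR) M))) = X at *
  have hval : (∀ a < n, ∀ b < n, R a b → ¬ ((A a ∧ A b) ∨ (B a ∧ B b))) →
      value n A B X ≤ ω := by
    intro hgood
    rw [← hs]
    refine hω s (fun v hv => (hs1 v hv).1) fun a ha b hb hab => ?_
    have hg := hgood a (hs1 a ha).1 b (hs1 b hb).1 hab
    rcases (hs1 a ha).2 with hAa | hBa <;> rcases (hs1 b hb).2 with hAb | hBb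
    · exact hg (.inl ⟨hAa, hAb⟩)
    · exact hs2 a ha b hb hAa hBb hab
    · exact hs2 b hb a ha hAb hBa (hR a b hab)
    · exact hg (.inr ⟨hBa, hBb⟩)
  have hnop : ∀ M' : Mem, den .nop M' = M' := fun _ => rfl
  split_ifs with h
  · rw [den, Function.update_self, Expr.eval_var, c1]
    refine ⟨h.2.le, fun _ => by exact_mod_cast hval h.1, fun hgood => ?_⟩
    rintro ⟨s', hs', h1, h2⟩
    rw [← hs']
    exact_mod_cast hle h1 hAB fun a ha b hb _ _ => h2 a ha b hb
  · rw [hnop, v0]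
    refine ⟨le_rfl, id, fun hgood => ?_⟩
    rintro ⟨s', hs', h1, h2⟩
    have h3 := hle h1 hAB fun a ha b hb _ _ => h2 a ha b hb
    have h4 : ¬ M (var 0) < value n A B X := fun h' => h ⟨hgood, h'⟩
    rw [hs'] at h3
    omega

end Tests

namespace Cmd

/-- Run a command for all values of `t` pairs of variables, the first of which runs through the
addresses of the input and the second through `0`, `1`, `2`. -/
def nest : ℕ → Cmd → Cmd
  | 0, c => c
  | t + 1, c => .rep (10 + 2 * t) 8 1 (.rep (11 + 2 * t) 0 3 (nest t c))

theorem writes_nest {c : Cmd} (hw : ∀ i ∈ c.writes, i < 10) (m : ℕ) :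
    ∀ i ∈ (nest m c).writes, i < 10 + 2 * m := by
  induction m with
  | zero => exact hw
  | succ m ih =>
    rintro i (h | h | h)
    · rw [h]; omega
    · rw [h]; omega
    · have := ih i h
      omega

theorem ok_nest {c : Cmd} (hc : c.Ok) (hw : ∀ i ∈ c.writes, i < 10) {m : ℕ} (hm : m ≤ 24) :
    (nest m c).Ok := by
  induction m with
  | zero => exact hc
  | succ m ih =>
    refine ⟨by omega, ?_, by omega, ?_, ih (by omega)⟩
    · rintro (h | h)
      · exact absurd (show 10 + 2 * m = 11 + 2 * m from h) (by omega)
      · have := writes_nest hw m _ h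
        omega
    · intro h
      have := writes_nest hw m _ h
      omega

/-- `P` is preserved throughout and `Q`, once reached, is never lost. Exhaustive search therefore
attains `Q` if a single choice `J`, `D` of the parameters does. -/
theorem nest_spec {n : ℕ} {c : Cmd} (hc : c.Ok) (hw : ∀ i ∈ c.writes, i < 10)
    {P Q : Mem → Prop} (hP : ∀ M i x, 10 ≤ i → P M → P (Function.update M (var i) x))
    (hQ : ∀ M i x, 10 ≤ i → Q M → Q (Function.update M (var i) x)) (hn : ∀ M, P M → M 0 = n)
    (hbody : ∀ M, P M → (∀ t < 24, 0 ≤ M (var (10 + 2 * t))) →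
      P (den c M) ∧ (Q M → Q (den c M)))
    {J D : ℕ → ℕ} (hJ : ∀ t < 24, J t < 8 * n + 1) (hD : ∀ t < 24, D t < 3)
    (hgood : ∀ M, P M → (∀ t < 24, M (var (10 + 2 * t)) = J t ∧ M (var (11 + 2 * t)) = D t) →
      Q (den c M)) :
    ∀ m ≤ 24, ∀ M, P M → (∀ t, m ≤ t → t < 24 → 0 ≤ M (var (10 + 2 * t))) →
      P (den (nest m c) M) ∧ (Q M → Q (den (nest m c) M)) ∧
        ((∀ t, m ≤ t → t < 24 → M (var (10 + 2 * t)) = J t ∧ M (var (11 + 2 * t)) = D t) →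
          Q (den (nest m c) M)) := by
  intro m
  induction m with
  | zero =>
    intro _ M hPM hpos
    obtain ⟨h1, h2⟩ := hbody M hPM fun t ht => hpos t (by omega) ht
    exact ⟨h1, h2, fun h => hgood M hPM fun t ht => h t (by omega) ht⟩
  | succ m ih =>
    intro hm M hPM hpos
    have hok := ok_nest hc hw hm
    have hsame : ∀ M' : Mem, (∀ j, 12 + 2 * m ≤ j → j < 100 → M' (var j) = M (var j)) →
        ∀ i x, i < 12 + 2 * m →
        ∀ j, 12 + 2 * m ≤ j → j < 100 → Function.update M' (var i) x (var j) = M (var j) := by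
      intro M' h i x hi j hj hj'
      rw [update_var, if_neg (by omega), h j hj hj']
    let G := ∀ t, m + 1 ≤ t → t < 24 → M (var (10 + 2 * t)) = J t ∧ M (var (11 + 2 * t)) = D t
    have := den_rep (I := fun k M' => P M' ∧
        (∀ j, 12 + 2 * m ≤ j → j < 100 → M' (var j) = M (var j)) ∧ (Q M → Q M') ∧
        (G → J m < k → Q M')) hok (hn M hPM) ?_ ?_
    · exact ⟨this.1, this.2.2.1, fun hG => this.2.2.2 hG (hJ m (by omega))⟩
    · exact ⟨hP _ _ _ (by omega) hPM, hsame M (fun _ _ _ => rfl) _ _ (by omega),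
        fun h => hQ _ _ _ (by omega) h, fun _ h => absurd h (Nat.not_lt_zero _)⟩
    · rintro k hk M' ⟨p1, p2, p3, p4⟩ h0 hv
      have := den_rep (I := fun l M'' => P M'' ∧
          (∀ j, 12 + 2 * m ≤ j → j < 100 → M'' (var j) = M (var j)) ∧
          M'' (var (10 + 2 * m)) = k ∧ (Q M → Q M'') ∧ (G → J m < k → Q M'') ∧
          (G → J m = k → D m < l → Q M'')) hok.2.2 h0 ?_ ?_
      · obtain ⟨q1, q2, q3, q4, q5, q6⟩ := this
        refine ⟨hP _ _ _ (by omega) q1, hsame _ q2 _ _ (by omega),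
          fun h => hQ _ _ _ (by omega) (q4 h), fun hG hlt => hQ _ _ _ (by omega) ?_⟩
        rcases Nat.lt_succ_iff_lt_or_eq.1 hlt with hlt | heq
        · exact q5 hG hlt
        · exact q6 hG heq (by have := hD m (by omega); omega)
      · exact ⟨hP _ _ _ (by omega) p1, hsame _ p2 _ _ (by omega),
          by rw [update_var, if_neg (by omega), hv], fun h => hQ _ _ _ (by omega) (p3 h),
          fun hG h => hQ _ _ _ (by omega) (p4 hG h), fun _ _ h => absurd h (Nat.not_lt_zero _)⟩
      · rintro l hl M'' ⟨q1, q2, q3, q4, q5, q6⟩ h0'' hv''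
        have hwn := writes_nest hw m
        have hon := ok_nest hc hw (show m ≤ 24 by omega)
        obtain ⟨r1, r2, r3⟩ := ih (by omega) M'' q1 fun t ht ht' => by
          rcases Nat.lt_or_eq_of_le ht with ht | rfl
          · rw [q2 _ (by omega) (by omega)]
            exact hpos t ht ht'
          · rw [q3]; positivity
        refine ⟨hP _ _ _ (by omega) r1, hsame _ ?_ _ _ (by omega), ?_,
          fun h => hQ _ _ _ (by omega) (r2 (q4 h)), fun hG h => hQ _ _ _ (by omega) (r2 (q5 hG h)),
          fun hG heq hlt => hQ _ _ _ (by omega) ?_⟩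
        · intro j hj hj'
          rw [den_var hon hj' (fun h => by have := hwn j h; omega), q2 j hj hj']
        · rw [update_var, if_neg (by omega),
            den_var hon (by omega) (fun h => by have := hwn _ h; omega), q3]
        · rcases Nat.lt_succ_iff_lt_or_eq.1 hlt with hlt | hlt
          · exact r2 (q6 hG heq hlt)
          · refine r3 fun t ht ht' => ?_
            rcases Nat.lt_or_eq_of_le ht with ht | rfl
            · rw [q2 _ (by omega) (by omega), q2 _ (by omega) (by omega)]
              exact hG t ht ht'
            · exact ⟨by rw [q3, heq], by rw [hv'', hlt]⟩

end Cmd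

end EPG

namespace EPG

open Cmd

/-! ### The program for maximum cliques -/

/-- The memory holds the corners of the paths of the vertices. -/
def Input (n : ℕ) (z : ℕ → ZShape) (M : Mem) : Prop :=
  M 0 = n ∧ ∀ v < n, M (1 + 8 * v) = (z v).e ∧ M (2 + 8 * v) = (z v).a ∧ M (3 + 8 * v) = (z v).c ∧
    M (6 + 8 * v) = (z v).b ∧ M (7 + 8 * v) = (z v).f

/-- A number of the input block of the vertex in the variable `i`. -/
def Expr.coord (o : ℕ) (i : ℕ) : Expr := .load (.add (.const (o + 1)) (.nmul 8 (.var i)))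

theorem Expr.eval_coord {M : Mem} {i v : ℕ} (h : M (EPG.var i) = v) (o : ℕ) :
    (Expr.coord o i).eval M = M ((o : ℤ) + 1 + 8 * v) := by
  simp [coord, eval, h]

/-- The value given by the parameter number `t`: the double of an input number, up to one. -/
def Expr.param (t : ℕ) : Expr :=
  .sub (.add (.nmul 2 (.load (.var (10 + 2 * t)))) (.var (11 + 2 * t))) (.const 1)

theorem Expr.eval_param (M : Mem) (t : ℕ) : (Expr.param t).eval M =
    2 * M (M (EPG.var (10 + 2 * t))) + M (EPG.var (11 + 2 * t)) - 1 := by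
  simp [param, eval]

namespace Test

/-- The test for `ZShape.Within`. -/
def within (k r α β : Expr) (i : ℕ) : Test :=
  .or (.and (.eq k (.const 0))
      (.or (.and (.eq (.nmul 2 (.coord 1 i)) r) (.and
          (.or (.le (.nmul 2 (.coord 2 i)) α) (.le (.add (.nmul 2 (.coord 0 i)) (.const 1)) α))
          (.or (.le β (.nmul 2 (.coord 2 i))) (.le β (.sub (.nmul 2 (.coord 0 i)) (.const 1))))))
        (.and (.eq (.nmul 2 (.coord 5 i)) r) (.and
          (.or (.le (.nmul 2 (.coord 2 i)) α) (.le (.add (.nmul 2 (.coord 6 i)) (.const 1)) α))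
          (.or (.le β (.nmul 2 (.coord 2 i))) (.le β (.sub (.nmul 2 (.coord 6 i)) (.const 1))))))))
    (.and (.not (.eq k (.const 0))) (.and (.eq (.nmul 2 (.coord 2 i)) r) (.and
      (.or (.le (.nmul 2 (.coord 1 i)) α) (.le (.nmul 2 (.coord 5 i)) α))
      (.or (.le β (.nmul 2 (.coord 1 i))) (.le β (.nmul 2 (.coord 5 i)))))))

/-- The test for `ZShape.Ov`. -/
def ov (p q p' q' : Expr) : Test :=
  .and (.or (.or (.lt p p') (.lt p q')) (.or (.lt q p') (.lt q q')))
    (.or (.or (.lt p' p) (.lt p' q)) (.or (.lt q' p) (.lt q' q)))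

theorem sat_ov {M : Mem} {p q p' q' : Expr} : (ov p q p' q').Sat M ↔
    ZShape.Ov (p.eval M) (q.eval M) (p'.eval M) (q'.eval M) := by
  simp only [ov, sat_and, sat_or, sat_lt, ZShape.Ov]
  omega

/-- The test for two distinct vertices whose paths do not share an edge. -/
def apart (i j : ℕ) : Test :=
  .and (.not (.eq (.var i) (.var j))) (.not
    (.or (.and (.eq (.coord 1 i) (.coord 1 j))
        (.ov (.coord 0 i) (.coord 2 i) (.coord 0 j) (.coord 2 j)))
      (.or (.and (.eq (.coord 1 i) (.coord 5 j))
          (.ov (.coord 0 i) (.coord 2 i) (.coord 6 j) (.coord 2 j)))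
        (.or (.and (.eq (.coord 5 i) (.coord 1 j))
            (.ov (.coord 6 i) (.coord 2 i) (.coord 0 j) (.coord 2 j)))
          (.or (.and (.eq (.coord 5 i) (.coord 5 j))
              (.ov (.coord 6 i) (.coord 2 i) (.coord 6 j) (.coord 2 j)))
            (.and (.eq (.coord 2 i) (.coord 2 j))
              (.ov (.coord 1 i) (.coord 5 i) (.coord 1 j) (.coord 5 j))))))))

/-- The test for `Track.Con`. -/
def con (s i : ℕ) : Test :=
  within (.var (11 + 8 * s)) (.param (4 * s + 1)) (.param (4 * s + 2)) (.param (4 * s + 3)) i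

/-- The test for `Track.Touch`. -/
def touch (s i : ℕ) : Test :=
  within (.var (11 + 8 * s)) (.param (4 * s + 1)) (.param (4 * s + 3)) (.param (4 * s + 2)) i

/-- The test for `Track.Cand`. -/
def cand (s i : ℕ) : Test :=
  .or (.and (con s i) (touch (s + 1) i)) (.or (.and (con (s + 1) i) (touch (s + 2) i))
    (.and (con (s + 2) i) (touch s i)))

/-- The test for the first clique. -/
def fst (i : ℕ) : Test := cand 0 i

/-- The test for the difference of the second and the first clique. -/
def snd (i : ℕ) : Test := .and (cand 3 i) (.not (cand 0 i))

end Test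

/-- The interval given by the parameters `4 * s, …, 4 * s + 3`. -/
def track (M : Mem) (s : ℕ) : Track where
  k := M (var (11 + 8 * s))
  r := (Expr.param (4 * s + 1)).eval M
  α := (Expr.param (4 * s + 2)).eval M
  β := (Expr.param (4 * s + 3)).eval M

section

variable {n : ℕ} {z : ℕ → ZShape} {M M' : Mem}

/-- A block of eight cells lists four corners as `e, a, c, a, c, b, f, b`; offsets `3`, `4`, `7`
only repeat `a`, `c`, `b`. -/
theorem Input.coords (hM : Input n z M) (h : Agree M M') {i v : ℕ} (hv : v < n)
    (hi : M' (var i) = v) :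
    (Expr.coord 0 i).eval M' = (z v).e ∧ (Expr.coord 1 i).eval M' = (z v).a ∧
      (Expr.coord 2 i).eval M' = (z v).c ∧ (Expr.coord 5 i).eval M' = (z v).b ∧
        (Expr.coord 6 i).eval M' = (z v).f := by
  obtain ⟨h0, h1, h2, h5, h6⟩ := hM.2 v hv
  simp only [Expr.eval_coord hi]
  rw [← h0, ← h1, ← h2, ← h5, ← h6, ← h.1 (1 + 8 * v) (by positivity),
    ← h.1 (2 + 8 * v) (by positivity), ← h.1 (3 + 8 * v) (by positivity),
    ← h.1 (6 + 8 * v) (by positivity), ← h.1 (7 + 8 * v) (by positivity)]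
  norm_num

/-- Nonnegativity keeps the indirect access inside the input, which `Agree` protects. -/
theorem eval_param_of_agree (hpos : ∀ t < 24, 0 ≤ M (var (10 + 2 * t))) (h : Agree M M') {t : ℕ}
    (ht : t < 24) : (Expr.param t).eval M' = (Expr.param t).eval M := by
  rw [Expr.eval_param, Expr.eval_param, h.2 _ (by omega) (by omega), h.2 _ (by omega) (by omega),
    h.1 _ (hpos t ht)]

theorem Input.sat_within (hM : Input n z M) (h : Agree M M') {i v : ℕ} (hv : v < n)
    (hi : M' (var i) = v) {k r α β : Expr} : (Test.within k r α β i).Sat M' ↔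
      ZShape.Within (k.eval M') (r.eval M') (α.eval M') (β.eval M') (z v) := by
  obtain ⟨h0, h1, h2, h5, h6⟩ := hM.coords h hv hi
  simp only [Test.within, Test.sat_or, Test.sat_and, Test.sat_not, Test.sat_eq, Test.sat_le,
    Expr.eval, Expr.eval_nmul, h0, h1, h2, h5, h6, ZShape.Within, min_le_iff, le_max_iff,
    Nat.cast_ofNat, ne_eq]

theorem Input.sat_con (hM : Input n z M) (hpos : ∀ t < 24, 0 ≤ M (var (10 + 2 * t)))
    (h : Agree M M') {i v : ℕ} (hv : v < n) (hi : M' (var i) = v) {s : ℕ} (hs : s < 6) :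
    (Test.con s i).Sat M' ↔ (track M s).Con (z v) := by
  rw [Test.con, hM.sat_within h hv hi, Expr.eval_var, h.2 _ (by omega) (by omega),
    eval_param_of_agree hpos h (by omega), eval_param_of_agree hpos h (by omega),
    eval_param_of_agree hpos h (by omega)]
  rfl

theorem Input.sat_touch (hM : Input n z M) (hpos : ∀ t < 24, 0 ≤ M (var (10 + 2 * t)))
    (h : Agree M M') {i v : ℕ} (hv : v < n) (hi : M' (var i) = v) {s : ℕ} (hs : s < 6) :
    (Test.touch s i).Sat M' ↔ (track M s).Touch (z v) := by
  rw [Test.touch, hM.sat_within h hv hi, Expr.eval_var, h.2 _ (by omega) (by omega),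
    eval_param_of_agree hpos h (by omega), eval_param_of_agree hpos h (by omega),
    eval_param_of_agree hpos h (by omega)]
  rfl

theorem Input.sat_cand (hM : Input n z M) (hpos : ∀ t < 24, 0 ≤ M (var (10 + 2 * t)))
    (h : Agree M M') {i v : ℕ} (hv : v < n) (hi : M' (var i) = v) {s : ℕ} (hs : s < 4) :
    (Test.cand s i).Sat M' ↔
      Track.Cand (track M s) (track M (s + 1)) (track M (s + 2)) (z v) := by
  simp only [Test.cand, Test.sat_or, Test.sat_and, Track.Cand,
    hM.sat_con hpos h hv hi (show s < 6 by omega), hM.sat_con hpos h hv hi (show s + 1 < 6 by omega),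
    hM.sat_con hpos h hv hi (show s + 2 < 6 by omega),
    hM.sat_touch hpos h hv hi (show s < 6 by omega),
    hM.sat_touch hpos h hv hi (show s + 1 < 6 by omega),
    hM.sat_touch hpos h hv hi (show s + 2 < 6 by omega)]

theorem Input.sat_apart (hM : Input n z M) (h : Agree M M') {i j v w : ℕ} (hv : v < n) (hw : w < n)
    (hi : M' (var i) = v) (hj : M' (var j) = w) :
    (Test.apart i j).Sat M' ↔ v ≠ w ∧ ¬ ZShape.Share (z v) (z w) := by
  obtain ⟨h0, h1, h2, h5, h6⟩ := hM.coords h hv hi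
  obtain ⟨g0, g1, g2, g5, g6⟩ := hM.coords h hw hj
  simp only [Test.apart, Test.sat_or, Test.sat_and, Test.sat_not, Test.sat_eq, Test.sat_ov,
    Expr.eval_var, hi, hj, h0, h1, h2, h5, h6, g0, g1, g2, g5, g6, ZShape.Share, Nat.cast_inj, ne_eq]

theorem Input.tests (hM : Input n z M) (hpos : ∀ t < 24, 0 ≤ M (var (10 + 2 * t))) :
    Tests n M Test.fst Test.snd Test.apart
      (fun v => Track.Cand (track M 0) (track M 1) (track M 2) (z v))
      (fun v => Track.Cand (track M 3) (track M 4) (track M 5) (z v) ∧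
        ¬ Track.Cand (track M 0) (track M 1) (track M 2) (z v))
      (fun v w => v ≠ w ∧ ¬ ZShape.Share (z v) (z w)) where
  n_eq := hM.1
  sat_A _ h _ _ _ hv hi := hM.sat_cand hpos h hv hi (by norm_num)
  sat_B _ h _ _ _ hv hi := and_congr (hM.sat_cand hpos h hv hi (by norm_num))
    (not_congr (hM.sat_cand hpos h hv hi (by norm_num)))
  sat_R _ h _ _ _ _ _ hv _ hw hi hj := hM.sat_apart h hv hw hi hj

end

/-- The command that computes the clique number in the variable `0`. -/
def cliqueCmd : Cmd := nest 24 (improve Test.fst Test.snd Test.apart)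

theorem ok_cliqueCmd : cliqueCmd.Ok :=
  ok_nest (ok_improve _ _ _) (writes_improve _ _ _) le_rfl

theorem exists_param {n : ℕ} {z : ℕ → ZShape} {M : Mem} (hM : Input n z M) {K : Finset ZShape}
    (hK : ∀ u ∈ K, ∃ v < n, u = z v) {x : ℤ} (hx : Track.IsVal K x) :
    ∃ j d : ℕ, j < 8 * n + 1 ∧ d < 3 ∧ 2 * M j + d - 1 = x := by
  obtain ⟨u, hu, y, hy, hxy⟩ := hx
  obtain ⟨v, hv, rfl⟩ := hK u hu
  obtain ⟨h0, h1, h2, h5, h6⟩ := hM.2 v hv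
  obtain ⟨d, hd, hd'⟩ : ∃ d : ℕ, d < 3 ∧ 2 * y + d - 1 = x := by
    rcases hxy with h | h | h
    · exact ⟨0, by omega, by omega⟩
    · exact ⟨1, by omega, by omega⟩
    · exact ⟨2, by omega, by omega⟩
  rcases hy with rfl | rfl | rfl | rfl | rfl
  · exact ⟨1 + 8 * v, d, by omega, hd, by push_cast; rw [h0]; exact hd'⟩
  · exact ⟨3 + 8 * v, d, by omega, hd, by push_cast; rw [h2]; exact hd'⟩
  · exact ⟨7 + 8 * v, d, by omega, hd, by push_cast; rw [h6]; exact hd'⟩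
  · exact ⟨2 + 8 * v, d, by omega, hd, by push_cast; rw [h1]; exact hd'⟩
  · exact ⟨6 + 8 * v, d, by omega, hd, by push_cast; rw [h5]; exact hd'⟩

/-- Parameters for six intervals. -/
theorem exists_params {n : ℕ} {z : ℕ → ZShape} {M : Mem} (hM : Input n z M) {K : Finset ZShape}
    (hK : ∀ u ∈ K, ∃ v < n, u = z v) (T : ℕ → Track) (hT : ∀ s < 6, (T s).Valid K) :
    ∃ J D : ℕ → ℕ, (∀ t < 24, J t < 8 * n + 1) ∧ (∀ t < 24, D t < 3) ∧
      ∀ M' : Mem, (∀ x, 0 ≤ x → M' x = M x) →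
        (∀ t < 24, M' (var (10 + 2 * t)) = J t ∧ M' (var (11 + 2 * t)) = D t) →
        ∀ s < 6, track M' s = T s := by
  have : ∀ t, ∃ j d : ℕ, t < 24 → j < 8 * n + 1 ∧ d < 3 ∧ (t % 4 = 0 → (d : ℤ) = (T (t / 4)).k) ∧
      (t % 4 = 1 → 2 * M j + d - 1 = (T (t / 4)).r) ∧
      (t % 4 = 2 → 2 * M j + d - 1 = (T (t / 4)).α) ∧
      (t % 4 = 3 → 2 * M j + d - 1 = (T (t / 4)).β) := by
    intro t
    by_cases ht : t < 24
    · obtain ⟨hk, hr, hα, hβ⟩ := hT (t / 4) (by omega)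
      obtain h | h | h | h : t % 4 = 0 ∨ t % 4 = 1 ∨ t % 4 = 2 ∨ t % 4 = 3 := by omega
      -- The kind of the interval is read directly from `d`, so the address is arbitrary.
      · rcases hk with hk | hk
        · exact ⟨0, 0, fun _ => ⟨by omega, by omega, by omega, by omega, by omega, by omega⟩⟩
        · exact ⟨0, 1, fun _ => ⟨by omega, by omega, by omega, by omega, by omega, by omega⟩⟩
      · obtain ⟨j, d, hj, hd, hjd⟩ := exists_param hM hK hr
        exact ⟨j, d, fun _ => ⟨hj, hd, by omega, fun _ => hjd, by omega, by omega⟩⟩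
      · obtain ⟨j, d, hj, hd, hjd⟩ := exists_param hM hK hα
        exact ⟨j, d, fun _ => ⟨hj, hd, by omega, by omega, fun _ => hjd, by omega⟩⟩
      · obtain ⟨j, d, hj, hd, hjd⟩ := exists_param hM hK hβ
        exact ⟨j, d, fun _ => ⟨hj, hd, by omega, by omega, by omega, fun _ => hjd⟩⟩
    · exact ⟨0, 0, fun h => absurd h ht⟩
  choose J D hJD using this
  refine ⟨J, D, fun t ht => (hJD t ht).1, fun t ht => (hJD t ht).2.1, fun M' hM' hpar s hs => ?_⟩
  have hval : ∀ t < 24, (Expr.param t).eval M' = 2 * M (J t) + D t - 1 := by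
    intro t ht
    rw [Expr.eval_param, (hpar t ht).1, (hpar t ht).2, hM' _ (by positivity)]
  have h0 := (hJD (4 * s) (by omega)).2.2.1 (by omega)
  have h1 := (hJD (4 * s + 1) (by omega)).2.2.2.1 (by omega)
  have h2 := (hJD (4 * s + 2) (by omega)).2.2.2.2.1 (by omega)
  have h3 := (hJD (4 * s + 3) (by omega)).2.2.2.2.2 (by omega)
  rw [show 4 * s / 4 = s by omega] at h0
  rw [show (4 * s + 1) / 4 = s by omega] at h1
  rw [show (4 * s + 2) / 4 = s by omega] at h2
  rw [show (4 * s + 3) / 4 = s by omega] at h3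
  have hk := (hpar (4 * s) (by omega)).2
  rw [show 11 + 2 * (4 * s) = 11 + 8 * s by ring] at hk
  rw [track, hval _ (by omega), hval _ (by omega), hval _ (by omega), h1, h2, h3, hk, h0]

/-- The command computes the maximum size of a set of pairwise adjacent vertices. -/
theorem den_cliqueCmd {n : ℕ} {z : ℕ → ZShape} {M : Mem} (hM : Input n z M) (h0 : M (var 0) = 0)
    {ω : ℕ}
    (hω : ∀ s : Finset ℕ, (∀ v ∈ s, v < n) →
      (∀ a ∈ s, ∀ b ∈ s, ¬ (a ≠ b ∧ ¬ ZShape.Share (z a) (z b))) → s.card ≤ ω)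
    (hω' : ∃ s : Finset ℕ, s.card = ω ∧ (∀ v ∈ s, v < n) ∧
      ∀ a ∈ s, ∀ b ∈ s, ¬ (a ≠ b ∧ ¬ ZShape.Share (z a) (z b))) :
    den cliqueCmd M (var 0) = ω := by
  classical
  obtain ⟨s, hs, hsn, hsR⟩ := hω'
  have hokc := ok_improve Test.fst Test.snd Test.apart
  have hwc := writes_improve Test.fst Test.snd Test.apart
  -- The upper bound on the record holds for every choice of parameters; the covering theorem is
  -- needed only to attain `ω`.
  let P : Mem → Prop := fun M' => (∀ x, 0 ≤ x → M' x = M x) ∧ 0 ≤ M' (var 0) ∧ M' (var 0) ≤ ω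
  have hin : ∀ M' : Mem, P M' → Input n z M' := by
    intro M' h
    refine ⟨(h.1 0 le_rfl).trans hM.1, fun v hv => ?_⟩
    rw [h.1 _ (by positivity), h.1 _ (by positivity), h.1 _ (by positivity), h.1 _ (by positivity),
      h.1 _ (by positivity)]
    exact hM.2 v hv
  have himp : ∀ M' : Mem, P M' → (∀ t < 24, 0 ≤ M' (var (10 + 2 * t))) → _ := fun M' h hp =>
    ((hin M' h).tests hp).improve_spec (fun v hA hB => hB.2 hA)
      (fun a b hab => ⟨hab.1.symm, fun hs => hab.2 hs.symm⟩) hω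
  have hPM : P M := ⟨fun _ _ => rfl, h0.ge, by rw [h0]; positivity⟩
  have hPden : ∀ M' : Mem, P M' → (∀ t < 24, 0 ≤ M' (var (10 + 2 * t))) →
      P (den (improve Test.fst Test.snd Test.apart) M') := fun M' h hp =>
    ⟨fun x hx => (den_nonneg hokc hx M').trans (h.1 x hx),
      h.2.1.trans (himp M' h hp).1, (himp M' h hp).2.1 h.2.2⟩
  have hPup : ∀ (M' : Mem) i x, 10 ≤ i → P M' → P (Function.update M' (var i) x) := by
    rintro M' i x hi ⟨h1, h2⟩
    refine ⟨fun y hy => ?_, ?_⟩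
    · rw [Function.update_of_ne (by unfold var; omega), h1 y hy]
    · rw [update_var, if_neg (by omega)]
      exact h2
  have hQup : ∀ (M' : Mem) i x, 10 ≤ i → (ω : ℤ) ≤ M' (var 0) →
      (ω : ℤ) ≤ Function.update M' (var i) x (var 0) := by
    intro M' i x hi h
    rw [update_var, if_neg (by omega)]
    exact h
  have hbody : ∀ M' : Mem, P M' → (∀ t < 24, 0 ≤ M' (var (10 + 2 * t))) →
      P (den (improve Test.fst Test.snd Test.apart) M') ∧ ((ω : ℤ) ≤ M' (var 0) →
        (ω : ℤ) ≤ den (improve Test.fst Test.snd Test.apart) M' (var 0)) := fun M' h hp =>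
    ⟨hPden M' h hp, fun hQ => hQ.trans (himp M' h hp).1⟩
  have hpos : ∀ t, 24 ≤ t → t < 24 → 0 ≤ M (var (10 + 2 * t)) := fun t ht ht' => by omega
  have hn : ∀ M' : Mem, P M' → M' 0 = n := fun M' h => (hin M' h).1
  -- The covering theorem needs a nonempty clique. If `ω = 0`, the bounds in `P` already decide the
  -- result.
  rcases s.eq_empty_or_nonempty with rfl | hne
  · have := nest_spec (n := n) hokc hwc (Q := fun _ => True) hPup (fun _ _ _ _ h => h) hn
      (fun M' h hp => ⟨hPden M' h hp, id⟩) (J := fun _ => 0) (D := fun _ => 0)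
      (fun _ _ => by omega) (fun _ _ => by omega) (fun _ _ _ => trivial) 24 le_rfl M hPM hpos
    refine le_antisymm this.1.2.2 ?_
    rw [← hs]
    exact this.1.2.1
  -- Several vertices may have the same shape. Candidates are predicates on shapes, so covering the
  -- image of `s` covers all of its vertices.
  · obtain ⟨Y, Y', ⟨T₁, T₂, T₃, v₁, v₂, v₃, hY, hYc⟩, ⟨T₄, T₅, T₆, v₄, v₅, v₆, hY', hYc'⟩, hcov⟩ :=
      Track.covered (K := s.image z) (hne.image z) (by
        intro u hu v hv
        obtain ⟨a, ha, rfl⟩ := Finset.mem_image.1 hu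
        obtain ⟨b, hb, rfl⟩ := Finset.mem_image.1 hv
        by_cases hab : a = b
        · rw [hab]; exact ZShape.share_self _
        · by_contra hc
          exact hsR a ha b hb ⟨hab, hc⟩)
    let T : ℕ → Track := fun i => if i = 0 then T₁ else if i = 1 then T₂ else if i = 2 then T₃ else
      if i = 3 then T₄ else if i = 4 then T₅ else T₆
    obtain ⟨J, D, hJ, hD, hJD⟩ := exists_params hM (K := s.image z)
      (fun u hu => by
        obtain ⟨a, ha, rfl⟩ := Finset.mem_image.1 hu
        exact ⟨a, hsn a ha, rfl⟩) T (by
        intro i _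
        simp only [T]
        split_ifs <;> assumption)
    have := nest_spec (n := n) hokc hwc (Q := fun M' => (ω : ℤ) ≤ M' (var 0)) hPup hQup hn hbody
      hJ hD (fun M' h hpar => ?_) 24 le_rfl M hPM hpos
    · exact le_antisymm this.1.2.2 (this.2.2 fun t ht ht' => absurd ht (by omega))
    · have hp : ∀ t < 24, 0 ≤ M' (var (10 + 2 * t)) := fun t ht => by
        rw [(hpar t ht).1]; positivity
      have htr := hJD M' h.1 hpar
      have hA : Track.Cand (track M' 0) (track M' 1) (track M' 2) = Y := by
        rw [htr 0 (by omega), htr 1 (by omega), htr 2 (by omega), hY]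
        rfl
      have hB : Track.Cand (track M' 3) (track M' 4) (track M' 5) = Y' := by
        rw [htr 3 (by omega), htr 4 (by omega), htr 5 (by omega), hY']
        rfl
      have := (himp M' h hp).2.2
      rw [hA, hB] at this
      refine this ?_ ⟨s, hs, fun v hv => ⟨hsn v hv, ?_⟩, hsR⟩
      · rintro a - b - hab (⟨h1, h2⟩ | ⟨h1, h2⟩)
        · exact hab.2 (hYc _ _ h1 h2)
        · exact hab.2 (hYc' _ _ h1.1 h2.1)
      · have := hcov (z v) (Finset.mem_image_of_mem z hv)
        tauto

theorem getD_flatMap {α : Type*} (f : α → List ℤ) {m : ℕ} (l : List α)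
    (hf : ∀ a ∈ l, (f a).length = m) (v o : ℕ) (hv : v < l.length) (ho : o < m) :
    (l.flatMap f).getD (m * v + o) 0 = (f l[v]).getD o 0 := by
  induction l generalizing v with
  | nil => simp at hv
  | cons a l ih =>
    have ha := hf a (by simp)
    rw [List.flatMap_cons]
    cases v with
    | zero =>
      rw [mul_zero, zero_add, List.getD_append _ _ _ _ (by omega)]
      rfl
    | succ v =>
      rw [List.getD_append_right _ _ _ _ (by rw [ha, mul_add]; omega), ha,
        show m * (v + 1) + o - m = m * v + o by rw [mul_add]; omega]
      exact ih (fun a ha => hf a (by simp [ha])) v (by simpa using hv)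

end EPG

/-! ### From the encoded representation to the theorem. -/

namespace EPG

open Cmd

instance : Inhabited ZShape := ⟨⟨0, 1, 0, 0, 1, by norm_num, by norm_num, by norm_num⟩⟩

theorem exists_shapes {n : ℕ} {G : SimpleGraph (Fin n)} (R : BendRep 2 G)
    (hR : ∀ v, (R.path v).IsZ) : ∃ z : ℕ → ZShape, Input n z (Mem.ofList R.encode) ∧
      ∀ u v : Fin n, G.Adj u v ↔ u ≠ v ∧ ZShape.Share (z u) (z v) := by
  choose z hz hz' using fun v => (R.path v).exists_zShape (R.bends_le v) (hR v)
  refine ⟨fun v => if h : v < n then z ⟨v, h⟩ else default, ⟨?_, fun v hv => ?_⟩, fun u v => ?_⟩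
  · simp [Mem.ofList, BendRep.encode]
  · have key : ∀ o : ℕ, o < 8 → Mem.ofList R.encode ((o + 1 : ℕ) + 8 * v) =
        ((R.path ⟨v, hv⟩).corners.flatMap (fun p => [p.1, p.2])).getD o 0 := by
      intro o ho
      rw [Mem.ofList, if_pos (by positivity), BendRep.encode,
        show (((o + 1 : ℕ) : ℤ) + 8 * (v : ℤ)).toNat = (8 * v + o) + 1 by omega,
        List.getD_cons_succ, getD_flatMap _ _ (fun w _ => by rw [hz]; rfl) v o (by simpa) ho,
        List.getElem_finRange]
      rfl
    have h0 := key 0 (by norm_num)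
    have h1 := key 1 (by norm_num)
    have h2 := key 2 (by norm_num)
    have h5 := key 5 (by norm_num)
    have h6 := key 6 (by norm_num)
    rw [hz] at h0 h1 h2 h5 h6
    simp only [dif_pos hv]
    exact ⟨h0, h1, h2, h5, h6⟩
  · rw [R.adj_iff, ZShape.share_iff_exists_edge]
    simp only [Fin.is_lt, dif_pos, hz']

end EPG

theorem mainTheorem2 :
    ∃ (c : EPG.Program) (p : Polynomial ℕ),
      ∀ (n : ℕ) (G : SimpleGraph (Fin n)) (R : EPG.BendRep 2 G),
        (∀ v, (R.path v).IsZ) →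
          ∃ (t : ℕ) (M : EPG.Mem),
            EPG.Runs c (EPG.Mem.ofList R.encode) t M ∧ t ≤ p.eval n ∧ M 0 = (G.cliqueNum : ℤ) := by
  refine ⟨.seq EPG.cliqueCmd.compile (.store (.const 0) (.var 0)),
    EPG.cliqueCmd.time + Polynomial.C 4, fun n G R hR => ?_⟩
  obtain ⟨z, hz, hadj⟩ := EPG.exists_shapes R hR
  obtain ⟨t, ht, hruns⟩ := EPG.Cmd.runs_compile EPG.ok_cliqueCmd hz.1
  have hval := EPG.den_cliqueCmd hz (by simp [EPG.Mem.ofList, EPG.var]) (ω := G.cliqueNum)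
    (fun s hs hclique => by
      rw [← Finset.card_attachFin s hs]
      refine SimpleGraph.IsClique.card_le_cliqueNum (tc := fun a ha b hb hab => ?_)
      rw [hadj]
      refine ⟨hab, ?_⟩
      by_contra hc
      exact hclique a (Finset.mem_attachFin hs |>.1 ha) b (Finset.mem_attachFin hs |>.1 hb)
        ⟨fun h => hab (Fin.ext h), hc⟩)
    (by
      obtain ⟨s, hs⟩ := G.exists_isNClique_cliqueNum
      refine ⟨s.map Fin.valEmbedding, by rw [Finset.card_map, hs.card_eq], ?_, ?_⟩
      · intro v hv
        obtain ⟨a, -, rfl⟩ := Finset.mem_map.1 hv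
        exact a.2
      · intro a ha b hb
        obtain ⟨a, ha', rfl⟩ := Finset.mem_map.1 ha
        obtain ⟨b, hb', rfl⟩ := Finset.mem_map.1 hb
        rintro ⟨hab, hc⟩
        exact hc ((hadj a b).1 (hs.isClique ha' hb' fun h => hab (by rw [h]))).2)
  -- Copying the result to cell `0` takes 4 steps. It comes last because the loop bounds read `n`
  -- from that cell.
  refine ⟨t + 4, _, .seq hruns (.store _ _ _), ?_, ?_⟩
  · rw [Polynomial.eval_add, Polynomial.eval_C]
    omega
  · simp only [EPG.Expr.eval, EPG.Expr.eval_var, Function.update_self]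
    exact hval
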